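/- All spaces are compactly generated (weak Hausdorff $k$-spaces); products, subspaces and mapping spaces are formed in that category, and a topological monoid is a monoid in it, with unit $*$ as basepoint. A weak equivalence is a continuous map inducing bijections on $\pi_0$ and on $\pi_k$, $k\ge 1$, for all basepoints. A monoid is well-pointed if the inclusion of its unit has the homotopy extension property. Let $n\in\{1,2,\dots,\infty\}$. An $A_n$-map $f=(f,\{f_i\},\ell)\colon G\to G'$ between topological monoids consists of a number $\ell\in[0,\infty)$ (its size), a pointed map $f\colon G\to G'$, and maps $f_i\colon[0,\infty]^{i-1}\times G^{i}\to G'$ for $1\le i\le n$, $i<\infty$, such that (i) $f_1=f$; (ii) $f_i(t_1,\dots,t_{k-1},0,t_k,\dots,t_{i-2};g_1,\dots,g_i)=f_{i-1}(t_1,\dots,t_{i-2};g_1,\dots,g_kg_{k+1},\dots,g_i)$ for $1\le k<i$; (iii) $f_i(t_1,\dots,t_{k-1},t,t_k,\dots,t_{i-2};g_1,\dots,g_i)=f_k(t_1,\dots,t_{k-1};g_1,\dots,g_k)\,f_{i-k}(t_k,\dots,t_{i-2};g_{k+1},\dots,g_i)$ for $1\le k<i$ and $t\ge\ell$; (iv)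 $f_i(\mathbf t;g_1,\dots,g_{k-1},*,g_{k+1},\dots,g_i)=f_{i-1}(\sigma_k(\mathbf t);g_1,\dots,g_{k-1},g_{k+1},\dots,g_i)$ for $i\ge2$ and $1\le k\le i$, where $\sigma_k(t_1,\dots,t_{i-1})$ is $(t_2,\dots,t_{i-1})$ if $k=1$, $(t_1,\dots,t_{i-2})$ if $k=i$, and $(t_1,\dots,t_{k-2},\max\{t_{k-1},t_k\},t_{k+1},\dots,t_{i-1})$ otherwise. Let $\mathcal A_n(G,G')$ be the space of $A_n$-maps, a subspace of $[0,\infty)\times\prod_i\mathrm{Map}([0,\infty]^{i-1}\times G^i,G')$. The composite of $f\in\mathcal A_n(G,G')$ of size $\ell$ and $f'\in\mathcal A_n(G',G'')$ of size $\ell'$ is the $A_n$-map $f'\circ f=(f'\circ f,\{F_i\},\ell+\ell')$ with $$F_i(\mathbf s_1,t_1+\ell,\mathbf s_2,t_2+\ell,\dots,t_{r-1}+\ell,\mathbf s_r;\mathbf g_1,\dots,\mathbf g_r)=f'_r(t_1,\dots,t_{r-1};f_{i_1}(\mathbf s_1;\mathbf g_1),\dots,f_{i_r}(\mathbf s_r;\mathbf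 g_r))$$ for $i=i_1+\dots+i_r$ with all $i_k\ge1$, $t_k\in[0,\infty]$, $\mathbf s_k\in[0,\ell]^{i_k-1}$, $\mathbf g_k\in G^{i_k}$. The identity of $G$ in $\mathcal A_n$ is $\mathrm{id}_G$ with the $A_n$-form $(\mathbf t;g_1,\dots,g_i)\mapsto g_1\cdots g_i$ of size $0$. An $A_n$-map $f$ is a weak $A_n$-equivalence if $f_1$ is a weak equivalence. **Proposition.** Let $G,G',H,H'$ be topological monoids, and suppose that $G$ and $H$ are well-pointed and homotopy equivalent to CW complexes. Let $f\colon G\to H$ and $f'\colon G'\to H'$ be weak $A_n$-equivalences. Then the maps $$f^{\#}\colon\mathcal A_n(H,G')\to\mathcal A_n(G,G'),\ h\mapsto h\circ f,\qquad f'_{\#}\colon\mathcal A_n(H,G')\to\mathcal A_n(H,H'),\ h\mapsto f'\circ h,$$ are weak equivalences. Consequently $f$ is invertible in the homotopy category $\pi_0\mathcal A_n$: there is $e\in\mathcal A_n(H,G)$ such that $e\circ f$ lies in the path component of $\mathrm{id}_G$ in $\mathcal A_n(G,G)$ and $f\circ e$ lies in the path component of $\mathrm{id}_H$ in $\mathcal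 A_n(H,H)$. -/

import Mathlib

open Topology Set
open scoped ENNReal NNReal

universe u

/-! ### Compactly generated spaces -/

/-- The family of all compact Hausdorff spaces, used as test spaces. -/
abbrev KTest (K : CompHaus.{u}) : Type u := K

/-- The maps from (the compactly generated space associated with) `X` to `Y`: the functions whose
composite with every continuous map from a compact Hausdorff space to `X` is continuous.
For `X` a product, this means continuity for the product formed in compactly generated spaces. The
type carries Mathlib's topology, the compact-open one tested on maps from compact Hausdorff
spaces. -/
abbrev KMap (X Y : Type u) [TopologicalSpace X] [TopologicalSpace Y] : Type u :=
  ContinuousMapGeneratedBy KTest.{u} X Y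

/-- Weak Hausdorff spaces: continuous images of compact Hausdorff spaces are closed. -/
class WeakHausdorffSpace (X : Type u) [TopologicalSpace X] : Prop where
  isClosed_range : ∀ (K : CompHaus.{u}) (p : C(K, X)), IsClosed (Set.range p)

/-- A topological monoid in the category of compactly generated (weak Hausdorff) spaces; the
multiplication is continuous on the product formed in that category. -/
class CGMonoid (G : Type u) [Monoid G] [TopologicalSpace G] : Prop where
  compactlyGenerated : CompactlyGeneratedSpace G
  weakHausdorff : WeakHausdorffSpace G
  continuous_mul : ContinuousGeneratedBy KTest.{u} (fun p : G × G => p.1 * p.2)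

/-- The inclusion of the unit has the homotopy extension property. -/
def WellPointed (G : Type u) [Monoid G] [TopologicalSpace G] : Prop :=
  ∀ (Z : Type u) [TopologicalSpace Z] (f : C(G, Z)) (γ : C(unitInterval, Z)), γ 0 = f 1 →
    ∃ F : C(unitInterval × G, Z), (∀ g, F (0, g) = f g) ∧ ∀ s, F (s, 1) = γ s

/-- The space `X` is homotopy equivalent to a CW complex. -/
def HasCWType (X : Type u) [TopologicalSpace X] : Prop :=
  ∃ (Y : Type u) (_ : TopologicalSpace Y) (_ : T2Space Y),
    Nonempty (CWComplex (Set.univ : Set Y)) ∧ Nonempty (ContinuousMap.HomotopyEquiv X Y)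

/-! ### Weak equivalences -/

section WeakEquivalence

variable {X Y : Type*} [TopologicalSpace X] [TopologicalSpace Y]

/-- The map induced on path components. -/
def pi0Map (φ : C(X, Y)) : ZerothHomotopy X → ZerothHomotopy Y :=
  Quotient.map' φ fun _ _ h => h.map φ.continuous

/-- The map induced on based maps of cubes. -/
def genLoopMap (φ : C(X, Y)) (N : Type) (x : X) (p : GenLoop N X x) : GenLoop N Y (φ x) :=
  ⟨φ.comp p.1, fun y hy => congrArg φ (p.2 y hy)⟩

/-- The map induced on the homotopy group `π_k`. -/
def piMap (φ : C(X, Y)) (k : ℕ) (x : X) :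
    HomotopyGroup.Pi k X x → HomotopyGroup.Pi k Y (φ x) :=
  Quotient.map (genLoopMap φ (Fin k) x) fun _ _ h => h.map fun F => F.compContinuousMap φ

/-- A weak equivalence: a continuous map that is bijective on path components and on all higher
homotopy groups at all basepoints. -/
def IsWeakHomotopyEquiv (φ : X → Y) : Prop :=
  ∃ hφ : Continuous φ, Function.Bijective (pi0Map ⟨φ, hφ⟩) ∧
    ∀ (k : ℕ) (x : X), Function.Bijective (piMap ⟨φ, hφ⟩ (k + 1) x)

end WeakEquivalence

/-! ### `A_n`-maps -/

theorem enat_lt_of_le {n : ℕ∞} {a b : ℕ} (hb : (b : ℕ∞) < n) (hab : a ≤ b) : (a : ℕ∞) < n :=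
  lt_of_le_of_lt (by exact_mod_cast hab) hb

/-- The degeneracy `σ_k` of cubes: it drops the first coordinate for the first index, drops the last
coordinate for the last index, and otherwise replaces the two neighbouring coordinates by their
maximum. With indices starting from `0`. -/
noncomputable def cubeDegen {p : ℕ} (k : Fin (p + 2)) (T : Fin (p + 1) → ℝ≥0∞) (j : Fin p) : ℝ≥0∞ :=
  if (j : ℕ) + 1 < k then T j.castSucc
  else if (j : ℕ) + 1 = k then max (T j.castSucc) (T j.succ)
  else T j.succ

/-- An `A_n`-map, `n ∈ {1, 2, …, ∞}`. The component `form m` is the map usually called `f_{m+1}`,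
`[0,∞]^m × G^{m+1} → G'`; it exists for `m + 1 ≤ n`. -/
structure AnMap (n : ℕ∞) (G G' : Type u) [Monoid G] [TopologicalSpace G]
    [Monoid G'] [TopologicalSpace G'] where
  size : ℝ≥0
  form : ∀ m : ℕ, (m : ℕ∞) < n → KMap ((Fin m → ℝ≥0∞) × (Fin (m + 1) → G)) G'
  /-- The underlying map is pointed. -/
  map_one : ∀ (h : ((0 : ℕ) : ℕ∞) < n) (T : Fin 0 → ℝ≥0∞), form 0 h (T, fun _ => 1) = 1
  /-- On the face where a parameter is `0`, two neighbouring elements are multiplied. -/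
  face_zero : ∀ (p : ℕ) (h : ((p + 1 : ℕ) : ℕ∞) < n) (k : Fin (p + 1)) (T : Fin p → ℝ≥0∞)
    (g : Fin (p + 2) → G),
    form (p + 1) h (k.insertNth (0 : ℝ≥0∞) T, g) =
      form p (enat_lt_of_le h p.le_succ) (T, Fin.contractNth k.castSucc (· * ·) g)
  /-- Where a parameter `t` is at least the size, the map is the product of the values before and
  after it. -/
  face_ge : ∀ (p : ℕ) (h : ((p + 1 : ℕ) : ℕ∞) < n) (k : Fin (p + 1)) (t : ℝ≥0∞)
    (_ : (size : ℝ≥0∞) ≤ t) (T : Fin p → ℝ≥0∞) (g : Fin (p + 2) → G),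
    form (p + 1) h (k.insertNth t T, g) =
      form k (enat_lt_of_le h (by omega))
          (fun j : Fin k => T ⟨j, by omega⟩, fun j : Fin (k + 1) => g ⟨j, by omega⟩) *
        form (p - k) (enat_lt_of_le h (by omega))
          (fun j : Fin (p - k) => T ⟨k + j, by omega⟩,
            fun j : Fin (p - k + 1) => g ⟨k + 1 + j, by omega⟩)
  /-- A unit among the arguments can be omitted. -/
  degen : ∀ (p : ℕ) (h : ((p + 1 : ℕ) : ℕ∞) < n) (k : Fin (p + 2)) (T : Fin (p + 1) → ℝ≥0∞)
    (g : Fin (p + 2) → G), g k = 1 →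
    form (p + 1) h (T, g) =
      form p (enat_lt_of_le h p.le_succ) (cubeDegen k T, k.removeNth g)

namespace AnMap

variable {n : ℕ∞} {G G' G'' : Type u} [Monoid G] [TopologicalSpace G]
  [Monoid G'] [TopologicalSpace G'] [Monoid G''] [TopologicalSpace G'']

/-- The space `A_n(G, G')` of `A_n`-maps: the subspace of `[0,∞) × ∏ Map([0,∞]^m × G^{m+1}, G')`,
in compactly generated spaces. -/
instance : TopologicalSpace (AnMap n G G') :=
  letI : TopologicalSpace (AnMap n G G') :=
    .induced (fun f => (f.size, fun m : {m : ℕ // (m : ℕ∞) < n} => f.form m.1 m.2)) inferInstance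
  .generatedBy KTest.{u}

/-- The underlying map `f_1` of an `A_n`-map. -/
def underlying (hn : 1 ≤ n) (f : AnMap n G G') (g : G) : G' :=
  f.form 0 (lt_of_lt_of_le (by simp) hn) (Fin.elim0, fun _ => g)

/-- Weak `A_n`-equivalences. -/
def IsWeakEquiv (hn : 1 ≤ n) (f : AnMap n G G') : Prop :=
  IsWeakHomotopyEquiv (f.underlying hn)

/-! #### Words

A point `(t_1, …, t_m; g_1, …, g_{m+1})` is written as the list
`(0, g_1), (t_1, g_2), …, (t_m, g_{m+1})`; the first parameter never matters. -/

/-- The list of a point of `[0,∞]^m × G^{m+1}`. -/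
def word {m : ℕ} (T : Fin m → ℝ≥0∞) (g : Fin (m + 1) → G) : List (ℝ≥0∞ × G) :=
  (0, g 0) :: List.ofFn fun j : Fin m => (T j, g j.succ)

open Classical in
/-- The value of an `A_n`-map on a word: `f_i(t_1, …, t_{i-1}; g_1, …, g_i)`. It is `1` on the empty
word and, as a dummy value, on words of length greater than `n`. -/
noncomputable def eval (f : AnMap n G G') : List (ℝ≥0∞ × G) → G'
  | [] => 1
  | x :: l =>
    if h : (l.length : ℕ∞) < n then
      f.form l.length h (fun j => l[j].1, Fin.cons x.2 fun j => l[j].2)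
    else 1

/-- Processing of one letter, from right to left, of a word with cuts in front of the letters that
are marked `true`. The first component of the state is the block that is not yet closed, the second
one is the list of the blocks already closed: each is recorded through the value of `f` on it, and
the parameter `t` of the cut in front of it, lowered to `t - ℓ`. -/
noncomputable def step (f : AnMap n G G') (x : Bool × ℝ≥0∞ × G)
    (s : List (ℝ≥0∞ × G) × List (ℝ≥0∞ × G')) : List (ℝ≥0∞ × G) × List (ℝ≥0∞ × G') :=
  if x.1 then ([], (x.2.1 - f.size, f.eval (x.2 :: s.1)) :: s.2) else (x.2 :: s.1, s.2)

/-- For a word cut into blocks `(s_1; g_1), …, (s_r; g_r)` at parameters `t_1 + ℓ, …, t_{r-1} + ℓ`: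
the value `f'_r(t_1, …, t_{r-1}; f(s_1; g_1), …, f(s_r; g_r))`. -/
noncomputable def cutEval (f' : AnMap n G' G'') (f : AnMap n G G') (L : List (Bool × ℝ≥0∞ × G)) :
    G'' :=
  f'.eval (L.foldr f.step ([], [])).2

open Classical in
/-- The marking of a word: cuts are made in front of the first letter and at the parameters
`t > ℓ`. -/
noncomputable def mark (l : ℝ≥0) : List (ℝ≥0∞ × G) → List (Bool × ℝ≥0∞ × G)
  | [] => []
  | x :: w => (true, x) :: w.map fun y => (decide ((l : ℝ≥0∞) < y.1), y)

/-- The composite of two `A_n`-maps, on words. -/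
noncomputable def compEval (f' : AnMap n G' G'') (f : AnMap n G G') (w : List (ℝ≥0∞ × G)) : G'' :=
  cutEval f' f (mark f.size w)

theorem eval_eq (f : AnMap n G G') {l : List (ℝ≥0∞ × G)} {m : ℕ} (h : (m : ℕ∞) < n)
    (T : Fin m → ℝ≥0∞) (g : Fin (m + 1) → G) (hl : l.length = m + 1)
    (hT : ∀ (j : ℕ) (hj : j < m), T ⟨j, hj⟩ = (l[j + 1]'(by omega)).1)
    (hg : ∀ (j : ℕ) (hj : j < m + 1), g ⟨j, hj⟩ = (l[j]'(by omega)).2) :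
    f.eval l = f.form m h (T, g) := by
  cases l with
  | nil => simp at hl
  | cons x l =>
    obtain rfl : l.length = m := by simpa using hl
    rw [eval, dif_pos h]
    congr 2
    · funext j
      simpa using (hT j j.2).symm
    · funext j
      refine Fin.cases ?_ (fun j => ?_) j
      · simpa using (hg 0 (by omega)).symm
      · exact (hg (j + 1) (by omega)).symm

theorem eval_head (f : AnMap n G G') (t t' : ℝ≥0∞) (a : G) (l : List (ℝ≥0∞ × G)) :
    f.eval ((t, a) :: l) = f.eval ((t', a) :: l) := rfl

theorem eval_one (f : AnMap n G G') (t : ℝ≥0∞) : f.eval [(t, 1)] = 1 := by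
  by_cases h : ((0 : ℕ) : ℕ∞) < n
  · rw [f.eval_eq h Fin.elim0 (fun _ => 1) rfl (by intro j hj; omega) (by
      intro j hj
      obtain rfl : j = 0 := by omega
      rfl)]
    exact f.map_one h _
  · rw [eval, dif_neg (by simpa using h)]

theorem insertNth_mk {α : Type*} {p : ℕ} (k : Fin (p + 1)) (x : α) (T : Fin p → α) (j : ℕ)
    (hj : j < p + 1) : (k.insertNth x T : Fin (p + 1) → α) ⟨j, hj⟩ =
      if h : j < k then T ⟨j, by omega⟩ else if h' : j = k then x else T ⟨j - 1, by omega⟩ := by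
  split_ifs with h h'
  · rw [Fin.insertNth_apply_below (by exact h)]
    simp
    rfl
  · subst h'
    simp
  · rw [Fin.insertNth_apply_above (by change (k : ℕ) < j; omega)]
    simp
    rfl

theorem eval_zero (f : AnMap n G G') (u v : List (ℝ≥0∞ × G)) (t : ℝ≥0∞) (c b : G)
    (hn : ((u.length + 2 + v.length : ℕ) : ℕ∞) ≤ n) :
    f.eval (u ++ (t, c) :: (0, b) :: v) = f.eval (u ++ (t, c * b) :: v) := by
  have h : ((u.length + v.length + 1 : ℕ) : ℕ∞) < n :=
    lt_of_lt_of_le (by exact_mod_cast (by omega)) hn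
  have hlen : (u ++ (t, c * b) :: v).length = u.length + v.length + 1 := by simp; omega
  rw [f.eval_eq (m := u.length + v.length + 1) h
    ((⟨u.length, by omega⟩ : Fin (u.length + v.length + 1)).insertNth (0 : ℝ≥0∞)
      fun j => ((u ++ (t, c * b) :: v)[(j : ℕ) + 1]'(by omega)).1)
    (fun j => ((u ++ (t, c) :: (0, b) :: v)[(j : ℕ)]'(by simp; omega)).2) (by simp; omega) ?_
    (fun _ _ => rfl), f.face_zero]
  · symm
    apply f.eval_eq _ _ _ hlen (fun _ _ => rfl)
    intro j hj
    simp only [Fin.contractNth]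
    simp only [List.getElem_append, List.getElem_cons, Fin.val_castSucc, Fin.val_succ]
    grind
  · intro j hj
    rw [insertNth_mk]
    simp only [List.getElem_append, List.getElem_cons]
    grind

theorem eval_mul (f : AnMap n G G') (u v : List (ℝ≥0∞ × G)) (t : ℝ≥0∞) (b : G)
    (ht : (f.size : ℝ≥0∞) ≤ t) (hn : ((u.length + 1 + v.length : ℕ) : ℕ∞) ≤ n) :
    f.eval (u ++ (t, b) :: v) = f.eval u * f.eval ((t, b) :: v) := by
  rcases Nat.eq_zero_or_pos u.length with hu | hu
  · obtain rfl : u = [] := List.length_eq_zero_iff.1 hu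
    simp [eval]
  · obtain ⟨q, hq⟩ : ∃ q, u.length = q + 1 := ⟨u.length - 1, by omega⟩
    have h : ((q + v.length + 1 : ℕ) : ℕ∞) < n :=
      lt_of_lt_of_le (by exact_mod_cast (by omega)) hn
    let w : List (ℝ≥0∞ × G) := u ++ v
    have hw : w.length = q + 1 + v.length := by simp [w, hq]
    rw [f.eval_eq (m := q + v.length + 1) h
      ((⟨q, by omega⟩ : Fin (q + v.length + 1)).insertNth t
        fun j => (w[(j : ℕ) + 1]'(by omega)).1)
      (fun j => ((u ++ (t, b) :: v)[(j : ℕ)]'(by simp; omega)).2) (by simp; omega) ?_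
      (fun _ _ => rfl), f.face_ge _ _ _ _ ht]
    · congr 1
      · symm
        apply f.eval_eq _ _ _ (by simp [hq])
        · intro j hj
          simp only at hj
          simp only [w, List.getElem_append]
          grind
        · intro j hj
          simp only at hj
          simp only [List.getElem_append]
          grind
      · symm
        apply f.eval_eq _ _ _ (by simp)
        · intro j hj
          simp only at hj
          simp only [w, List.getElem_append, List.getElem_cons]
          grind
        · intro j hj
          simp only at hj
          simp only [List.getElem_append, List.getElem_cons]
          grind
    · intro j hj
      rw [insertNth_mk]
      simp only [w, List.getElem_append, List.getElem_cons]
      grind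

theorem eval_degen (f : AnMap n G G') (u v : List (ℝ≥0∞ × G)) (t t' : ℝ≥0∞) (b : G)
    (hn : ((u.length + 2 + v.length : ℕ) : ℕ∞) ≤ n) :
    f.eval (u ++ (t, 1) :: (t', b) :: v) = f.eval (u ++ (max t t', b) :: v) := by
  have h : ((u.length + v.length + 1 : ℕ) : ℕ∞) < n :=
    lt_of_lt_of_le (by exact_mod_cast (by omega)) hn
  let w := u ++ (t, 1) :: (t', b) :: v
  have hw : w.length = u.length + v.length + 2 := by simp [w]; omega
  rw [f.eval_eq (l := w) (m := u.length + v.length + 1) h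
    (fun j => (w[(j : ℕ) + 1]'(by omega)).1)
    (fun j => (w[(j : ℕ)]'(by omega)).2) hw (fun _ _ => rfl) (fun _ _ => rfl),
    f.degen _ h ⟨u.length, by omega⟩ _ _ (by simp [w])]
  symm
  apply f.eval_eq _ _ _ (by simp; omega)
  · intro j hj
    simp only [cubeDegen, w, List.getElem_append, List.getElem_cons, Fin.val_castSucc, Fin.val_succ]
    grind
  · intro j hj
    simp only [Fin.removeNth, Fin.succAbove, w]
    simp only [List.getElem_append, List.getElem_cons, Fin.lt_def]
    grind

theorem eval_degen_last (f : AnMap n G G') (u : List (ℝ≥0∞ × G)) (t : ℝ≥0∞)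
    (hn : ((u.length + 1 : ℕ) : ℕ∞) ≤ n) : f.eval (u ++ [(t, 1)]) = f.eval u := by
  rcases Nat.eq_zero_or_pos u.length with hu | hu
  · obtain rfl : u = [] := List.length_eq_zero_iff.1 hu
    exact f.eval_one t
  · obtain ⟨q, hq⟩ : ∃ q, u.length = q + 1 := ⟨u.length - 1, by omega⟩
    have h : ((q + 1 : ℕ) : ℕ∞) < n := lt_of_lt_of_le (by exact_mod_cast (by omega)) hn
    let w := u ++ [(t, 1)]
    have hw : w.length = q + 2 := by simp [w, hq]
    rw [f.eval_eq (l := w) h (fun j => (w[(j : ℕ) + 1]'(by omega)).1)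
      (fun j => (w[(j : ℕ)]'(by omega)).2) hw (fun _ _ => rfl) (fun _ _ => rfl),
      f.degen _ h ⟨q + 1, by omega⟩ _ _ (by simp [w, hq])]
    symm
    apply f.eval_eq _ _ _ hq
    · intro j hj
      simp only [cubeDegen, w, List.getElem_append, Fin.val_castSucc, Fin.val_succ]
      grind
    · intro j hj
      simp only [Fin.removeNth, Fin.succAbove, w]
      simp only [List.getElem_append, Fin.lt_def]
      grind

/-! #### Words and points of `[0,∞]^m × G^{m+1}` -/

@[simp] theorem length_word {m : ℕ} (T : Fin m → ℝ≥0∞) (g : Fin (m + 1) → G) :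
    (word T g).length = m + 1 := by
  simp [word]

theorem getElem_word {m : ℕ} (T : Fin m → ℝ≥0∞) (g : Fin (m + 1) → G) (j : ℕ)
    (hj : j < (word T g).length) :
    (word T g)[j] = (if h : j = 0 then 0 else T ⟨j - 1, by simp at hj; omega⟩,
      g ⟨j, by simpa using hj⟩) := by
  cases j with
  | zero => simp [word]
  | succ j => simp [word]

/-- An `A_n`-map from a function on words. -/
def ofWord (φ : List (ℝ≥0∞ × G) → G') (l : ℝ≥0)
    (cont : ∀ m : ℕ, (m : ℕ∞) < n → ContinuousGeneratedBy KTest.{u}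
      fun x : (Fin m → ℝ≥0∞) × (Fin (m + 1) → G) => φ (word x.1 x.2))
    (head : ∀ t t' a v, φ ((t, a) :: v) = φ ((t', a) :: v))
    (one : ∀ t, φ [(t, 1)] = 1)
    (zero : ∀ u v t c b, ((u.length + 2 + v.length : ℕ) : ℕ∞) ≤ n →
      φ (u ++ (t, c) :: (0, b) :: v) = φ (u ++ (t, c * b) :: v))
    (ge : ∀ x u v t b, (l : ℝ≥0∞) ≤ t → ((u.length + 2 + v.length : ℕ) : ℕ∞) ≤ n →
      φ (x :: u ++ (t, b) :: v) = φ (x :: u) * φ ((t, b) :: v))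
    (deg : ∀ u v t t' b, ((u.length + 2 + v.length : ℕ) : ℕ∞) ≤ n →
      φ (u ++ (t, 1) :: (t', b) :: v) = φ (u ++ (max t t', b) :: v))
    (deg_last : ∀ x u t, ((u.length + 2 : ℕ) : ℕ∞) ≤ n →
      φ (x :: u ++ [(t, 1)]) = φ (x :: u)) : AnMap n G G' where
  size := l
  form m h := ⟨fun x => φ (word x.1 x.2), cont m h⟩
  map_one h T := by
    change φ (word T fun _ => 1) = 1
    simpa [word] using one 0
  face_zero p h k T g := by
    change φ (word (k.insertNth (0 : ℝ≥0∞) T) g) =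
      φ (word T (Fin.contractNth k.castSucc (· * ·) g))
    have hn : ((p + 2 : ℕ) : ℕ∞) ≤ n := by exact_mod_cast Order.add_one_le_of_lt h
    set w := word (k.insertNth (0 : ℝ≥0∞) T) g with hw
    have hl : w.length = p + 2 := by simp [hw]
    have hk := k.2
    have e1 : w = w.take k ++ ((w[(k : ℕ)]'(by omega)).1, g ⟨k, by omega⟩) ::
        (0, g ⟨k + 1, by omega⟩) :: w.drop (k + 2) := by
      apply List.ext_getElem
      · simp; omega
      · intro j h1 h2
        simp only [List.getElem_append, List.getElem_cons, List.getElem_take, List.getElem_drop, hw,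
          getElem_word, insertNth_mk, List.length_take, length_word]
        grind
    have e2 : word T (Fin.contractNth k.castSucc (· * ·) g) =
        w.take k ++ ((w[(k : ℕ)]'(by omega)).1, g ⟨k, by omega⟩ * g ⟨k + 1, by omega⟩) ::
          w.drop (k + 2) := by
      apply List.ext_getElem
      · simp [hl]; omega
      · intro j h1 h2
        have h3 : j < p + 1 := by simpa using h1
        simp only [List.getElem_append, List.getElem_cons, List.getElem_take, List.getElem_drop, hw,
          getElem_word, insertNth_mk, List.length_take, length_word, Fin.contractNth,
          Fin.val_castSucc, Fin.castSucc_mk, Fin.succ_mk]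
        grind
    rw [e2]
    conv_lhs => rw [e1]
    apply zero
    simp only [List.length_take, List.length_drop, hl]
    rwa [show min (k : ℕ) (p + 2) + 2 + (p + 2 - (k + 2)) = p + 2 by omega]
  face_ge p h k t ht T g := by
    change φ (word (k.insertNth t T) g) = φ (word _ _) * φ (word _ _)
    have hn : ((p + 2 : ℕ) : ℕ∞) ≤ n := by exact_mod_cast Order.add_one_le_of_lt h
    set w := word (k.insertNth t T) g with hw
    have hl : w.length = p + 2 := by simp [hw]
    have hk := k.2
    have e1 : w = (0, g 0) :: (w.tail.take k) ++ (t, g ⟨k + 1, by omega⟩) :: w.drop (k + 2) := by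
      apply List.ext_getElem
      · simp; omega
      · intro j h1 h2
        simp only [List.getElem_append, List.getElem_cons, List.getElem_take, List.getElem_drop, hw,
          getElem_word, insertNth_mk, List.length_take, length_word, List.getElem_tail,
          List.length_cons, List.length_tail]
        grind
    conv_lhs => rw [e1]
    rw [ge _ _ _ _ _ ht]
    · congr 1
      · congr 1
        apply List.ext_getElem
        · simp [hl]
        · intro j h1 h2
          simp only [List.getElem_cons, List.getElem_take, hw,
            getElem_word, insertNth_mk, List.getElem_tail]
          simp only [length_word] at h2
          grind
      · rw [head t 0]
        congr 1
        apply List.ext_getElem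
        · simp [hl]
        · intro j h1 h2
          simp only [List.getElem_cons, List.getElem_drop, hw, getElem_word, insertNth_mk]
          simp only [length_word] at h2
          grind
    · simp only [List.length_take, List.length_drop, List.length_tail, hl]
      rwa [show min (k : ℕ) (p + 2 - 1) + 2 + (p + 2 - (k + 2)) = p + 2 by omega]
  degen p h k T g hg := by
    change φ (word T g) = φ (word (cubeDegen k T) (k.removeNth g))
    have hn : ((p + 2 : ℕ) : ℕ∞) ≤ n := by exact_mod_cast Order.add_one_le_of_lt h
    set w := word T g with hw
    have hl : w.length = p + 2 := by simp [hw]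
    have hk := k.2
    rcases Nat.lt_or_ge k (p + 1) with hkp | hkp
    · have e1 : w = w.take k ++ ((w[(k : ℕ)]'(by omega)).1, 1) ::
          (T ⟨k, hkp⟩, g ⟨k + 1, by omega⟩) :: w.drop (k + 2) := by
        apply List.ext_getElem
        · simp; omega
        · intro j h1 h2
          simp only [List.getElem_append, List.getElem_cons, List.getElem_take, List.getElem_drop,
            hw, getElem_word, List.length_take, length_word]
          grind
      have hlen : ((w.take k).length + 2 + (w.drop (k + 2)).length : ℕ) = p + 2 := by
        simp only [List.length_take, List.length_drop, hl]; omega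
      conv_lhs => rw [e1]
      rw [deg _ _ _ _ _ (by rwa [hlen])]
      rcases Nat.eq_zero_or_pos k with hk0 | hk0
      · have hk0' : k = 0 := Fin.ext hk0
        subst hk0'
        simp only [Fin.val_zero, List.take_zero, List.nil_append]
        rw [head _ 0]
        congr 1
        apply List.ext_getElem
        · simp [hl]
        · intro j h1 h2
          simp only [length_word] at h2
          simp only [List.getElem_cons, List.getElem_drop, hw, getElem_word, cubeDegen,
            Fin.removeNth, Fin.succAbove, Fin.lt_def, Fin.val_zero, Fin.succ_mk]
          grind
      · congr 1
        apply List.ext_getElem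
        · simp [hl]; omega
        · intro j h1 h2
          simp only [length_word] at h2
          simp only [List.getElem_append, List.getElem_take, List.length_take, length_word,
            List.getElem_cons, List.getElem_drop, hw, getElem_word, cubeDegen,
            Fin.removeNth, Fin.succAbove, Fin.lt_def, Fin.succ_mk, Fin.castSucc_mk]
          grind
    · have hk' : (k : ℕ) = p + 1 := by omega
      have e1 : w = (0, g 0) :: (w.tail.take p) ++ [((w[p + 1]'(by omega)).1, 1)] := by
        apply List.ext_getElem
        · simp; omega
        · intro j h1 h2
          simp only [List.getElem_append, List.getElem_cons, List.getElem_take, hw,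
            getElem_word, List.length_take, length_word, List.getElem_tail,
            List.length_cons, List.length_tail]
          grind
      conv_lhs => rw [e1]
      rw [deg_last]
      · congr 1
        apply List.ext_getElem
        · simp [hl]
        · intro j h1 h2
          simp only [length_word] at h2
          simp only [List.getElem_take, List.getElem_tail,
            List.getElem_cons, hw, getElem_word, cubeDegen,
            Fin.removeNth, Fin.succAbove, Fin.lt_def, Fin.succ_mk, Fin.castSucc_mk]
          grind
      · simp only [List.length_take, List.length_tail, hl]
        rwa [show min p (p + 2 - 1) + 2 = p + 2 by omega]

/-! #### Composition -/

/-- Two states of `step` that cannot be told apart after prolonging them by at most `k` letters. -/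
def StateRel (f' : AnMap n G' G'') (f : AnMap n G G') (k : ℕ)
    (s s' : List (ℝ≥0∞ × G) × List (ℝ≥0∞ × G')) : Prop :=
  (∀ u : List (ℝ≥0∞ × G), u.length ≤ k → f.eval (u ++ s.1) = f.eval (u ++ s'.1)) ∧
    ∀ u : List (ℝ≥0∞ × G'), u.length ≤ k → f'.eval (u ++ s.2) = f'.eval (u ++ s'.2)

theorem StateRel.step {f' : AnMap n G' G''} {f : AnMap n G G'} {k : ℕ}
    {s s' : List (ℝ≥0∞ × G) × List (ℝ≥0∞ × G')} (h : StateRel f' f (k + 1) s s')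
    (x : Bool × ℝ≥0∞ × G) : StateRel f' f k (f.step x s) (f.step x s') := by
  obtain ⟨h1, h2⟩ := h
  obtain ⟨b, x⟩ := x
  cases b
  · refine ⟨fun u hu => ?_, fun u hu => h2 u (by omega)⟩
    have := h1 (u ++ [x]) (by simpa using hu)
    simpa [AnMap.step] using this
  · refine ⟨fun u hu => rfl, fun u hu => ?_⟩
    have e : f.eval (x :: s.1) = f.eval (x :: s'.1) := h1 [x] (by simp)
    have := h2 (u ++ [(x.1 - f.size, f.eval (x :: s'.1))]) (by simpa using hu)
    simpa [AnMap.step, e] using this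

theorem StateRel.foldr {f' : AnMap n G' G''} {f : AnMap n G G'} (u : List (Bool × ℝ≥0∞ × G))
    {k : ℕ} {s s' : List (ℝ≥0∞ × G) × List (ℝ≥0∞ × G')} (h : StateRel f' f (u.length + k) s s') :
    StateRel f' f k (u.foldr f.step s) (u.foldr f.step s') := by
  induction u generalizing k with
  | nil => simpa using h
  | cons x u ih =>
    exact StateRel.step (ih (by rwa [List.length_cons, add_right_comm] at h)) x

theorem cutEval_congr {f' : AnMap n G' G''} {f : AnMap n G G'} (u v v' : List (Bool × ℝ≥0∞ × G))
    (h : StateRel f' f u.length (v.foldr f.step ([], [])) (v'.foldr f.step ([], []))) :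
    cutEval f' f (u ++ v) = cutEval f' f (u ++ v') := by
  have := (StateRel.foldr u (k := 0) (by simpa using h)).2 [] (by simp)
  simpa [cutEval] using this

theorem length_foldr_step (f : AnMap n G G') (v : List (Bool × ℝ≥0∞ × G)) :
    (v.foldr f.step ([], [])).1.length + (v.foldr f.step ([], [])).2.length ≤ v.length := by
  induction v with
  | nil => simp
  | cons x v ih =>
    rw [List.foldr_cons, step]
    split <;> simp <;> omega

theorem foldr_step_append (f : AnMap n G G') (u : List (Bool × ℝ≥0∞ × G))
    (o : List (ℝ≥0∞ × G')) : u.foldr f.step ([], o) =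
      ((u.foldr f.step ([], [])).1, (u.foldr f.step ([], [])).2 ++ o) := by
  induction u with
  | nil => simp
  | cons x u ih =>
    rw [List.foldr_cons, ih, List.foldr_cons, step, step]
    split <;> simp

/-- A cut at a parameter equal to `ℓ` can be removed. -/
theorem cutEval_merge (f' : AnMap n G' G'') (f : AnMap n G G') (y : ℝ≥0∞ × G)
    (u v : List (Bool × ℝ≥0∞ × G)) (b : G) (hn : ((u.length + 2 + v.length : ℕ) : ℕ∞) ≤ n) :
    cutEval f' f ((true, y) :: u ++ (true, (f.size : ℝ≥0∞), b) :: v) =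
      cutEval f' f ((true, y) :: u ++ (false, (f.size : ℝ≥0∞), b) :: v) := by
  set p := (v.foldr f.step ([], [])).1 with hp
  set o := (v.foldr f.step ([], [])).2 with ho
  have hpo : p.length + o.length ≤ v.length := length_foldr_step f v
  set x := f.eval (((f.size : ℝ≥0∞), b) :: p) with hx
  have key : ∀ (u : List (Bool × ℝ≥0∞ × G)) (k : ℕ),
      ((u.length + k + 1 + v.length : ℕ) : ℕ∞) ≤ n →
      (∃ w : List (ℝ≥0∞ × G), w.length + k ≤ u.length + k ∧
        u.foldr f.step ([], (0, x) :: o) = (w, (0, x) :: o) ∧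
        u.foldr f.step (((f.size : ℝ≥0∞), b) :: p, o) = (w ++ ((f.size : ℝ≥0∞), b) :: p, o)) ∨
      StateRel f' f k (u.foldr f.step ([], (0, x) :: o))
        (u.foldr f.step (((f.size : ℝ≥0∞), b) :: p, o)) := by
    intro u
    induction u with
    | nil => exact fun k _ => Or.inl ⟨[], by simp⟩
    | cons z u ih =>
      intro k hk
      rcases ih (k + 1) (by rwa [List.length_cons, add_assoc u.length, add_comm 1 k] at hk) with
        ⟨w, hw, e1, e2⟩ | h
      · obtain ⟨c, z⟩ := z
        rw [List.foldr_cons, List.foldr_cons, e1, e2]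
        cases c
        · exact Or.inl ⟨z :: w, by simp; omega, by simp [step], by simp [step]⟩
        · refine Or.inr ⟨fun _ _ => rfl, fun q hq => ?_⟩
          have hle : ((k + 1 + 1 + v.length : ℕ) : ℕ∞) ≤ n :=
            le_trans (by simp only [List.length_cons]; exact_mod_cast (by omega)) hk
          have e3 : f.eval (z :: (w ++ ((f.size : ℝ≥0∞), b) :: p)) = f.eval (z :: w) * x := by
            have := f.eval_mul (z :: w) p (f.size : ℝ≥0∞) b le_rfl
              (le_trans (by simp only [List.length_cons] at hk ⊢; exact_mod_cast (by omega)) hk)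
            simpa using this
          have e4 := f'.eval_zero q o (z.1 - f.size) (f.eval (z :: w)) x
            (le_trans (by exact_mod_cast (by omega)) hle)
          simpa [step, e3] using e4
      · exact Or.inr (StateRel.step h z)
  have e1 : ((true, (f.size : ℝ≥0∞), b) :: v).foldr f.step ([], []) = ([], (0, x) :: o) := by
    simp [step, hx, hp, ho]
  have e2 : ((false, (f.size : ℝ≥0∞), b) :: v).foldr f.step ([], []) =
      (((f.size : ℝ≥0∞), b) :: p, o) := by
    simp [step, hp, ho]
  have e3 : StateRel f' f 0 (((true, y) :: u).foldr f.step ([], (0, x) :: o))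
      (((true, y) :: u).foldr f.step (((f.size : ℝ≥0∞), b) :: p, o)) := by
    rcases key ((true, y) :: u) 0 (le_trans
      (by simp only [List.length_cons]; exact_mod_cast (by omega)) hn) with ⟨w, hw, h1, h2⟩ | h
    · exfalso
      rw [List.foldr_cons, step] at h1
      rw [List.foldr_cons, step] at h2
      have h5 := congrArg Prod.fst h2
      simp at h5
    · exact h
  have := e3.2 [] (by simp)
  rw [cutEval, cutEval, List.foldr_append, List.foldr_append, e1, e2]
  simpa using this

/-- The standard marking of a letter that is not the first one. -/
noncomputable def markLetter (l : ℝ≥0) (y : ℝ≥0∞ × G) : Bool × ℝ≥0∞ × G :=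
  open Classical in (decide ((l : ℝ≥0∞) < y.1), y)

theorem mark_cons (l : ℝ≥0) (x : ℝ≥0∞ × G) (w : List (ℝ≥0∞ × G)) :
    mark l (x :: w) = (true, x) :: w.map (markLetter l) := rfl

/-- The result does not depend on the choice of the cuts, as long as they are made where the
parameters are at least `ℓ` and all parameters without a cut are at most `ℓ`. -/
theorem cutEval_eq (f' : AnMap n G' G'') (f : AnMap n G G') (x : ℝ≥0∞ × G)
    (u v : List (Bool × ℝ≥0∞ × G)) (hn : ((u.length + 1 + v.length : ℕ) : ℕ∞) ≤ n)
    (hv : ∀ y ∈ v, (y.1 = true → (f.size : ℝ≥0∞) ≤ y.2.1) ∧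
      (y.1 = false → y.2.1 ≤ (f.size : ℝ≥0∞))) :
    cutEval f' f ((true, x) :: u ++ v) =
      cutEval f' f ((true, x) :: u ++ v.map fun y => markLetter f.size y.2) := by
  induction v generalizing u with
  | nil => rfl
  | cons y v ih =>
    have hy := hv y (by simp)
    have e : cutEval f' f ((true, x) :: u ++ y :: v) =
        cutEval f' f ((true, x) :: u ++ markLetter f.size y.2 :: v) := by
      obtain ⟨c, t, b⟩ := y
      have hn' : ((u.length + 2 + v.length : ℕ) : ℕ∞) ≤ n :=
        le_trans (by simp only [List.length_cons]; exact_mod_cast (by omega)) hn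
      cases c
      · have : ¬ (f.size : ℝ≥0∞) < t := not_lt.2 (hy.2 rfl)
        simp [markLetter, this]
      · rcases (hy.1 rfl).lt_or_eq with h | h
        · simp only at h
          simp [markLetter, h]
        · simp only at h
          subst h
          simpa [markLetter] using cutEval_merge f' f x u v b hn'
    rw [e]
    have := ih (u ++ [markLetter f.size y.2]) (le_trans
      (by simp only [List.length_cons, List.length_append, List.length_nil]
          exact_mod_cast (by omega)) hn) (fun z hz => hv z (by simp [hz]))
    simpa using this

theorem compEval_eq (f' : AnMap n G' G'') (f : AnMap n G G') (x : ℝ≥0∞ × G)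
    (v : List (Bool × ℝ≥0∞ × G)) (hn : ((1 + v.length : ℕ) : ℕ∞) ≤ n)
    (hv : ∀ y ∈ v, (y.1 = true → (f.size : ℝ≥0∞) ≤ y.2.1) ∧
      (y.1 = false → y.2.1 ≤ (f.size : ℝ≥0∞))) :
    compEval f' f (x :: v.map Prod.snd) = cutEval f' f ((true, x) :: v) := by
  have := cutEval_eq f' f x [] v (by simpa using hn) hv
  simp only [List.cons_append, List.nil_append] at this
  rw [this, compEval, mark_cons, List.map_map]
  rfl

theorem compEval_head (f' : AnMap n G' G'') (f : AnMap n G G') (t t' : ℝ≥0∞) (a : G)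
    (v : List (ℝ≥0∞ × G)) : compEval f' f ((t, a) :: v) = compEval f' f ((t', a) :: v) := rfl

theorem compEval_one (f' : AnMap n G' G'') (f : AnMap n G G') (t : ℝ≥0∞) :
    compEval f' f [(t, 1)] = 1 := by
  simp [compEval, mark_cons, cutEval, step, eval_one]

theorem compEval_congr (f' : AnMap n G' G'') (f : AnMap n G G') (u v v' : List (ℝ≥0∞ × G))
    (hu : u ≠ [])
    (h : StateRel f' f u.length ((v.map (markLetter f.size)).foldr f.step ([], []))
      ((v'.map (markLetter f.size)).foldr f.step ([], []))) :
    compEval f' f (u ++ v) = compEval f' f (u ++ v') := by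
  cases u with
  | nil => exact absurd rfl hu
  | cons x u =>
    simp only [compEval, List.cons_append, mark_cons, List.map_append]
    exact cutEval_congr ((true, x) :: u.map (markLetter f.size)) _ _ (by simpa using h)

theorem stateRel_zero (f' : AnMap n G' G'') (f : AnMap n G G') (c : Bool) (t : ℝ≥0∞) (a b : G)
    (M : List (Bool × ℝ≥0∞ × G)) (k : ℕ) (hn : ((k + 2 + M.length : ℕ) : ℕ∞) ≤ n) :
    StateRel f' f k (((c, t, a) :: (false, 0, b) :: M).foldr f.step ([], []))
      (((c, t, a * b) :: M).foldr f.step ([], [])) := by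
  have hM := length_foldr_step f M
  set p := (M.foldr f.step ([], [])).1 with hp
  set o := (M.foldr f.step ([], [])).2 with ho
  have e : ∀ u : List (ℝ≥0∞ × G), u.length ≤ k →
      f.eval (u ++ (t, a) :: (0, b) :: p) = f.eval (u ++ (t, a * b) :: p) := fun u hu =>
    f.eval_zero u p t a b (le_trans (by exact_mod_cast (by omega)) hn)
  cases c
  · simp only [List.foldr_cons, step]
    exact ⟨by simpa using e, fun _ _ => by simp⟩
  · have e0 : f.eval ((t, a) :: (0, b) :: p) = f.eval ((t, a * b) :: p) := e [] (by simp)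
    simp only [List.foldr_cons, step]
    exact ⟨fun _ _ => by simp, fun _ _ => by simp [← hp, e0]⟩

theorem stateRel_degen (f' : AnMap n G' G'') (f : AnMap n G G') (t t' : ℝ≥0∞) (b : G)
    (M : List (Bool × ℝ≥0∞ × G)) (k : ℕ) (hn : ((k + 2 + M.length : ℕ) : ℕ∞) ≤ n) :
    StateRel f' f k
      ((markLetter f.size (t, 1) :: markLetter f.size (t', b) :: M).foldr f.step ([], []))
      ((markLetter f.size (max t t', b) :: M).foldr f.step ([], [])) := by
  have hM := length_foldr_step f M
  set p := (M.foldr f.step ([], [])).1 with hp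
  set o := (M.foldr f.step ([], [])).2 with ho
  have hk1 : ((k + 1 : ℕ) : ℕ∞) ≤ n := le_trans (by exact_mod_cast (by omega)) hn
  have e : ∀ u : List (ℝ≥0∞ × G), u.length ≤ k →
      f.eval (u ++ (t, 1) :: (t', b) :: p) = f.eval (u ++ (max t t', b) :: p) := fun u hu =>
    f.eval_degen u p t t' b (le_trans (by exact_mod_cast (by omega)) hn)
  have e0 : f.eval ((t, 1) :: (t', b) :: p) = f.eval ((max t t', b) :: p) := e [] (by simp)
  by_cases h : (f.size : ℝ≥0∞) < t <;> by_cases h' : (f.size : ℝ≥0∞) < t'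
  · simp only [markLetter, List.foldr_cons, step, h, h', lt_max_iff, decide_true, or_true, if_true,
      eval_one, ← hp, ← ho]
    refine ⟨fun _ _ => rfl, fun u hu => ?_⟩
    rw [eval_degen]
    · have e1 : max (t - (f.size : ℝ≥0∞)) (t' - f.size) = max t t' - f.size :=
        (Monotone.map_max (f := fun s : ℝ≥0∞ => s - f.size)
          (fun _ _ h => tsub_le_tsub_right h _)).symm
      rw [e1]
      rfl
    · exact le_trans (by exact_mod_cast (by omega)) hn
  · simp only [markLetter, List.foldr_cons, step, h, h', lt_max_iff, decide_true, or_false, if_true,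
      decide_false, ← hp, ← ho]
    have hm : max t t' = t := max_eq_left (le_trans (not_lt.1 h') h.le)
    rw [hm] at e0 ⊢
    refine ⟨fun _ _ => rfl, fun u hu => ?_⟩
    simp [e0]
  · simp only [markLetter, List.foldr_cons, step, h, h', lt_max_iff, decide_true, false_or, if_true,
      decide_false, ← hp, ← ho]
    have hm : max t t' = t' := max_eq_right (le_trans (not_lt.1 h) h'.le)
    rw [hm]
    refine ⟨fun u hu => ?_, fun u hu => by simp⟩
    simpa using f.eval_degen_last u t (le_trans (by exact_mod_cast (by omega)) hk1)
  · simp only [markLetter, List.foldr_cons, step, h, h', lt_max_iff, false_or,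
      decide_false, ← hp, ← ho]
    exact ⟨by simpa using e, fun u hu => by simp⟩

theorem compEval_zero (f' : AnMap n G' G'') (f : AnMap n G G') (u v : List (ℝ≥0∞ × G)) (t : ℝ≥0∞)
    (a b : G) (hn : ((u.length + 2 + v.length : ℕ) : ℕ∞) ≤ n) :
    compEval f' f (u ++ (t, a) :: (0, b) :: v) = compEval f' f (u ++ (t, a * b) :: v) := by
  have hm : markLetter f.size ((0 : ℝ≥0∞), b) = (false, 0, b) := by simp [markLetter]
  rcases eq_or_ne u [] with rfl | hu
  · simp only [List.nil_append, compEval, mark_cons, List.map_cons, hm]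
    exact cutEval_congr [] _ _ (stateRel_zero f' f true t a b _ 0 (by simpa using hn))
  · apply compEval_congr _ _ _ _ _ hu
    simp only [List.map_cons, hm]
    exact stateRel_zero f' f _ t a b _ _ (by simpa using hn)

theorem compEval_degen (f' : AnMap n G' G'') (f : AnMap n G G') (u v : List (ℝ≥0∞ × G))
    (t t' : ℝ≥0∞) (b : G) (hn : ((u.length + 2 + v.length : ℕ) : ℕ∞) ≤ n) :
    compEval f' f (u ++ (t, 1) :: (t', b) :: v) = compEval f' f (u ++ (max t t', b) :: v) := by
  rcases eq_or_ne u [] with rfl | hu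
  · have h := stateRel_degen f' f ⊤ t' b (v.map (markLetter f.size)) 0 (by simpa using hn)
    have hm : ∀ a : G, markLetter f.size ((⊤ : ℝ≥0∞), a) = (true, ⊤, a) := by simp [markLetter]
    rw [max_eq_left le_top, hm, hm] at h
    rw [List.nil_append, List.nil_append, compEval_head f' f t ⊤, compEval_head f' f (max t t') ⊤]
    simp only [compEval, mark_cons, List.map_cons]
    exact cutEval_congr [] _ _ h
  · apply compEval_congr _ _ _ _ _ hu
    simp only [List.map_cons]
    exact stateRel_degen f' f t t' b _ _ (by simpa using hn)

theorem compEval_degen_last (f' : AnMap n G' G'') (f : AnMap n G G') (x : ℝ≥0∞ × G)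
    (u : List (ℝ≥0∞ × G)) (t : ℝ≥0∞) (hn : ((u.length + 2 : ℕ) : ℕ∞) ≤ n) :
    compEval f' f (x :: u ++ [(t, 1)]) = compEval f' f (x :: u) := by
  have := compEval_congr f' f (x :: u) [(t, 1)] [] (by simp) (by
    by_cases h : (f.size : ℝ≥0∞) < t
    · simp only [List.map_cons, List.map_nil, markLetter, h, List.foldr_cons, List.foldr_nil, step,
        eval_one, decide_true, if_true]
      refine ⟨fun _ _ => rfl, fun q hq => ?_⟩
      simp only [List.length_cons] at hq
      simpa using f'.eval_degen_last q _ (le_trans (by exact_mod_cast (by omega)) hn)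
    · simp only [List.map_cons, List.map_nil, markLetter, h, List.foldr_cons, List.foldr_nil, step,
        decide_false]
      refine ⟨fun q hq => ?_, fun _ _ => by simp⟩
      simp only [List.length_cons] at hq
      simpa using f.eval_degen_last q _ (le_trans (by exact_mod_cast (by omega)) hn))
  simpa using this

theorem markLetter_spec (l : ℝ≥0) (y : ℝ≥0∞ × G) :
    ((markLetter l y).1 = true → (l : ℝ≥0∞) ≤ (markLetter l y).2.1) ∧
      ((markLetter l y).1 = false → (markLetter l y).2.1 ≤ (l : ℝ≥0∞)) := by
  simp only [markLetter, decide_eq_true_eq, decide_eq_false_iff_not, not_lt]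
  exact ⟨le_of_lt, id⟩

theorem compEval_mul (f' : AnMap n G' G'') (f : AnMap n G G') (x : ℝ≥0∞ × G)
    (u v : List (ℝ≥0∞ × G)) (t : ℝ≥0∞) (b : G) (ht : ((f.size + f'.size : ℝ≥0) : ℝ≥0∞) ≤ t)
    (hn : ((u.length + 2 + v.length : ℕ) : ℕ∞) ≤ n) :
    compEval f' f (x :: u ++ (t, b) :: v) =
      compEval f' f (x :: u) * compEval f' f ((t, b) :: v) := by
  rw [ENNReal.coe_add] at ht
  have h1 : (f.size : ℝ≥0∞) ≤ t := le_trans le_self_add ht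
  have h2 : (f'.size : ℝ≥0∞) ≤ t - f.size := ENNReal.le_sub_of_add_le_left (by simp) ht
  have e := compEval_eq f' f x
    (u.map (markLetter f.size) ++ (true, t, b) :: v.map (markLetter f.size))
    (by
      refine le_trans ?_ hn
      simp only [List.length_append, List.length_cons, List.length_map]
      exact_mod_cast (by omega))
    (by
      intro y hy
      simp only [List.mem_append, List.mem_cons, List.mem_map] at hy
      rcases hy with ⟨z, _, rfl⟩ | rfl | ⟨z, _, rfl⟩
      · exact markLetter_spec _ _
      · simpa using h1
      · exact markLetter_spec _ _)
  have hs : ∀ w : List (ℝ≥0∞ × G), (w.map (markLetter f.size)).map Prod.snd = w := by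
    intro w
    rw [List.map_map]
    exact List.map_id w
  simp only [List.map_append, List.map_cons, hs] at e
  rw [List.cons_append, e]
  have hu := length_foldr_step f ((true, x) :: u.map (markLetter f.size))
  have hv := length_foldr_step f (v.map (markLetter f.size))
  simp only [List.length_cons, List.length_map] at hu hv
  have e5 : ((true, t, b) :: v.map (markLetter f.size)).foldr f.step ([], []) =
      ([], (t - f.size, f.eval ((t, b) :: ((v.map (markLetter f.size)).foldr f.step ([], [])).1)) ::
        ((v.map (markLetter f.size)).foldr f.step ([], [])).2) := by
    simp [step]
  have e6 : cutEval f' f ((true, x) :: (u.map (markLetter f.size) ++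
      (true, t, b) :: v.map (markLetter f.size))) = cutEval f' f (((true, x) ::
        u.map (markLetter f.size)) ++ (true, t, b) :: v.map (markLetter f.size)) := rfl
  rw [e6, compEval, compEval, mark_cons, mark_cons]
  simp only [cutEval]
  rw [List.foldr_append, e5, foldr_step_append]
  apply f'.eval_mul _ _ _ _ h2
  refine le_trans ?_ hn
  exact_mod_cast (by omega)

/-! #### Continuity of the composite -/

theorem continuous_eval (f : AnMap n G G') {K : CompHaus.{u}} (w : List (C(K, ℝ≥0∞) × C(K, G))) :
    Continuous fun x : K => f.eval (w.map fun q => (q.1 x, q.2 x)) := by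
  cases w with
  | nil => exact continuous_const
  | cons y w =>
    by_cases h : (w.length : ℕ∞) < n
    · let p : C(K, (Fin w.length → ℝ≥0∞) × (Fin (w.length + 1) → G)) :=
        ⟨fun x => (fun j => w[j].1 x, fun j => ((y :: w)[j]).2 x), by fun_prop⟩
      have := (f.form w.length h).prop p
      refine this.congr fun x => ?_
      symm
      exact f.eval_eq h _ _ (by simp) (by simp) (by
        intro j hj
        simp only [Fin.getElem_fin, List.getElem_map])
    · refine (continuous_const (y := (1 : G'))).congr fun x => ?_
      rw [List.map_cons, eval, dif_neg (by simpa using h)]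

theorem continuous_cutEval (f' : AnMap n G' G'') (f : AnMap n G G') {K : CompHaus.{u}}
    (L : List (Bool × C(K, ℝ≥0∞) × C(K, G))) :
    Continuous fun x : K => cutEval f' f (L.map fun q => (q.1, q.2.1 x, q.2.2 x)) := by
  have key : ∃ (p : List (C(K, ℝ≥0∞) × C(K, G))) (o : List (C(K, ℝ≥0∞) × C(K, G'))), ∀ x : K,
      (L.map fun q => (q.1, q.2.1 x, q.2.2 x)).foldr f.step ([], []) =
        (p.map fun q => (q.1 x, q.2 x), o.map fun q => (q.1 x, q.2 x)) := by
    induction L with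
    | nil => exact ⟨[], [], fun x => rfl⟩
    | cons y L ih =>
      obtain ⟨p, o, h⟩ := ih
      obtain ⟨c, y⟩ := y
      cases c
      · refine ⟨y :: p, o, fun x => ?_⟩
        rw [List.map_cons, List.foldr_cons, h]
        simp [step]
      · refine ⟨[], (⟨fun x => y.1 x - f.size,
          (ENNReal.continuous_sub_right _).comp y.1.continuous⟩,
          ⟨_, f.continuous_eval (y :: p)⟩) :: o, fun x => ?_⟩
        rw [List.map_cons, List.foldr_cons, h]
        simp [step]
  obtain ⟨p, o, h⟩ := key
  refine (f'.continuous_eval o).congr fun x => ?_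
  rw [cutEval, h]

theorem continuous_compEval (f' : AnMap n G' G'') (f : AnMap n G G') (m : ℕ) (hm : (m : ℕ∞) < n) :
    ContinuousGeneratedBy KTest.{u}
      fun x : (Fin m → ℝ≥0∞) × (Fin (m + 1) → G) => compEval f' f (word x.1 x.2) := by
  intro K p
  have hn : ((1 + m : ℕ) : ℕ∞) ≤ n := by
    rw [add_comm]
    exact_mod_cast Order.add_one_le_of_lt hm
  have hp1 : ∀ j, Continuous fun x : K => (p x).1 j := fun j =>
    (continuous_apply j).comp (continuous_fst.comp p.continuous)
  have hp2 : ∀ j, Continuous fun x : K => (p x).2 j := fun j =>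
    (continuous_apply j).comp (continuous_snd.comp p.continuous)
  let A : (Fin m → Bool) → Set K := fun c =>
    ⋂ j, {x | (c j = true → (f.size : ℝ≥0∞) ≤ (p x).1 j) ∧
      (c j = false → (p x).1 j ≤ (f.size : ℝ≥0∞))}
  have hA : ∀ c, IsClosed (A c) := by
    intro c
    refine isClosed_iInter fun j => ?_
    cases hc : c j
    · have e : {x : K | (false = true → (f.size : ℝ≥0∞) ≤ (p x).1 j) ∧
          (false = false → (p x).1 j ≤ (f.size : ℝ≥0∞))} = {x : K | (p x).1 j ≤ (f.size : ℝ≥0∞)} :=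
        Set.ext fun x => ⟨fun h => h.2 rfl, fun h => ⟨fun h' => absurd h' (by decide), fun _ => h⟩⟩
      rw [e]
      exact isClosed_le (hp1 j) continuous_const
    · have e : {x : K | (true = true → (f.size : ℝ≥0∞) ≤ (p x).1 j) ∧
          (true = false → (p x).1 j ≤ (f.size : ℝ≥0∞))} = {x : K | (f.size : ℝ≥0∞) ≤ (p x).1 j} :=
        Set.ext fun x => ⟨fun h => h.1 rfl, fun h => ⟨fun _ => h, fun h' => absurd h' (by decide)⟩⟩
      rw [e]
      exact isClosed_le continuous_const (hp1 j)
  have hcov : ⋃ c, A c = Set.univ := by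
    classical
    refine Set.eq_univ_of_forall fun x => Set.mem_iUnion.2
      ⟨fun j => decide ((f.size : ℝ≥0∞) < (p x).1 j), Set.mem_iInter.2 fun j => ?_⟩
    simp only [Set.mem_ofPred_eq, decide_eq_true_eq, decide_eq_false_iff_not, not_lt]
    exact ⟨le_of_lt, id⟩
  refine LocallyFinite.continuous (locallyFinite_of_finite A) hcov hA fun c => ?_
  let L : List (Bool × C(K, ℝ≥0∞) × C(K, G)) :=
    (true, ⟨fun _ => 0, continuous_const⟩, ⟨_, hp2 0⟩) ::
      List.ofFn fun j : Fin m => (c j, ⟨_, hp1 j⟩, ⟨_, hp2 j.succ⟩)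
  refine (continuous_cutEval f' f L).continuousOn.congr fun x hx => ?_
  have hx' := Set.mem_iInter.1 hx
  have := compEval_eq f' f (0, (p x).2 0)
    (List.ofFn fun j : Fin m => (c j, (p x).1 j, (p x).2 j.succ))
    (by simpa using hn) (by
      intro y hy
      obtain ⟨j, rfl⟩ := (List.mem_ofFn' _ _).1 hy
      exact hx' j)
  rw [List.map_ofFn] at this
  simp only [Function.comp_apply, L, List.map_cons, List.map_ofFn]
  exact this

/-- The composite `f' ∘ f` of two `A_n`-maps, of size the sum of the sizes `ℓ` of `f` and `ℓ'` of
`f'`: at a point of the cube, cut the sequence of arguments at the parameters `t > ℓ`, apply `f` to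
the blocks, and `f'` to the results with the parameters `t - ℓ` between them. By `compEval_eq`, the
result is the same for every choice of the cuts such that parameters at cuts are at least `ℓ` and
the others at most `ℓ`, which is the defining formula
`F(s_1, t_1 + ℓ, s_2, …, s_r; g_1, …, g_r) = f'_r(t_1, …, t_{r-1}; f(s_1; g_1), …, f(s_r; g_r))`. -/
noncomputable def comp (f' : AnMap n G' G'') (f : AnMap n G G') : AnMap n G G'' :=
  ofWord (compEval f' f) (f.size + f'.size) (continuous_compEval f' f) (compEval_head f' f)
    (compEval_one f' f) (compEval_zero f' f) (compEval_mul f' f) (compEval_degen f' f)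
    (compEval_degen_last f' f)

/-- The identity, with the `A_n`-form of size `0` given by multiplication. -/
def identity (n : ℕ∞) (G : Type u) [Monoid G] [TopologicalSpace G] [CGMonoid G] : AnMap n G G :=
  ofWord (fun w => (w.map Prod.snd).prod) 0
    (by
      intro m _ K p
      have key : ∀ w : List C(K, G), Continuous fun x : K => (w.map fun q => q x).prod := by
        intro w
        induction w with
        | nil => exact continuous_const
        | cons y w ih =>
          have := CGMonoid.continuous_mul (G := G) (⟨fun x => (y x, (w.map fun q => q x).prod),
            by fun_prop⟩ : C(K, G × G))
          exact this.congr fun x => by simp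
      have hp2 : ∀ j, Continuous fun x : K => (p x).2 j := fun j => by fun_prop
      refine (key (List.ofFn fun j => ⟨_, hp2 j⟩)).congr fun x => ?_
      simp [word, List.map_ofFn, Function.comp_def, List.ofFn_succ])
    (by simp) (by simp) (by simp [mul_assoc]) (by simp [mul_assoc]) (by simp) (by simp)

end AnMap

/-!
Write `f'_#` for postcomposition with the weak equivalence `f'`. The main point is that `f'_#` is a
weak equivalence (`AnMap.isWeakHomotopyEquiv_comp_left`); the rest is formal. Indeed, surjectivity of
`f_#` on path components for spaces of maps out of `H` gives `e` with `f ∘ e` in the component of the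
identity, and injectivity for maps out of `G` shows that `e ∘ f` is in the component of the identity
as well, by the associativity and unit laws of the composition. Precomposition with `f ∘ e` and with
`e ∘ f` is then homotopic to the identity, and the two-out-of-six property makes precomposition with
`f` a weak equivalence.

For `f'_#`, it suffices that the path fibration of `f'_#` lifts cubes relative to their boundaries
(`isWeakHomotopyEquiv_of_lifts`). Such a problem consists of a family `a` of `A_n`-maps `H → H'` over
a cube and lifts `h` over the boundary, and asks for an extension of `h` to a family `ψ` and for a
homotopy `ω` relative to the boundary from `a` to `f' ∘ ψ`. Since sizes can be raised, all sizes may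
be taken to be constant and positive. Then `ψ` and `ω` are built by induction on the number of
arguments (`IsPartialLift.exists_succ`). At a stage with `m + 1` arguments, the relations determine
the values over the boundary of the parameter cube and where an argument is the unit, that is on a
subset of `I^k × I^m × H^{m+1}`, and the extension problem is to lift a map of this space to the
trivial fibration given by the path fibration of the underlying map of `f'`. This is possible by the
pushout-product argument `lifts_cube_prod_pow`, which reduces it to the pair `(H, 1)`; there, it
follows from the cell structure of a CW complex homotopy equivalent to `H` and well-pointedness
(`lifts_unit`). Over the cube `I^m × I` of parameters and of the time of the homotopy, the composite
`f' ∘ ψ` is known at the end on parameters exceeding the size `l` of `ψ`, because it decomposes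
there; the remaining part `[0, l]^m × 1` of the end is the end at which the path fibration is used.
The homeomorphism `boxMap` of `I^m × I` takes `I^m × 1` to this part.

To express the relations uniformly, `A_n`-maps are treated as functions on words (`IsWordMap`). The
values of such a function on irreducible words, those to which none of the relations apply, can be
prescribed (`isWordMap_extendWord`), and they determine it (`IsWordMap.ext_irreducible`). Hence a
family can be changed on words of one more letter by giving its values there, compatibly with the
shorter words (`WordContOn.exists_extension`). All continuity is tested on compact Hausdorff spaces
(`KContOn`, `WordContOn`), in accordance with products in compactly generated spaces.
-/

open scoped unitInterval

universe v w

/-! ### Continuity tested on compact Hausdorff spaces -/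

/-- Continuity on the subset `A` in the sense of compactly generated spaces: the composite with
every continuous map from a compact Hausdorff space that lands in `A` is continuous. -/
def KContOn {X : Type v} [TopologicalSpace X] {Y : Type u} [TopologicalSpace Y] (f : X → Y)
    (A : Set X) : Prop :=
  ∀ (K : Type u) [TopologicalSpace K] [CompactSpace K] [T2Space K] (p : K → X), Continuous p →
    (∀ z, p z ∈ A) → Continuous fun z => f (p z)

/-- Continuity in the sense of compactly generated spaces. -/
def KCont {X : Type v} [TopologicalSpace X] {Y : Type u} [TopologicalSpace Y] (f : X → Y) : Prop :=
  ∀ (K : Type u) [TopologicalSpace K] [CompactSpace K] [T2Space K] (p : K → X), Continuous p →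
    Continuous fun z => f (p z)

section KContinuity

variable {X : Type v} [TopologicalSpace X] {Y : Type u} [TopologicalSpace Y]
  {Z : Type w} [TopologicalSpace Z]

theorem kCont_iff_generatedBy {f : X → Y} : KCont f ↔ ContinuousGeneratedBy KTest.{u} f :=
  ⟨fun h K p => h K p p.continuous, fun h K _ _ _ p hp => h (i := CompHaus.of K) ⟨p, hp⟩⟩

theorem kContOn_univ {f : X → Y} : KContOn f univ ↔ KCont f :=
  ⟨fun h K _ _ _ p hp => h K p hp fun _ => mem_univ _, fun h K _ _ _ p hp _ => h K p hp⟩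

theorem Continuous.kCont {f : X → Y} (hf : Continuous f) : KCont f :=
  fun _ _ _ _ _ hp => hf.comp hp

theorem KCont.kContOn {f : X → Y} (hf : KCont f) (A : Set X) : KContOn f A :=
  fun K _ _ _ p hp _ => hf K p hp

theorem KContOn.mono {f : X → Y} {A B : Set X} (hf : KContOn f A) (h : B ⊆ A) : KContOn f B :=
  fun K _ _ _ p hp hB => hf K p hp fun z => h (hB z)

theorem KContOn.congr {f g : X → Y} {A : Set X} (hf : KContOn f A) (h : ∀ x ∈ A, g x = f x) :
    KContOn g A :=
  fun K _ _ _ p hp hA => (hf K p hp hA).congr fun z => (h _ (hA z)).symm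

theorem KContOn.comp_continuous {f : X → Y} {A : Set X} (hf : KContOn f A) {g : Z → X}
    (hg : Continuous g) {B : Set Z} (h : ∀ z ∈ B, g z ∈ A) : KContOn (fun z => f (g z)) B :=
  fun K _ _ _ p hp hB => hf K (fun z => g (p z)) (hg.comp hp) fun z => h _ (hB z)

theorem KCont.comp_continuous {f : X → Y} (hf : KCont f) {g : Z → X} (hg : Continuous g) :
    KCont fun z => f (g z) :=
  fun K _ _ _ p hp => hf K (fun z => g (p z)) (hg.comp hp)

theorem KCont.comp_kContOn {Y' : Type u} [TopologicalSpace Y'] {g : Y → Y'} (hg : KCont g)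
    {f : X → Y} {A : Set X} (hf : KContOn f A) : KContOn (fun x => g (f x)) A :=
  fun K _ _ _ p hp hA => hg K _ (hf K p hp hA)

theorem KCont.comp {Y' : Type u} [TopologicalSpace Y'] {g : Y → Y'} (hg : KCont g)
    {f : X → Y} (hf : KCont f) : KCont fun x => g (f x) :=
  fun K _ _ _ p hp => hg K _ (hf K p hp)

/-- A function on a compact Hausdorff space is continuous if it is so on two closed sets that
cover. -/
theorem continuous_of_closed_cover {K : Type v} [TopologicalSpace K] {f : K → Y} {A B : Set K}
    (hA : IsClosed A) (hB : IsClosed B) (h : ∀ z, z ∈ A ∨ z ∈ B)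
    (hfA : Continuous fun z : A => f z) (hfB : Continuous fun z : B => f z) : Continuous f := by
  rw [← continuousOn_univ, ← (Set.eq_univ_of_forall h : A ∪ B = univ)]
  exact (continuousOn_iff_continuous_domRestrict.2 hfA).union_of_isClosed
    (continuousOn_iff_continuous_domRestrict.2 hfB) hA hB

theorem continuous_of_finite_closed_cover {ι : Type*} [Finite ι] {K : Type v} [TopologicalSpace K]
    {f : K → Y} {A : ι → Set K} (hA : ∀ i, IsClosed (A i)) (h : ∀ z, ∃ i, z ∈ A i)
    (hf : ∀ i, Continuous fun z : A i => f z) : Continuous f :=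
  (locallyFinite_of_finite A).continuous (Set.eq_univ_of_forall fun z => mem_iUnion.2 (h z)) hA
    fun i => continuousOn_iff_continuous_domRestrict.2 (hf i)

theorem KContOn.union {f : X → Y} {A B : Set X} (hA : IsClosed A) (hB : IsClosed B)
    (hfA : KContOn f A) (hfB : KContOn f B) : KContOn f (A ∪ B) := by
  intro K _ _ _ p hp h
  have hA' := hA.preimage hp
  have hB' := hB.preimage hp
  have := isCompact_iff_compactSpace.1 hA'.isCompact
  have := isCompact_iff_compactSpace.1 hB'.isCompact
  exact continuous_of_closed_cover hA' hB' h
    (hfA (p ⁻¹' A) (fun z => p z) (hp.comp continuous_subtype_val) fun z => z.2)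
    (hfB (p ⁻¹' B) (fun z => p z) (hp.comp continuous_subtype_val) fun z => z.2)

/-- On a compact Hausdorff space of the lowest universe, continuity in the sense of compactly
generated spaces is continuity. -/
theorem KContOn.continuous_comp {K : Type} [TopologicalSpace K] [CompactSpace K] [T2Space K]
    {f : X → Y} {A : Set X} (hf : KContOn f A) {p : K → X} (hp : Continuous p)
    (hA : ∀ z, p z ∈ A) : Continuous fun z => f (p z) := by
  have := hf (ULift.{u} K) (fun z => p z.down) (hp.comp continuous_uliftDown) fun z => hA _
  exact this.comp continuous_uliftUp

theorem KCont.continuous_comp {K : Type} [TopologicalSpace K] [CompactSpace K] [T2Space K]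
    {f : X → Y} (hf : KCont f) {p : K → X} (hp : Continuous p) : Continuous fun z => f (p z) :=
  (hf.kContOn univ).continuous_comp hp fun _ => mem_univ _

theorem KCont.continuous {K : Type} [TopologicalSpace K] [CompactSpace K] [T2Space K]
    {f : K → Y} (hf : KCont f) : Continuous f :=
  hf.continuous_comp continuous_id

theorem ContinuousOn.kContOn {f : X → Y} {A : Set X} (hf : ContinuousOn f A) : KContOn f A :=
  fun _ _ _ _ p hp hA => by
    have := (continuousOn_iff_continuous_domRestrict.1 hf).comp (hp.subtype_mk hA)
    exact this

/-- A map of a compact Hausdorff space into a mapping space is continuous if and only if its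
adjoint is. -/
theorem continuous_kMap_iff {K : Type u} [TopologicalSpace K] [CompactSpace K] [T2Space K]
    {X : Type u} [TopologicalSpace X] {g : K → KMap X Y} :
    Continuous g ↔ KCont fun z : K × X => g z.1 z.2 := by
  rw [ContinuousMapGeneratedBy.continuous_iff]
  constructor
  · intro h L _ _ _ p hp
    have h1 : Continuous fun z : K × L =>
        (ContinuousMapGeneratedBy.precomp (X := KTest.{u}) (i := CompHaus.of L)
          ⟨fun y => (p y).2, continuous_snd.comp hp⟩ (g z.1)) z.2 :=
      ContinuousMap.continuous_uncurry_of_continuous ⟨_, h (CompHaus.of L) ⟨_, _⟩⟩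
    exact h1.comp ((continuous_fst.comp hp).prodMk continuous_id)
  · intro h L p
    refine (ContinuousMap.curry ⟨fun z : K × L => g z.1 (p z.2), ?_⟩).continuous
    exact h (K × L) (fun z => (z.1, p z.2)) (by fun_prop)

theorem kContOn_kMap_iff {X Y : Type u} [TopologicalSpace X] [TopologicalSpace Y] {g : Z → KMap X Y}
    {A : Set Z} : KContOn g A ↔ KContOn (fun z : Z × X => g z.1 z.2) {z | z.1 ∈ A} :=
  ⟨fun h L _ _ _ p hp hA => (continuous_kMap_iff.1 (h L (fun y => (p y).1) (continuous_fst.comp hp)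
      hA)) L (fun y => (y, (p y).2)) (continuous_id.prodMk (continuous_snd.comp hp)),
    fun h K _ _ _ p hp hA => continuous_kMap_iff.2 fun L _ _ _ r hr =>
      h L (fun y => (p (r y).1, (r y).2)) (by fun_prop) fun y => hA _⟩

theorem kCont_kMap_iff {X Y : Type u} [TopologicalSpace X] [TopologicalSpace Y] {g : Z → KMap X Y} :
    KCont g ↔ KCont fun z : Z × X => g z.1 z.2 := by
  rw [← kContOn_univ, kContOn_kMap_iff, ← kContOn_univ]
  rfl

end KContinuity

/-! ### Lifting properties, fibrations and NDR pairs -/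

section Lifting

variable {X : Type v} [TopologicalSpace X] {X' : Type w} [TopologicalSpace X']
  {E N : Type u} [TopologicalSpace E] [TopologicalSpace N] {q : E → N}

/-- The pair `(X, A)` has the left lifting property with respect to `q`. -/
def Lifts (q : E → N) (A : Set X) : Prop :=
  ∀ (w : X → N) (u₀ : X → E), KCont w → KContOn u₀ A → (∀ x ∈ A, q (u₀ x) = w x) →
    ∃ u : X → E, KCont u ∧ (∀ x, q (u x) = w x) ∧ ∀ x ∈ A, u x = u₀ x

theorem Lifts.of_homeomorph {A : Set X} {A' : Set X'} (hl : Lifts q A') (e : X ≃ₜ X')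
    (h : ∀ x, x ∈ A ↔ e x ∈ A') : Lifts q A := by
  intro w u₀ hw hu₀ hq
  obtain ⟨u, hu, h1, h2⟩ := hl (fun x => w (e.symm x)) (fun x => u₀ (e.symm x))
    (hw.comp_continuous e.symm.continuous)
    (hu₀.comp_continuous e.symm.continuous fun z hz => by rw [h]; simpa using hz)
    (fun x hx => hq _ (by rw [h]; simpa using hx))
  refine ⟨fun x => u (e x), hu.comp_continuous e.continuous, fun x => by simp [h1], fun x hx => ?_⟩
  simpa using h2 (e x) ((h x).1 hx)

/-- Hurewicz fibrations: maps with the homotopy lifting property for all spaces. -/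
def IsKFibration (q : E → N) : Prop :=
  ∀ (Z : Type u) [TopologicalSpace Z], Lifts q {z : Z × I | z.2 = 0}

/-- A neighbourhood deformation retract pair, in the following weak form: `h` is a homotopy that
starts with the identity and `u` is a function vanishing on `A` such that the path of `x` lies in
`A` at the time `u x`, unless `u x = 1`. -/
def IsNDR (A : Set X) : Prop :=
  ∃ (u : X → I) (h : X × I → X), Continuous u ∧ Continuous h ∧ (∀ x, h (x, 0) = x) ∧
    (∀ x, u x = 1 ∨ h (x, u x) ∈ A) ∧ ∀ x ∈ A, u x = 0

theorem IsNDR.empty : IsNDR (∅ : Set X) :=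
  ⟨fun _ => 1, Prod.fst, continuous_const, continuous_fst, fun _ => rfl, fun _ => Or.inl rfl,
    fun _ h => h.elim⟩

theorem IsNDR.prod {A : Set X} {B : Set X'} (hA : IsNDR A) (hB : IsNDR B) :
    IsNDR {z : X × X' | z.1 ∈ A ∨ z.2 ∈ B} := by
  obtain ⟨u, h, hu, hh, h0, h1, h2⟩ := hA
  obtain ⟨u', h', hu', hh', h0', h1', h2'⟩ := hB
  refine ⟨fun z => u z.1 ⊓ u' z.2, fun z => (h (z.1.1, z.2), h' (z.1.2, z.2)), by fun_prop,
    by fun_prop, fun z => by simp [h0, h0'], fun z => ?_, fun z hz => ?_⟩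
  · rcases le_total (u z.1) (u' z.2) with hle | hle
    · simp only [inf_eq_left.2 hle]
      exact (h1 z.1).imp_right Or.inl
    · simp only [inf_eq_right.2 hle]
      exact (h1' z.2).imp_right Or.inr
  · rcases hz with hz | hz
    · simp [h2 _ hz]
    · simp [h2' _ hz]

/-- Truncated subtraction in the unit interval. -/
def unitInterval.tsub (a b : I) : I :=
  ⟨max (a - b) 0, le_max_right _ _, max_le (by linarith [a.2.2, b.2.1]) zero_le_one⟩

@[fun_prop]
theorem unitInterval.continuous_tsub {f g : X → I} (hf : Continuous f) (hg : Continuous g) :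
    Continuous fun x => unitInterval.tsub (f x) (g x) := by
  unfold unitInterval.tsub
  fun_prop

@[simp] theorem unitInterval.tsub_self (a : I) : unitInterval.tsub a a = 0 := by
  simp [unitInterval.tsub]

@[simp] theorem unitInterval.tsub_zero (a : I) : unitInterval.tsub a 0 = a := by
  ext
  simp [unitInterval.tsub, a.2.1]

/-- For an NDR pair `(X, A)`, the cylinder `X × I` deforms to `X × 0 ∪ A × I`, in such a way that the
point `y` needs the time `φ y`. -/
theorem IsNDR.exists_deformation {A : Set X} (hA : IsNDR A) :
    ∃ (φ : X × I → I) (D : (X × I) × I → X × I), Continuous φ ∧ Continuous D ∧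
      (∀ y, (D (y, 0)).2 = 0 ∨ (D (y, 0)).1 ∈ A) ∧ (∀ y, D (y, φ y) = y) ∧
      ∀ y : X × I, y.2 = 0 ∨ y.1 ∈ A → φ y = 0 := by
  obtain ⟨u, h, hu, hh, h0, h1, h2⟩ := hA
  refine ⟨fun y => y.2 ⊓ u y.1, fun z => (h (z.1.1, unitInterval.tsub (z.1.2 ⊓ u z.1.1) z.2),
    unitInterval.tsub z.1.2 (unitInterval.tsub (z.1.2 ⊓ u z.1.1) z.2)), by fun_prop, by fun_prop,
    fun y => ?_, fun y => ?_, fun y hy => ?_⟩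
  · simp only [unitInterval.tsub_zero]
    rcases le_total y.2 (u y.1) with hle | hle
    · left
      rw [inf_eq_left.2 hle]
      simp
    · rw [inf_eq_right.2 hle]
      rcases h1 y.1 with h | h
      · left
        rw [h] at hle ⊢
        rw [le_antisymm unitInterval.le_one' hle]
        simp
      · exact Or.inr h
  · simp [h0]
  · rcases hy with hy | hy
    · simp [hy]
    · simp [h2 _ hy]

/-- The homotopy extension property of NDR pairs. -/
theorem IsNDR.exists_extension {A : Set X} (hA : IsNDR A) {Y : Type u} [TopologicalSpace Y]
    (f : X × I → Y) (hf : KContOn f {y | y.2 = 0 ∨ y.1 ∈ A}) :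
    ∃ F : X × I → Y, KCont F ∧ (∀ y : X × I, y.2 = 0 ∨ y.1 ∈ A → F y = f y) ∧
      ∀ y, ∃ b : X × I, (b.2 = 0 ∨ b.1 ∈ A) ∧ F y = f b := by
  obtain ⟨φ, D, hφ, hD, h0, h1, h2⟩ := hA.exists_deformation
  refine ⟨fun y => f (D (y, 0)), ?_, fun y hy => ?_, fun y => ⟨D (y, 0), h0 y, rfl⟩⟩
  · exact kContOn_univ.1 (hf.comp_continuous (g := fun y => D (y, 0)) (by fun_prop)
      fun z _ => h0 z)
  · have := h1 y
    rw [h2 y hy] at this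
    simp only [this]

/-- The relative homotopy lifting property of fibrations with respect to NDR pairs. -/
theorem IsKFibration.lifts_ndr {X : Type u} [TopologicalSpace X] (hq : IsKFibration q) {A : Set X}
    (hA : IsNDR A) : Lifts q {y : X × I | y.2 = 0 ∨ y.1 ∈ A} := by
  intro w u₀ hw hu₀ hqu
  obtain ⟨φ, D, hφ, hD, h0, h1, h2⟩ := hA.exists_deformation
  obtain ⟨u, hu, hu1, hu2⟩ := hq (X × I) (fun z => w (D z)) (fun z => u₀ (D (z.1, 0)))
    (hw.comp_continuous hD) (hu₀.comp_continuous (by fun_prop) fun z _ => h0 z.1)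
    (fun z hz => by
      obtain ⟨y, t⟩ := z
      obtain rfl : t = 0 := hz
      exact hqu _ (h0 y))
  refine ⟨fun y => u (y, φ y), hu.comp_continuous (by fun_prop), fun y => by rw [hu1, h1],
    fun y hy => ?_⟩
  have e := h1 y
  rw [h2 y hy] at e
  change u (y, φ y) = u₀ y
  rw [h2 y hy, hu2 _ rfl]
  simp only [e]

/-! #### Pullback powers -/

/-- The base of the pullback power of `q` by the pair `(X, A)`: a map of `X` to the base of `q` with
a lift over `A`. -/
def PowBase {X : Type u} [TopologicalSpace X] (q : E → N) (A : Set X) : Type u :=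
  {z : KMap X N × KMap A E // ∀ a : A, q (z.2 a) = z.1 a}

instance {X : Type u} [TopologicalSpace X] (q : E → N) (A : Set X) :
    TopologicalSpace (PowBase q A) :=
  inferInstanceAs (TopologicalSpace {z : KMap X N × KMap A E // ∀ a : A, q (z.2 a) = z.1 a})

/-- The pullback power of `q` by the pair `(X, A)`: it sends a map `X → E` to its composite with `q`
and its restriction to `A`. -/
def pow {X : Type u} [TopologicalSpace X] (q : E → N) (hq : KCont q) (A : Set X) (f : KMap X E) :
    PowBase q A :=
  ⟨(⟨fun x => q (f x), kCont_iff_generatedBy.1 (hq.comp (kCont_iff_generatedBy.2 f.prop))⟩,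
    ⟨fun a => f a, kCont_iff_generatedBy.1
      ((kCont_iff_generatedBy.2 f.prop).comp_continuous continuous_subtype_val)⟩), fun _ => rfl⟩

theorem PowBase.kContOn_iff {X : Type u} [TopologicalSpace X] {A : Set X} {Z : Type v}
    [TopologicalSpace Z] {g : Z → PowBase q A} {B : Set Z} : KContOn g B ↔
      KContOn (fun z : Z × X => (g z.1).1.1 z.2) {z | z.1 ∈ B} ∧
      KContOn (fun z : Z × A => (g z.1).1.2 z.2) {z | z.1 ∈ B} := by
  rw [← kContOn_kMap_iff (g := fun z => (g z).1.1), ← kContOn_kMap_iff (g := fun z => (g z).1.2)]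
  constructor
  · exact fun h => ⟨fun K _ _ _ p hp hA => continuous_fst.comp
      (continuous_subtype_val.comp (h K p hp hA)), fun K _ _ _ p hp hA => continuous_snd.comp
      (continuous_subtype_val.comp (h K p hp hA))⟩
  · exact fun h K _ _ _ p hp hA => Continuous.subtype_mk ((h.1 K p hp hA).prodMk
      (h.2 K p hp hA)) _

theorem kCont_pow {X : Type u} [TopologicalSpace X] (hq : KCont q) (A : Set X) :
    KCont (pow q hq A) := by
  have h : KCont fun z : KMap X E × X => z.1 z.2 :=
    kCont_kMap_iff.1 (continuous_id (X := KMap X E)).kCont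
  rw [← kContOn_univ, PowBase.kContOn_iff]
  exact ⟨(hq.comp h).kContOn _, (h.comp_continuous (g := fun z : KMap X E × A => (z.1, z.2.1))
    (by fun_prop)).kContOn _⟩

/-- The adjunction between pullback powers and pushout products. -/
theorem lifts_pow_iff [Nonempty E] {X : Type u} [TopologicalSpace X] (hq : KCont q) {A : Set X}
    (hA : IsClosed A) {Z : Type v} [TopologicalSpace Z] {B : Set Z} (hB : IsClosed B) :
    Lifts (pow q hq A) B ↔ Lifts q {z : Z × X | z.1 ∈ B ∨ z.2 ∈ A} := by
  classical
  constructor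
  · intro h w u₀ hw hu₀ hqu
    let g : Z → PowBase q A := fun z => ⟨(⟨fun x => w (z, x), kCont_iff_generatedBy.1
      (hw.comp_continuous (by fun_prop))⟩, ⟨fun a => u₀ (z, a), kCont_iff_generatedBy.1
      (kContOn_univ.1 (hu₀.comp_continuous (g := fun a : A => (z, a.1)) (by fun_prop)
        fun a _ => Or.inr a.2))⟩), fun a => hqu _ (Or.inr a.2)⟩
    let k : Z → KMap X E := fun z => if hz : z ∈ B then ⟨fun x => u₀ (z, x),
      kCont_iff_generatedBy.1 (kContOn_univ.1 (hu₀.comp_continuous (g := fun x => (z, x))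
        (by fun_prop) fun _ _ => Or.inl hz))⟩ else ⟨fun _ => Classical.arbitrary E,
      kCont_iff_generatedBy.1 continuous_const.kCont⟩
    have hk : ∀ z ∈ B, ∀ x, k z x = u₀ (z, x) := fun z hz x => by
      simp only [k, dif_pos hz]
      rfl
    obtain ⟨u, hu, hu1, hu2⟩ := h g k
      (kContOn_univ.1 (PowBase.kContOn_iff.2 ⟨hw.kContOn _, hu₀.comp_continuous
        (g := fun z : Z × A => (z.1, z.2.1)) (by fun_prop) fun a _ => Or.inr a.2.2⟩))
      (kContOn_kMap_iff.2 ((hu₀.mono fun z hz => Or.inl hz).congr fun z hz => hk z.1 hz z.2))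
      (fun z hz => Subtype.ext (Prod.ext
        (ContinuousMapGeneratedBy.ext (funext fun x => by
          change q (k z x) = w (z, x)
          rw [hk z hz]
          exact hqu _ (Or.inl hz)))
        (ContinuousMapGeneratedBy.ext (funext fun x => hk z hz x))))
    refine ⟨fun z => u z.1 z.2, kCont_kMap_iff.1 hu, fun z => ?_, ?_⟩
    · exact congrArg (fun c : PowBase q A => c.1.1 z.2) (hu1 z.1)
    · rintro ⟨z, x⟩ (hz | hx)
      · simp only [hu2 z hz, hk z hz]
      · exact congrArg (fun c : PowBase q A => c.1.2 ⟨x, hx⟩) (hu1 z)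
  · intro h g k hg hk hqk
    rw [← kContOn_univ, PowBase.kContOn_iff] at hg
    have hk' := kContOn_kMap_iff.1 hk
    let u₀ : Z × X → E := fun z => if hz : z.2 ∈ A then (g z.1).1.2 ⟨z.2, hz⟩ else k z.1 z.2
    have h1 : ∀ z : Z × X, ∀ hz : z.2 ∈ A, u₀ z = (g z.1).1.2 ⟨z.2, hz⟩ := fun z hz => dif_pos hz
    have h2 : ∀ z : Z × X, z.1 ∈ B → u₀ z = k z.1 z.2 := by
      intro z hz
      by_cases hx : z.2 ∈ A
      · rw [h1 z hx, ← hqk z.1 hz]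
        rfl
      · exact dif_neg hx
    obtain ⟨u, hu, hu1, hu2⟩ := h (fun z => (g z.1).1.1 z.2) u₀ (kContOn_univ.1 hg.1)
      (KContOn.union (hB.preimage continuous_fst) (hA.preimage continuous_snd)
        (hk'.congr h2) (by
          intro K _ _ _ p hp hpA
          refine (hg.2 K (fun z => ((p z).1, ⟨(p z).2, hpA z⟩)) (by fun_prop)
            fun _ => mem_univ _).congr fun z => ?_
          exact (h1 _ (hpA z)).symm))
      (by
        rintro ⟨z, x⟩ (hz | hx)
        · rw [h2 _ hz]
          exact congrArg (fun c : PowBase q A => c.1.1 x) (hqk z hz)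
        · rw [h1 _ hx]
          exact (g z).2 ⟨x, hx⟩)
    refine ⟨fun z => ⟨fun x => u (z, x), kCont_iff_generatedBy.1
      (hu.comp_continuous (by fun_prop))⟩, kCont_kMap_iff.2 hu, fun z => ?_, fun z hz => ?_⟩
    · refine Subtype.ext (Prod.ext (ContinuousMapGeneratedBy.ext (funext fun x => hu1 (z, x)))
        (ContinuousMapGeneratedBy.ext (funext fun x => ?_)))
      exact (hu2 (z, x) (Or.inr x.2)).trans (h1 _ x.2)
    · exact ContinuousMapGeneratedBy.ext (funext fun x =>
        (hu2 (z, x) (Or.inl hz)).trans (h2 _ hz))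

theorem IsKFibration.pow [Nonempty E] {X : Type u} [TopologicalSpace X] (hf : IsKFibration q)
    (hq : KCont q) {A : Set X} (hA : IsClosed A) (hA' : IsNDR A) :
    IsKFibration (pow q hq A) := by
  intro Z _
  rw [lifts_pow_iff hq hA (isClosed_eq continuous_snd continuous_const)]
  refine (hf.lifts_ndr ((IsNDR.empty (X := Z)).prod hA')).of_homeomorph
    ((Homeomorph.prodAssoc Z I X).trans (((Homeomorph.refl Z).prodCongr
      (Homeomorph.prodComm I X)).trans (Homeomorph.prodAssoc Z X I).symm)) fun z => ?_
  change (z.1.2 = 0 ∨ z.2 ∈ A) ↔ (z.1.2 = 0 ∨ (z.1.1 ∈ (∅ : Set Z) ∨ z.2 ∈ A))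
  simp

end Lifting

/-! ### Examples of NDR pairs -/

section NDRExamples

theorem IsNDR.of_homeomorph {X : Type v} [TopologicalSpace X] {X' : Type w} [TopologicalSpace X']
    {A : Set X} {A' : Set X'} (hl : IsNDR A') (e : X ≃ₜ X') (h : ∀ x, x ∈ A ↔ e x ∈ A') :
    IsNDR A := by
  obtain ⟨u, k, hu, hk, h0, h1, h2⟩ := hl
  refine ⟨fun x => u (e x), fun z => e.symm (k (e z.1, z.2)), by fun_prop, by fun_prop,
    fun x => by simp [h0], fun x => ?_, fun x hx => h2 _ ((h x).1 hx)⟩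
  exact (h1 (e x)).imp_right fun hx => by simpa [h] using hx

/-- The time `u` is `1` on the middle third, and the homotopy stretches the interval from its
midpoint, truncated at the ends. -/
theorem isNDR_interval : IsNDR ({0, 1} : Set I) := by
  let u : I → I := fun x => projIcc 0 1 zero_le_one (min (3 * (x : ℝ)) (3 * (1 - x)))
  let h : I × I → I := fun z => projIcc 0 1 zero_le_one ((z.1 : ℝ) + z.2 * (2 * z.1 - 1))
  refine ⟨u, h, by fun_prop, by fun_prop, fun x => by simp [h], fun x => ?_, ?_⟩
  · have hx := x.2
    by_cases h1 : (x : ℝ) < 1 / 3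
    · right; left
      have hu : (u x : ℝ) = 3 * x := by
        simp only [u, coe_projIcc]
        rw [min_eq_left (b := 3 * (1 - (x : ℝ))) (by linarith), min_eq_right (by linarith),
          max_eq_right (by linarith [hx.1])]
      simp only [h, hu]
      exact projIcc_of_le_left _ (by nlinarith [hx.1])
    by_cases h2 : 2 / 3 < (x : ℝ)
    · right; right
      have hu : (u x : ℝ) = 3 * (1 - x) := by
        simp only [u, coe_projIcc]
        rw [min_eq_right (a := 3 * (x : ℝ)) (by linarith), min_eq_right (by linarith),
          max_eq_right (by linarith [hx.2])]
      simp only [h, hu]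
      exact projIcc_of_right_le _ (by nlinarith [hx.2])
    · left
      exact projIcc_of_right_le _ (le_min (by linarith) (by linarith))
  · rintro x (rfl | rfl)
    · simp [u]
    · simp [u]

/-- The decomposition of a power into its first factor and the other ones. -/
def consHomeomorph (α : Type v) [TopologicalSpace α] (m : ℕ) :
    (Fin (m + 1) → α) ≃ₜ α × (Fin m → α) where
  toFun y := (y 0, fun j => y j.succ)
  invFun z := Fin.cons z.1 z.2
  left_inv y := funext fun j => Fin.cases rfl (fun _ => rfl) j
  right_inv z := rfl
  continuous_toFun := by fun_prop
  continuous_invFun := by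
    refine continuous_pi fun j => Fin.cases ?_ (fun i => ?_) j
    · exact continuous_fst
    · exact (continuous_apply i).comp continuous_snd

theorem mem_boundary_succ {m : ℕ} {y : Fin (m + 1) → I} : y ∈ Cube.boundary (Fin (m + 1)) ↔
    y 0 ∈ ({0, 1} : Set I) ∨ (fun j : Fin m => y j.succ) ∈ Cube.boundary (Fin m) := by
  simp only [Cube.boundary, mem_ofPred_eq, Fin.exists_fin_succ]
  rfl

theorem isClosed_boundary (m : ℕ) : IsClosed (Cube.boundary (Fin m)) := by
  simp only [Cube.boundary, ofPred_exists]
  exact isClosed_iUnion_of_finite fun i => (isClosed_eq (continuous_apply i) continuous_const).union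
    (isClosed_eq (continuous_apply i) continuous_const)

theorem boundary_zero : Cube.boundary (Fin 0) = ∅ := by
  ext y
  simp [Cube.boundary]

theorem isNDR_boundary (m : ℕ) : IsNDR (Cube.boundary (Fin m)) := by
  induction m with
  | zero => rw [boundary_zero]; exact IsNDR.empty
  | succ m ih =>
    exact (isNDR_interval.prod ih).of_homeomorph (consHomeomorph I m) fun y => mem_boundary_succ

theorem isClosed_singleton_of_weakHausdorff {X : Type u} [TopologicalSpace X]
    [h : WeakHausdorffSpace X] (x : X) : IsClosed {x} := by
  have := h.isClosed_range (CompHaus.of PUnit.{u + 1}) ⟨fun _ => x, continuous_const⟩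
  rwa [show range (⟨fun _ => x, continuous_const⟩ : C(CompHaus.of PUnit.{u + 1}, X)) = {x} from
    range_const (ι := PUnit.{u + 1})] at this

/-- The unit of a well-pointed monoid is an NDR: the function is read off from a retraction of the
cylinder to the mapping cylinder of the inclusion of the unit. -/
theorem WellPointed.isNDR {G : Type u} [Monoid G] [TopologicalSpace G] [CGMonoid G]
    (hG : WellPointed G) : IsNDR ({1} : Set G) := by
  obtain ⟨F, hF0, hF1⟩ := hG {y : I × G // y.1 = 0 ∨ y.2 = 1}
    ⟨fun g => ⟨(0, g), Or.inl rfl⟩, by fun_prop⟩ ⟨fun s => ⟨(s, 1), Or.inr rfl⟩, by fun_prop⟩ rfl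
  have := (CGMonoid.weakHausdorff : WeakHausdorffSpace G)
  let r : G → I → ℝ := fun x t => t - (F (t, x)).1.1
  let s : G → ℝ := fun x => sSup (r x '' univ)
  have hr : Continuous ↿r := by
    have : Continuous fun z : G × I => (z.2 : ℝ) - (F (z.2, z.1)).1.1 := by fun_prop
    exact this
  have hs : Continuous s := isCompact_univ.continuous_sSup hr
  have hle : ∀ x t, r x t ≤ s x := fun x t => le_csSup
    ⟨1, by rintro _ ⟨t, -, rfl⟩; simp only [r]; linarith [t.2.2, (F (t, x)).1.1.2.1]⟩ ⟨t, trivial, rfl⟩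
  refine ⟨fun x => projIcc 0 1 zero_le_one (s x), fun z => (F (z.2, z.1)).1.2, by fun_prop,
    by fun_prop, fun x => by simp [hF0], fun x => ?_, ?_⟩
  · by_cases h1 : s x < 1
    · right
      set a : I := projIcc 0 1 zero_le_one (s x) with ha
      have h0 : 0 ≤ s x := le_trans (by simp [r, hF0]) (hle x 0)
      have ha' : (a : ℝ) = s x := by
        rw [ha, coe_projIcc, min_eq_right h1.le, max_eq_right h0]
      have hcl : IsClosed {t : I | (F (t, x)).1.2 ∈ ({1} : Set G)} :=
        (isClosed_singleton_of_weakHausdorff (1 : G)).preimage (by fun_prop)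
      have hsub : Ioi a ⊆ {t : I | (F (t, x)).1.2 ∈ ({1} : Set G)} := by
        intro t ht
        rcases (F (t, x)).2 with h | h
        · exfalso
          have h3 := hle x t
          simp only [r, h, Icc.coe_zero, sub_zero] at h3
          have h4 : (a : ℝ) < t := ht
          linarith
        · exact h
      have h5 := hcl.closure_subset_iff.2 hsub
      have hne : (Ioi a).Nonempty := ⟨1, show (a : ℝ) < (1 : I) by rw [ha']; simpa using h1⟩
      rw [closure_Ioi' hne] at h5
      exact h5 self_mem_Ici
    · left
      exact projIcc_of_right_le _ (not_lt.1 h1)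
  · rintro x rfl
    refine projIcc_of_le_left _ (csSup_le ⟨_, 0, trivial, rfl⟩ ?_)
    rintro _ ⟨t, -, rfl⟩
    simp [r, hF1]

end NDRExamples

/-! ### Maps with the lifting property for cubes -/

section TrivialFibrations

variable {E N : Type u} [TopologicalSpace E] [TopologicalSpace N] {q : E → N}

/-- Fibrations with the lifting property for all pairs of a cube and its boundary, that is,
fibrations that are weak equivalences. -/
structure IsTrivialKFibration (q : E → N) : Prop where
  kCont : KCont q
  nonempty : Nonempty E
  fibration : IsKFibration q
  lifts_cube : ∀ m, Lifts q (Cube.boundary (Fin m))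

theorem IsKFibration.lifts_ndr' {X : Type} [TopologicalSpace X] (hq : IsKFibration q) {A : Set X}
    (hA : IsNDR A) : Lifts q {y : X × I | y.2 = 0 ∨ y.1 ∈ A} :=
  (hq.lifts_ndr (hA.of_homeomorph (Homeomorph.ulift.{u}) fun x => (Iff.rfl :
    x ∈ ULift.down ⁻¹' A ↔ _))).of_homeomorph
    (Homeomorph.ulift.symm.prodCongr (Homeomorph.refl I)) fun _ => Iff.rfl

theorem IsNDR.ulift {X : Type} [TopologicalSpace X] {A : Set X} (hA : IsNDR A) :
    IsNDR (ULift.down.{u} ⁻¹' A) :=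
  hA.of_homeomorph (Homeomorph.ulift.{u}) fun _ => Iff.rfl

/-- The end points of the unit interval, in an arbitrary universe. -/
def intervalEnds : Set (ULift.{u} I) := ULift.down ⁻¹' {0, 1}

theorem isClosed_intervalEnds : IsClosed intervalEnds.{u} :=
  (Set.toFinite ({0, 1} : Set I)).isClosed.preimage continuous_uliftDown

theorem IsTrivialKFibration.pow_interval (hq : IsTrivialKFibration q) :
    IsTrivialKFibration (pow q hq.kCont intervalEnds) where
  kCont := kCont_pow _ _
  nonempty := hq.nonempty.map fun e => ⟨fun _ => e, continuous_const.continuousGeneratedBy⟩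
  fibration := by
    have := hq.nonempty
    exact hq.fibration.pow hq.kCont isClosed_intervalEnds isNDR_interval.ulift
  lifts_cube m := by
    have := hq.nonempty
    rw [lifts_pow_iff hq.kCont isClosed_intervalEnds (isClosed_boundary m)]
    refine (hq.lifts_cube (m + 1)).of_homeomorph ((Homeomorph.prodComm _ _).trans
      ((Homeomorph.ulift.prodCongr (Homeomorph.refl _)).trans (consHomeomorph I m).symm))
      fun z => ?_
    rw [mem_boundary_succ]
    exact or_comm

variable {H : Type u} [Monoid H] [TopologicalSpace H]

/-- If the pair of `H` and its unit has the lifting property for all trivial fibrations, then so have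
its products with cubes. -/
theorem lifts_cube_prod (hH : ∀ (E N : Type u) [TopologicalSpace E] [TopologicalSpace N]
    (q : E → N), IsTrivialKFibration q → Lifts q ({1} : Set H)) (hc : IsClosed ({1} : Set H)) (m : ℕ)
    {E N : Type u} [TopologicalSpace E] [TopologicalSpace N] {q : E → N}
    (hq : IsTrivialKFibration q) :
    Lifts q {z : (Fin m → I) × H | z.1 ∈ Cube.boundary (Fin m) ∨ z.2 ∈ ({1} : Set H)} := by
  induction m generalizing E N with
  | zero =>
    refine (hH E N q hq).of_homeomorph (Homeomorph.uniqueProd _ _) fun z => ?_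
    rw [boundary_zero]
    simp
  | succ m ih =>
    have := hq.nonempty
    have h := (lifts_pow_iff hq.kCont isClosed_intervalEnds
      (((isClosed_boundary m).preimage continuous_fst).union
        (hc.preimage continuous_snd))).1 (ih hq.pow_interval)
    refine h.of_homeomorph ((((consHomeomorph I m).trans (Homeomorph.prodComm _ _)).prodCongr
      (Homeomorph.refl H)).trans ((Homeomorph.prodAssoc _ _ _).trans
        (((Homeomorph.refl _).prodCongr ((Homeomorph.ulift.symm.prodCongr
          (Homeomorph.refl H)).trans (Homeomorph.prodComm _ _))).trans
            (Homeomorph.prodAssoc _ _ _).symm))) fun z => ?_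
    change (z.1 ∈ Cube.boundary (Fin (m + 1)) ∨ _) ↔
      ((_ ∈ Cube.boundary (Fin m) ∨ z.2 ∈ ({1} : Set H)) ∨ z.1 0 ∈ ({0, 1} : Set I))
    rw [mem_boundary_succ]
    tauto

theorem IsTrivialKFibration.pow_unit (hH : ∀ (E N : Type u) [TopologicalSpace E]
    [TopologicalSpace N] (q : E → N), IsTrivialKFibration q → Lifts q ({1} : Set H))
    (hc : IsClosed ({1} : Set H)) (hn : IsNDR ({1} : Set H)) (hq : IsTrivialKFibration q) :
    IsTrivialKFibration (pow q hq.kCont ({1} : Set H)) where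
  kCont := kCont_pow _ _
  nonempty := hq.nonempty.map fun e => ⟨fun _ => e, continuous_const.continuousGeneratedBy⟩
  fibration := by
    have := hq.nonempty
    exact hq.fibration.pow hq.kCont hc hn
  lifts_cube m := by
    have := hq.nonempty
    rw [lifts_pow_iff hq.kCont hc (isClosed_boundary m)]
    exact lifts_cube_prod hH hc m hq

/-- Products of a cube with a power of `H` have the lifting property for trivial fibrations,
relative to the points with a coordinate in the boundary or equal to the unit. -/
theorem lifts_cube_prod_pow (hH : ∀ (E N : Type u) [TopologicalSpace E]
    [TopologicalSpace N] (q : E → N), IsTrivialKFibration q → Lifts q ({1} : Set H))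
    (hc : IsClosed ({1} : Set H)) (hn : IsNDR ({1} : Set H)) (m j : ℕ)
    {E N : Type u} [TopologicalSpace E] [TopologicalSpace N] {q : E → N}
    (hq : IsTrivialKFibration q) :
    Lifts q {z : (Fin m → I) × (Fin j → H) | z.1 ∈ Cube.boundary (Fin m) ∨ ∃ i, z.2 i = 1} := by
  induction j generalizing E N with
  | zero =>
    refine (hq.lifts_cube m).of_homeomorph (Homeomorph.prodUnique _ _) fun z => ?_
    simp
  | succ j ih =>
    have := hq.nonempty
    have hcl : IsClosed {z : (Fin m → I) × (Fin j → H) |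
        z.1 ∈ Cube.boundary (Fin m) ∨ ∃ i, z.2 i = 1} := by
      refine ((isClosed_boundary m).preimage continuous_fst).union ?_
      change IsClosed {z : (Fin m → I) × (Fin j → H) | ∃ i, z.2 i = 1}
      simp only [ofPred_exists]
      exact isClosed_iUnion_of_finite fun i => hc.preimage
        (f := fun z : (Fin m → I) × (Fin j → H) => z.2 i) (by fun_prop)
    have h := (lifts_pow_iff hq.kCont hc hcl).1 (ih (hq.pow_unit hH hc hn))
    refine h.of_homeomorph (((Homeomorph.refl _).prodCongr ((consHomeomorph H j).trans
      (Homeomorph.prodComm _ _))).trans (Homeomorph.prodAssoc _ _ _).symm) fun z => ?_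
    change (z.1 ∈ Cube.boundary (Fin m) ∨ ∃ i, z.2 i = 1) ↔
      ((z.1 ∈ Cube.boundary (Fin m) ∨ ∃ i : Fin j, z.2 i.succ = 1) ∨ z.2 0 = 1)
    rw [Fin.exists_fin_succ]
    tauto

end TrivialFibrations

/-! ### Lifting on CW complexes -/

section CWLifting

variable {E N : Type u} [TopologicalSpace E] [TopologicalSpace N] {q : E → N}

/-- The affine map from the unit cube to the unit ball of the maximum norm. -/
def cubeToBall {m : ℕ} (y : Fin m → I) : Fin m → ℝ := fun i => 2 * y i - 1

/-- A continuous map that is on the unit ball of the maximum norm inverse to `cubeToBall`. -/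
noncomputable def ballToCube {m : ℕ} (x : Fin m → ℝ) : Fin m → I :=
  fun i => projIcc 0 1 zero_le_one ((x i + 1) / 2)

@[fun_prop]
theorem continuous_cubeToBall {m : ℕ} : Continuous (cubeToBall (m := m)) := by
  unfold cubeToBall
  fun_prop

@[fun_prop]
theorem continuous_ballToCube {m : ℕ} : Continuous (ballToCube (m := m)) := by
  unfold ballToCube
  fun_prop

theorem cubeToBall_ballToCube {m : ℕ} {x : Fin m → ℝ} (hx : ‖x‖ ≤ 1) :
    cubeToBall (ballToCube x) = x := by
  funext i
  have h := abs_le.1 ((norm_le_pi_norm x i).trans hx)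
  simp only [cubeToBall, ballToCube, coe_projIcc]
  rw [min_eq_right (by linarith), max_eq_right (by linarith)]
  ring

theorem norm_cubeToBall_le {m : ℕ} (y : Fin m → I) : ‖cubeToBall y‖ ≤ 1 := by
  refine (pi_norm_le_iff_of_nonneg zero_le_one).2 fun i => abs_le.2 ?_
  have := (y i).2
  simp only [cubeToBall]
  constructor <;> linarith [this.1, this.2]

theorem norm_cubeToBall_eq_one_iff {m : ℕ} (y : Fin m → I) :
    ‖cubeToBall y‖ = 1 ↔ y ∈ Cube.boundary (Fin m) := by
  constructor
  · intro h
    by_contra hy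
    refine absurd h (ne_of_lt ((pi_norm_lt_iff zero_lt_one).2 fun i => abs_lt.2 ?_))
    simp only [Cube.boundary, mem_ofPred_eq, not_exists, not_or] at hy
    have h0 : 0 < y i := unitInterval.pos_iff_ne_zero.2 (hy i).1
    have h1 : y i < 1 := unitInterval.lt_one_iff_ne_one.2 (hy i).2
    have h0' : (0 : ℝ) < y i := h0
    have h1' : (y i : ℝ) < 1 := h1
    simp only [cubeToBall]
    constructor <;> linarith
  · rintro ⟨i, hi⟩
    refine le_antisymm (norm_cubeToBall_le y) (le_trans ?_ (norm_le_pi_norm _ i))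
    rcases hi with hi | hi <;> norm_num [cubeToBall, hi]

/-- The lifting property for a ball and its boundary sphere. -/
theorem Lifts.ball {m : ℕ} (h : Lifts q (Cube.boundary (Fin m))) {w : (Fin m → ℝ) → N}
    {u₀ : (Fin m → ℝ) → E} (hw : ContinuousOn w (Metric.closedBall 0 1))
    (hu₀ : ContinuousOn u₀ (Metric.sphere 0 1)) (hq : ∀ x ∈ Metric.sphere 0 1, q (u₀ x) = w x) :
    ∃ u : (Fin m → ℝ) → E, ContinuousOn u (Metric.closedBall 0 1) ∧
      (∀ x ∈ Metric.closedBall 0 1, q (u x) = w x) ∧ ∀ x ∈ Metric.sphere 0 1, u x = u₀ x := by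
  have hs : ∀ y ∈ Cube.boundary (Fin m), cubeToBall y ∈ Metric.sphere 0 1 := fun y hy =>
    mem_sphere_zero_iff_norm.2 ((norm_cubeToBall_eq_one_iff y).2 hy)
  have hb : ∀ y : Fin m → I, cubeToBall y ∈ Metric.closedBall 0 1 := fun y =>
    mem_closedBall_zero_iff.2 (norm_cubeToBall_le y)
  obtain ⟨u, hu, h1, h2⟩ := h (fun y => w (cubeToBall y)) (fun y => u₀ (cubeToBall y))
    (kContOn_univ.1 (hw.kContOn.comp_continuous continuous_cubeToBall fun y _ => hb y))
    (hu₀.kContOn.comp_continuous continuous_cubeToBall hs) (fun y hy => hq _ (hs y hy))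
  refine ⟨fun x => u (ballToCube x), (hu.continuous.comp continuous_ballToCube).continuousOn,
    fun x hx => ?_, fun x hx => ?_⟩
  · rw [h1, cubeToBall_ballToCube (mem_closedBall_zero_iff.1 hx)]
  · have e := cubeToBall_ballToCube (mem_closedBall_zero_iff.1 (Metric.sphere_subset_closedBall hx))
    change u (ballToCube x) = u₀ x
    rw [h2 _ ((norm_cubeToBall_eq_one_iff _).1 (by rw [e]; exact mem_sphere_zero_iff_norm.1 hx)), e]

open RelCWComplex in
/-- Maps of CW complexes lift along maps with the lifting property for cubes. -/
theorem lifts_cwComplex (hq : ∀ m, Lifts q (Cube.boundary (Fin m))) (Y : Type u)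
    [TopologicalSpace Y] [T2Space Y] [CWComplex (univ : Set Y)] : Lifts q (∅ : Set Y) := by
  classical
  intro w u₀ hw _ _
  have hwc : ∀ n (i : cell (univ : Set Y) n),
      ContinuousOn (fun x => w (map n i x)) (Metric.closedBall 0 1) := by
    intro n i
    have hc : IsCompact (Metric.closedBall (0 : Fin n → ℝ) 1) := isCompact_closedBall 0 1
    have := isCompact_iff_compactSpace.1 hc
    exact continuousOn_iff_continuous_domRestrict.2 (hw.continuous_comp
      (continuousOn_iff_continuous_domRestrict.1 (RelCWComplex.continuousOn n i)))
  -- The image of a closed subset of a ball under a characteristic map is closed.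
  have hcl : ∀ (v : Y → E) n (i : cell (univ : Set Y) n),
      ContinuousOn (fun x => v (map n i x)) (Metric.closedBall 0 1) → ∀ F : Set E, IsClosed F →
      IsClosed (v ⁻¹' F ∩ closedCell n i) := by
    intro v n i hv F hF
    have e : v ⁻¹' F ∩ closedCell n i = map n i '' (Metric.closedBall 0 1 ∩
        (fun x => v (map n i x)) ⁻¹' F) := by
      ext y
      constructor
      · rintro ⟨hy, x, hx, rfl⟩
        exact ⟨x, ⟨hx, hy⟩, rfl⟩
      · rintro ⟨x, ⟨hx, hy⟩, rfl⟩
        exact ⟨hy, x, hx, rfl⟩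
    rw [e]
    have h1 : IsClosed (Metric.closedBall 0 1 ∩ (fun x => v (map n i x)) ⁻¹' F) :=
      hv.preimage_isClosed_of_isClosed Metric.isClosed_closedBall hF
    have h2 := (isCompact_closedBall (0 : Fin n → ℝ) 1).of_isClosed_subset h1 inter_subset_left
    exact (h2.image_of_continuousOn
      ((RelCWComplex.continuousOn n i).mono inter_subset_left)).isClosed
  let P : ℕ → (Y → E) → Prop := fun n v => ∀ m < n, ∀ i : cell (univ : Set Y) m,
    ContinuousOn (fun x => v (map m i x)) (Metric.closedBall 0 1) ∧
      ∀ x ∈ Metric.closedBall 0 1, q (v (map m i x)) = w (map m i x)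
  have step : ∀ n v, P n v → ∃ v', P (n + 1) v' ∧
      ∀ m < n, ∀ i : cell (univ : Set Y) m, ∀ y ∈ closedCell m i, v' y = v y := by
    intro n v hv
    have hsphere : ∀ i : cell (univ : Set Y) n, ∃ u : (Fin n → ℝ) → E,
        ContinuousOn u (Metric.closedBall 0 1) ∧
        (∀ x ∈ Metric.closedBall 0 1, q (u x) = w (map n i x)) ∧
        ∀ x ∈ Metric.sphere 0 1, u x = v (map n i x) := by
      intro i
      obtain ⟨J, hJ⟩ := CWComplex.mapsTo n i
      have hx : ∀ x ∈ Metric.sphere (0 : Fin n → ℝ) 1, ∃ k : (Σ m : Fin n, J m),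
          map n i x ∈ closedCell k.1 k.2.1 := by
        intro x hx
        obtain ⟨m, hm, j, hj, h⟩ : ∃ m, ∃ _ : m < n, ∃ j, ∃ _ : j ∈ J m,
            map n i x ∈ closedCell m j := by
          simpa [closedCell] using hJ hx
        exact ⟨⟨⟨m, hm⟩, ⟨j, hj⟩⟩, h⟩
      refine (hq n).ball (hwc n i) ?_ ?_
      · have hmap : Continuous fun x : Metric.sphere (0 : Fin n → ℝ) 1 => map n i x :=
          continuousOn_iff_continuous_domRestrict.1
            ((RelCWComplex.continuousOn n i).mono Metric.sphere_subset_closedBall)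
        refine continuousOn_iff_continuous_domRestrict.2 (continuous_of_finite_closed_cover
          (A := fun k : (Σ m : Fin n, J m) => {x | map n i x.1 ∈ closedCell k.1 k.2.1})
          (fun k => RelCWComplex.isClosed_closedCell.preimage hmap) (fun x => hx x x.2) fun k => ?_)
        refine continuous_iff_isClosed.2 fun F hF => ?_
        have h := hcl v _ k.2.1 (hv k.1 k.1.2 k.2.1).1 F hF
        convert h.preimage (hmap.comp continuous_subtype_val) using 1
        ext x
        exact ⟨fun h => ⟨h, x.2⟩, fun h => h.1⟩
      · intro x h
        obtain ⟨k, z, hz, e⟩ := hx x h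
        rw [← e]
        exact (hv k.1 k.1.2 k.2.1).2 z hz
    choose u hu1 hu2 hu3 using hsphere
    let v' : Y → E := fun y => if h : ∃ i : cell (univ : Set Y) n, y ∈ openCell n i then
      u h.choose ((map n h.choose).symm y) else v y
    have hlow : ∀ m < n, ∀ i : cell (univ : Set Y) m, ∀ y ∈ closedCell m i, v' y = v y := by
      intro m hm i y hy
      refine dif_neg ?_
      rintro ⟨j, hj⟩
      have h1 : y ∈ skeletonLT (univ : Set Y) n :=
        RelCWComplex.skeletonLT_mono (by exact_mod_cast hm)
          (RelCWComplex.closedCell_subset_skeletonLT m i hy)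
      exact (RelCWComplex.disjoint_skeletonLT_openCell le_rfl).le_bot ⟨h1, hj⟩
    have hn : ∀ i : cell (univ : Set Y) n, ∀ x ∈ Metric.closedBall 0 1,
        v' (map n i x) = u i x := by
      intro i x hx
      rcases (Metric.mem_closedBall.1 hx).lt_or_eq with h | h
      · have hex : ∃ j : cell (univ : Set Y) n, map n i x ∈ openCell n j :=
          ⟨i, x, Metric.mem_ball.2 h, rfl⟩
        have hj : hex.choose = i := by
          by_contra hne
          exact (RelCWComplex.disjoint_openCell_of_ne (by
            intro h; exact hne (by simpa using h))).le_bot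
            ⟨hex.choose_spec, (⟨x, Metric.mem_ball.2 h, rfl⟩ : map n i x ∈ openCell n i)⟩
        simp only [v', dif_pos hex]
        rw [hj, (map n i).left_inv (by rw [RelCWComplex.source_eq]; exact Metric.mem_ball.2 h)]
      · have hxs : x ∈ Metric.sphere 0 1 := h
        rw [hu3 i x hxs]
        obtain ⟨J, hJ⟩ := CWComplex.mapsTo n i
        obtain ⟨m, hm, j, hj, h⟩ : ∃ m, ∃ _ : m < n, ∃ j, ∃ _ : j ∈ J m,
            map n i x ∈ closedCell m j := by
          simpa [closedCell] using hJ hxs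
        exact hlow m hm j _ h
    refine ⟨v', fun m hm i => ?_, hlow⟩
    rcases Nat.lt_succ_iff_lt_or_eq.1 hm with hm | rfl
    · have e : ∀ x ∈ Metric.closedBall 0 1, v' (map m i x) = v (map m i x) := fun x hx =>
        hlow m hm i _ ⟨x, hx, rfl⟩
      exact ⟨(hv m hm i).1.congr e, fun x hx => by rw [e x hx]; exact (hv m hm i).2 x hx⟩
    · exact ⟨(hu1 i).congr (hn i), fun x hx => by rw [hn i x hx]; exact hu2 i x hx⟩
  choose! next hnext1 hnext2 using step
  let V : ℕ → Y → E := fun n => Nat.rec u₀ (fun n v => next n v) n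
  have hV : ∀ n, P n (V n) := by
    intro n
    induction n with
    | zero => exact fun m hm => absurd hm (Nat.not_lt_zero m)
    | succ n ih => exact hnext1 n _ ih
  have hst : ∀ m n, m < n → ∀ i : cell (univ : Set Y) m, ∀ y ∈ closedCell m i,
      V n y = V (m + 1) y := by
    intro m n hmn i y hy
    induction n, hmn using Nat.le_induction with
    | base => rfl
    | succ n h ih => exact (hnext2 n _ (hV n) m h i y hy).trans ih
  have hcov : ∀ y : Y, ∃ n, ∃ i : cell (univ : Set Y) n, y ∈ closedCell n i := fun y => by
    have := (CWComplex.union (C := (univ : Set Y))).symm ▸ mem_univ y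
    simpa using this
  choose d i hd using hcov
  let v : Y → E := fun y => V (d y + 1) y
  have hv : ∀ n (i : cell (univ : Set Y) n), ∀ y ∈ closedCell n i, v y = V (n + 1) y := by
    intro n j y hy
    have h1 := hst (d y) (max (d y) n + 1) (by omega) (i y) y (hd y)
    have h2 := hst n (max (d y) n + 1) (by omega) j y hy
    exact h1.symm.trans h2
  have hvc : Continuous v := by
    refine continuous_iff_isClosed.2 fun F hF => ?_
    refine CWComplex.closed' (C := (univ : Set Y)) _ (subset_univ _) fun n j => ?_
    have h1 := hcl (V (n + 1)) n j (hV (n + 1) n (Nat.lt_succ_self n) j).1 F hF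
    convert h1 using 1
    ext y
    constructor
    · rintro ⟨h, h'⟩
      exact ⟨by change V (n + 1) y ∈ F; rw [← hv n j y h']; exact h, h'⟩
    · rintro ⟨h, h'⟩
      exact ⟨by change v y ∈ F; rw [hv n j y h']; exact h, h'⟩
  refine ⟨v, hvc.kCont, fun y => ?_, fun _ h => h.elim⟩
  obtain ⟨x, hx, e⟩ := hd y
  have := (hV (d y + 1) (d y) (Nat.lt_succ_self _) (i y)).2 x hx
  rw [e] at this
  exact this

end CWLifting

/-! ### Lifting against the unit of a monoid -/

section UnitLifting

variable {E N : Type u} [TopologicalSpace E] [TopologicalSpace N] {q : E → N}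

/-- Two points in the same fibre of a trivial fibration are joined by a path in the fibre. -/
theorem IsTrivialKFibration.exists_path (hq : IsTrivialKFibration q) {a b : E} (h : q a = q b) :
    ∃ δ : C(I, E), δ 0 = a ∧ δ 1 = b ∧ ∀ t, q (δ t) = q a := by
  classical
  let A : Set (Fin 1 → I) := {y | y 0 = 0}
  let B : Set (Fin 1 → I) := {y | y 0 = 1}
  have hA : IsClosed A := isClosed_eq (continuous_apply 0) continuous_const
  have hB : IsClosed B := isClosed_eq (continuous_apply 0) continuous_const
  have hAB : Cube.boundary (Fin 1) ⊆ A ∪ B := by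
    rintro y ⟨i, hi⟩
    rw [Subsingleton.elim i 0] at hi
    exact hi
  have hBA : ∀ y ∈ B, y 0 ≠ 0 := fun y (hy : y 0 = 1) h0 => by rw [hy] at h0; simp at h0
  obtain ⟨u, hu, h1, h2⟩ := hq.lifts_cube 1 (fun _ => q a) (fun y => if y 0 = 0 then a else b)
    continuous_const.kCont ((KContOn.union hA hB
      ((continuous_const (y := a)).kCont.kContOn A |>.congr fun y hy => if_pos hy)
      ((continuous_const (y := b)).kCont.kContOn B |>.congr fun y hy => if_neg (hBA y hy))).mono
        hAB) (fun y _ => by split_ifs; exacts [rfl, h.symm])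
  refine ⟨⟨fun t => u fun _ => t, hu.continuous.comp (by fun_prop)⟩, ?_, ?_, fun t => h1 _⟩
  · exact (h2 (fun _ => 0) ⟨0, Or.inl rfl⟩).trans (if_pos rfl)
  · exact (h2 (fun _ => 1) ⟨0, Or.inr rfl⟩).trans (if_neg (by simp))

/-- The pair of a well-pointed monoid of the homotopy type of a CW complex and its unit has the
lifting property for trivial fibrations: a lift on the CW complex gives one up to homotopy, the
homotopy is lifted, and the value at the unit is corrected by a path in the fibre. -/
theorem lifts_unit {H : Type u} [Monoid H] [TopologicalSpace H] [CGMonoid H] (hH : WellPointed H)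
    (hcw : HasCWType H) (hq : IsTrivialKFibration q) : Lifts q ({1} : Set H) := by
  classical
  intro w u₀ hw hu₀ hqu
  obtain ⟨Y, _, _, ⟨cw⟩, ⟨e⟩⟩ := hcw
  have := hq.nonempty
  obtain ⟨v, hv, hv1, -⟩ := lifts_cwComplex hq.lifts_cube Y (fun y => w (e.invFun y))
    (fun _ => Classical.arbitrary E) (hw.comp_continuous e.invFun.continuous)
    (fun _ _ _ _ _ _ _ => continuous_const) (fun _ h => h.elim)
  obtain ⟨F⟩ := e.left_inv
  obtain ⟨u₁, hu₁, h1, -⟩ := hq.fibration H (fun z => w (F (z.2, z.1))) (fun z => v (e.toFun z.1))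
    (hw.comp_continuous (by fun_prop))
    ((hv.comp_continuous (e.toFun.continuous.comp continuous_fst)).kContOn _)
    (by
      rintro ⟨x, t⟩ (rfl : t = 0)
      rw [hv1, F.apply_zero]
      rfl)
  have h1' : ∀ x, q (u₁ (x, 1)) = w x := fun x => by
    rw [h1, F.apply_one]
    rfl
  obtain ⟨δ, hδ0, hδ1, hδ⟩ := hq.exists_path ((h1' 1).trans (hqu 1 rfl).symm)
  have hc := @isClosed_singleton_of_weakHausdorff H _ (CGMonoid.weakHausdorff) 1
  obtain ⟨u, hu, h2, h3⟩ := hq.fibration.lifts_ndr hH.isNDR (fun z => w z.1)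
    (fun z => if z.2 = 0 then u₁ (z.1, 1) else δ z.2) (hw.comp_continuous continuous_fst)
    (KContOn.union (isClosed_eq continuous_snd continuous_const) (hc.preimage continuous_fst)
      (((hu₁.comp_continuous (g := fun z : H × I => (z.1, 1)) (by fun_prop)).kContOn _).congr
        fun z hz => if_pos hz)
      (((δ.continuous.comp continuous_snd).kCont.kContOn _).congr fun z hz => by
        split_ifs with h
        · have hz' : z.1 = 1 := hz
          rw [Function.comp_apply, h, hδ0, hz']
        · rfl))
    (by
      rintro ⟨x, t⟩ hz
      dsimp only
      split_ifs with h
      · exact h1' x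
      · rcases hz with hz | hz
        · exact absurd hz h
        · have hz' : x = 1 := hz
          rw [hδ, h1', hz'])
  refine ⟨fun x => u (x, 1), hu.comp_continuous (by fun_prop), fun x => h2 _, ?_⟩
  rintro x (rfl : x = 1)
  change u (1, 1) = u₀ 1
  rw [h3 (1, 1) (Or.inr (mem_singleton 1)), if_neg (by simp), hδ1]

end UnitLifting

/-! ### Path fibrations -/

section PathFibration

variable {M N : Type u} [TopologicalSpace M] [TopologicalSpace N]

/-- The path fibration of `p`: a point of `M` with a path in `N` that ends at its image. -/
def PathSpace (p : M → N) : Type u := {e : M × C(I, N) // e.2 1 = p e.1}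

instance (p : M → N) : TopologicalSpace (PathSpace p) :=
  inferInstanceAs (TopologicalSpace {e : M × C(I, N) // e.2 1 = p e.1})

/-- The projection of the path fibration of `p`. -/
def pathFib (p : M → N) (e : PathSpace p) : N := e.1.2 0

theorem continuous_pathFib (p : M → N) : Continuous (pathFib p) :=
  (continuous_eval_const (0 : I)).comp (continuous_snd.comp continuous_subtype_val)

/-- The path that runs on `[0, 1]` through the initial segment of `β` of length `t` backwards and
then through `γ`. -/
noncomputable def prependPath (β γ : C(I, N)) (t x : I) : N :=
  if (1 + (t : ℝ)) * x ≤ t then β (projIcc 0 1 zero_le_one (t - (1 + t) * x))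
  else γ (projIcc 0 1 zero_le_one ((1 + t) * x - t))

theorem continuous_prependPath {K : Type v} [TopologicalSpace K] {β γ : K → C(I, N)} {t x : K → I}
    (hβ : Continuous β) (hγ : Continuous γ) (ht : Continuous t) (hx : Continuous x)
    (h : ∀ k, β k 0 = γ k 0) : Continuous fun k => prependPath (β k) (γ k) (t k) (x k) := by
  refine Continuous.if_le (by fun_prop) (by fun_prop) (by fun_prop) (by fun_prop) fun k hk => ?_
  rw [hk, sub_self, projIcc_left]
  exact h k

/-- A homotopy of end points is lifted by running through the initial segments of its paths
backwards before the given paths. -/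
theorem isKFibration_pathFib (p : M → N) : IsKFibration (pathFib p) := by
  intro Z _ w u₀ hw hu₀ hq
  have hw' : ∀ z : Z, Continuous fun t : I => w (z, t) := fun z =>
    hw.continuous_comp (p := fun t : I => (z, t)) (by fun_prop)
  have h0 : ∀ z, w (z, 0) = (u₀ (z, 0)).1.2 0 := fun z => (hq _ rfl).symm
  have hfam : ∀ (K : Type u) [TopologicalSpace K] [CompactSpace K] [T2Space K] (f : K → Z),
      Continuous f → Continuous fun k => (⟨fun t => w (f k, t), hw' _⟩ : C(I, N)) := by
    intro K _ _ _ f hf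
    refine (ContinuousMap.curry ⟨fun z : K × I => w (f z.1, z.2), ?_⟩).continuous
    have := hw (K × ULift.{u} I) (fun z => (f z.1, z.2.down)) (by fun_prop)
    exact this.comp (g := fun z : K × ULift.{u} I => w (f z.1, z.2.down))
      (f := fun z : K × I => (z.1, ULift.up z.2)) (by fun_prop)
  have hfam0 : ∀ (K : Type u) [TopologicalSpace K] [CompactSpace K] [T2Space K] (f : K → Z),
      Continuous f → Continuous fun k => u₀ (f k, 0) := fun K _ _ _ f hf =>
    hu₀ K (fun k => (f k, 0)) (by fun_prop) fun _ => rfl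
  refine ⟨fun z => ⟨((u₀ (z.1, 0)).1.1, ⟨fun x => prependPath ⟨fun t => w (z.1, t), hw' _⟩
    (u₀ (z.1, 0)).1.2 z.2 x, continuous_prependPath continuous_const continuous_const
      continuous_const continuous_id fun _ => h0 _⟩), ?_⟩, ?_, ?_, ?_⟩
  · change prependPath _ _ z.2 1 = _
    rw [← (u₀ (z.1, 0)).2, prependPath, if_neg (by simp)]
    simp
  · intro K _ _ _ f hf
    refine Continuous.subtype_mk (Continuous.prodMk ?_ ?_) _
    · exact continuous_fst.comp (continuous_subtype_val.comp
        (hfam0 K (fun k => (f k).1) (by fun_prop)))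
    · refine (ContinuousMap.curry ⟨fun z : K × I => prependPath
        ⟨fun t => w ((f z.1).1, t), hw' _⟩ (u₀ ((f z.1).1, 0)).1.2 (f z.1).2 z.2, ?_⟩).continuous
      exact continuous_prependPath ((hfam K (fun k => (f k).1) (by fun_prop)).comp continuous_fst)
        (continuous_snd.comp (continuous_subtype_val.comp
          ((hfam0 K (fun k => (f k).1) (by fun_prop)).comp continuous_fst))) (by fun_prop)
            continuous_snd fun _ => h0 _
  · rintro ⟨z, t⟩
    change prependPath _ _ t 0 = _
    rw [prependPath, if_pos (by simp [t.2.1])]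
    simp
  · rintro ⟨z, t⟩ (rfl : t = 0)
    refine Subtype.ext (Prod.ext rfl (ContinuousMap.ext fun x => ?_))
    change prependPath _ _ 0 x = _
    rw [prependPath]
    split_ifs with h
    · have hx : x = 0 := Subtype.ext (le_antisymm (by simpa using h) x.2.1)
      subst hx
      simp [h0]
    · simp

end PathFibration

/-! ### Homotopies of lifting problems -/

section Transport

variable {E N : Type u} [TopologicalSpace E] [TopologicalSpace N] {q : E → N}

/-- The lifting problem for the map `w` on a cube, with the lift `u₀` on the boundary, is
solvable. -/
def CubeLift (q : E → N) {m : ℕ} (w : (Fin m → I) → N) (u₀ : (Fin m → I) → E) : Prop :=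
  ∃ u : (Fin m → I) → E, Continuous u ∧ (∀ y, q (u y) = w y) ∧
    ∀ y ∈ Cube.boundary (Fin m), u y = u₀ y

/-- If two lifting problems on a cube are homotopic and one of them is solvable, then so is the
other one. -/
theorem IsKFibration.cubeLift_of_homotopy (hq : IsKFibration q) {m : ℕ} {w : (Fin m → I) × I → N}
    (hw : Continuous w) {u₀ : (Fin m → I) × I → E}
    (hu₀ : KContOn u₀ {z | z.1 ∈ Cube.boundary (Fin m)})
    (hqu : ∀ z : (Fin m → I) × I, z.1 ∈ Cube.boundary (Fin m) → q (u₀ z) = w z)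
    (h : CubeLift q (fun y => w (y, 1)) (fun y => u₀ (y, 1))) :
    CubeLift q (fun y => w (y, 0)) (fun y => u₀ (y, 0)) := by
  classical
  obtain ⟨u₁, hu₁, h1, h2⟩ := h
  obtain ⟨u, hu, h3, h4⟩ := hq.lifts_ndr' (isNDR_boundary m)
    (fun z => w (z.1, unitInterval.symm z.2))
    (fun z => if z.2 = 0 then u₁ z.1 else u₀ (z.1, unitInterval.symm z.2))
    (hw.comp (by fun_prop)).kCont
    (KContOn.union (isClosed_eq continuous_snd continuous_const)
      ((isClosed_boundary m).preimage continuous_fst)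
      (((hu₁.comp continuous_fst).kCont.kContOn _).congr fun z hz => if_pos hz)
      ((hu₀.comp_continuous (g := fun z : (Fin m → I) × I => (z.1, unitInterval.symm z.2))
        (by fun_prop) fun z hz => hz).congr fun z hz => by
          split_ifs with h
          · rw [h2 _ hz, h, unitInterval.symm_zero]
          · rfl))
    (by
      rintro ⟨x, t⟩ hz
      dsimp only
      split_ifs with h
      · rw [h1, h, unitInterval.symm_zero]
      · exact hqu _ (hz.resolve_left h))
  refine ⟨fun y => u (y, 1), hu.continuous.comp (by fun_prop), fun y => ?_, fun y hy => ?_⟩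
  · rw [h3]
    simp
  · change u (y, 1) = u₀ (y, 0)
    rw [h4 (y, 1) (Or.inr hy), if_neg (by simp)]
    simp

/-- A homotopy of the lift on the boundary extends to a homotopy of lifting problems. The values of
the new map are among the values of the given data. -/
theorem IsKFibration.cubeLift_of_boundary_homotopy (hq : IsKFibration q) (hqc : KCont q) {m : ℕ}
    {w : (Fin m → I) → N} (hw : Continuous w) {u₀ : (Fin m → I) × I → E}
    (hu₀ : KContOn u₀ {z | z.1 ∈ Cube.boundary (Fin m)})
    (hqu : ∀ y ∈ Cube.boundary (Fin m), q (u₀ (y, 0)) = w y)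
    (h : ∀ w₁ : (Fin m → I) → N, Continuous w₁ →
      (∀ y ∈ Cube.boundary (Fin m), q (u₀ (y, 1)) = w₁ y) →
      (∀ y, (∃ y', w₁ y = w y') ∨ ∃ z : (Fin m → I) × I, z.1 ∈ Cube.boundary (Fin m) ∧
        w₁ y = q (u₀ z)) → CubeLift q w₁ (fun y => u₀ (y, 1))) :
    CubeLift q w (fun y => u₀ (y, 0)) := by
  classical
  let f : (Fin m → I) × I → N := fun z => if z.2 = 0 then w z.1 else q (u₀ z)
  have hf0 : ∀ z : (Fin m → I) × I, z.2 = 0 → f z = w z.1 := fun z hz => if_pos hz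
  have hf1 : ∀ z : (Fin m → I) × I, z.1 ∈ Cube.boundary (Fin m) → f z = q (u₀ z) := by
    rintro ⟨y, t⟩ hz
    by_cases ht : t = 0
    · subst ht
      rw [hf0 _ rfl, hqu _ hz]
    · exact if_neg ht
  obtain ⟨F, hF, hF1, hF2⟩ := (isNDR_boundary m).exists_extension f
    (KContOn.union (isClosed_eq continuous_snd continuous_const)
      ((isClosed_boundary m).preimage continuous_fst)
      (((hw.comp continuous_fst).kCont.kContOn _).congr hf0)
      ((hqc.comp_kContOn hu₀).congr hf1))
  have e : w = fun y => F (y, 0) := funext fun y => by rw [hF1 _ (Or.inl rfl), hf0 _ rfl]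
  rw [e]
  refine hq.cubeLift_of_homotopy hF.continuous hu₀ (fun z hz => ?_) (h _ ?_ (fun y hy => ?_)
    fun y => ?_)
  · rw [hF1 _ (Or.inr hz), hf1 _ hz]
  · exact hF.continuous.comp (by fun_prop)
  · rw [hF1 _ (Or.inr hy), hf1 _ hy]
  · obtain ⟨b, hb, e⟩ := hF2 (y, 1)
    rcases hb with hb | hb
    · exact Or.inl ⟨b.1, e.trans (hf0 _ hb)⟩
    · exact Or.inr ⟨b, hb, e.trans (hf1 _ hb)⟩

variable {M : Type u} [TopologicalSpace M] {p : M → N}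

/-- The point of the path fibration given by a constant path. -/
def PathSpace.const (p : M → N) (x : M) : PathSpace p := ⟨(x, ContinuousMap.const I (p x)), rfl⟩

theorem PathSpace.continuous_const (hp : Continuous p) : Continuous (PathSpace.const p) :=
  Continuous.subtype_mk (continuous_id.prodMk
    (ContinuousMap.continuous_const'.comp hp)) _

/-- The path of a point of the path fibration, restricted to `[s, 1]`. -/
def PathSpace.shrink (e : PathSpace p) (s : I) : PathSpace p :=
  ⟨(e.1.1, e.1.2.comp ⟨fun r => r ⊔ s, by fun_prop⟩), by
    rw [← e.2]
    simp [unitInterval.le_one']⟩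

theorem PathSpace.continuous_shrink : Continuous fun z : PathSpace p × I => z.1.shrink z.2 := by
  refine Continuous.subtype_mk (Continuous.prodMk ?_ ?_) _
  · exact continuous_fst.comp (continuous_subtype_val.comp continuous_fst)
  · refine ContinuousMap.continuous_of_continuous_uncurry _ ?_
    have h : Continuous fun z : (PathSpace p × I) × I => z.1.1.1.2 :=
      continuous_snd.comp (continuous_subtype_val.comp (continuous_fst.comp continuous_fst))
    exact h.eval (show Continuous fun z : (PathSpace p × I) × I => z.2 ⊔ z.1.2 by fun_prop)

theorem PathSpace.shrink_zero {M : Type u} {p : M → N} (e : PathSpace p) : e.shrink 0 = e := by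
  refine Subtype.ext (Prod.ext rfl (ContinuousMap.ext fun r => ?_))
  change e.1.2 (r ⊔ 0) = e.1.2 r
  rw [sup_eq_left.2 unitInterval.nonneg']

theorem PathSpace.shrink_one {M : Type u} {p : M → N} (e : PathSpace p) :
    e.shrink 1 = PathSpace.const p e.1.1 := by
  refine Subtype.ext (Prod.ext rfl (ContinuousMap.ext fun r => ?_))
  change e.1.2 (r ⊔ 1) = p e.1.1
  rw [sup_eq_right.2 unitInterval.le_one', e.2]

/-- For the lifting property of a path fibration, constant paths over the boundary suffice. -/
theorem lifts_pathFib_of_const {m : ℕ} (h : ∀ (w : (Fin m → I) → N) (k : (Fin m → I) → M),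
    Continuous w → KContOn k (Cube.boundary (Fin m)) →
    (∀ y ∈ Cube.boundary (Fin m), w y = p (k y)) →
    CubeLift (pathFib p) w (fun y => PathSpace.const p (k y))) :
    Lifts (pathFib p) (Cube.boundary (Fin m)) := by
  intro w u₀ hw hu₀ hqu
  have := (isKFibration_pathFib p).cubeLift_of_boundary_homotopy (continuous_pathFib p).kCont
    hw.continuous (u₀ := fun z : (Fin m → I) × I => (u₀ z.1).shrink z.2)
    (fun K _ _ _ f hf hA => PathSpace.continuous_shrink.comp
      ((hu₀ K (fun z => (f z).1) (by fun_prop) hA).prodMk (continuous_snd.comp hf)))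
    (fun y hy => by rw [PathSpace.shrink_zero, hqu y hy])
    (fun w₁ hw₁ hw₂ _ => by
      simp only [PathSpace.shrink_one] at hw₂ ⊢
      exact h w₁ (fun y => (u₀ y).1.1) hw₁ (fun K _ _ _ f hf hA =>
        continuous_fst.comp (continuous_subtype_val.comp (hu₀ K f hf hA)))
          fun y hy => (hw₂ y hy).symm)
  simp only [PathSpace.shrink_zero] at this
  obtain ⟨u, hu, h1, h2⟩ := this
  exact ⟨u, hu.kCont, h1, h2⟩

theorem cubeLift_pathFib {m : ℕ} {w : (Fin m → I) → N} {k : (Fin m → I) → M} (g : (Fin m → I) → M)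
    (hg : Continuous g) (F : (Fin m → I) × I → N) (hF : Continuous F) (h0 : ∀ y, F (y, 0) = w y)
    (h1 : ∀ y, F (y, 1) = p (g y)) (hgk : ∀ y ∈ Cube.boundary (Fin m), g y = k y)
    (hFk : ∀ y ∈ Cube.boundary (Fin m), ∀ t, F (y, t) = p (k y)) :
    CubeLift (pathFib p) w (fun y => PathSpace.const p (k y)) := by
  refine ⟨fun y => ⟨(g y, ⟨fun t => F (y, t), by fun_prop⟩), h1 y⟩, ?_, h0, fun y hy => ?_⟩
  · exact Continuous.subtype_mk (hg.prodMk (ContinuousMap.curry ⟨F, hF⟩).continuous) _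
  · exact Subtype.ext (Prod.ext (hgk y hy) (ContinuousMap.ext fun t => hFk y hy t))

/-- Lifting problems with constant paths over the boundary can be moved along homotopies. -/
theorem cubeLift_pathFib_of_homotopy (hp : Continuous p) {m : ℕ} {w : (Fin m → I) → N}
    (hw : Continuous w) {k : (Fin m → I) × I → M}
    (hk : KContOn k {z | z.1 ∈ Cube.boundary (Fin m)})
    (hwk : ∀ y ∈ Cube.boundary (Fin m), w y = p (k (y, 0)))
    (h : ∀ w₁ : (Fin m → I) → N, Continuous w₁ →
      (∀ y ∈ Cube.boundary (Fin m), w₁ y = p (k (y, 1))) →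
      (∀ y, (∃ y', w₁ y = w y') ∨ ∃ z : (Fin m → I) × I, z.1 ∈ Cube.boundary (Fin m) ∧
        w₁ y = p (k z)) → CubeLift (pathFib p) w₁ (fun y => PathSpace.const p (k (y, 1)))) :
    CubeLift (pathFib p) w (fun y => PathSpace.const p (k (y, 0))) :=
  (isKFibration_pathFib p).cubeLift_of_boundary_homotopy (continuous_pathFib p).kCont hw
    (u₀ := fun z => PathSpace.const p (k z))
    (fun K _ _ _ f hf hA => (PathSpace.continuous_const hp).comp (hk K f hf hA))
    (fun y hy => (hwk y hy).symm) fun w₁ h1 h2 h3 => h w₁ h1 (fun y hy => (h2 y hy).symm) h3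

end Transport

/-! ### Path fibrations of weak equivalences -/

section WeakEquivalenceLifting

variable {M N : Type u} [TopologicalSpace M] [TopologicalSpace N] {p : M → N}

theorem genLoop_homotopic_iff {X : Type*} [TopologicalSpace X] {k : ℕ} {x : X}
    (f g : GenLoop (Fin k) X x) : GenLoop.Homotopic f g ↔
      ∃ F : (Fin k → I) × I → X, Continuous F ∧ (∀ y, F (y, 0) = f.1 y) ∧ (∀ y, F (y, 1) = g.1 y) ∧
        ∀ y ∈ Cube.boundary (Fin k), ∀ t, F (y, t) = x := by
  constructor
  · rintro ⟨F⟩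
    refine ⟨fun z => F (z.2, z.1), by fun_prop, fun y => F.map_zero_left y,
      fun y => F.map_one_left y, fun y hy t => ?_⟩
    exact (F.eq_fst t hy).trans (f.2 y hy)
  · rintro ⟨F, hF, h0, h1, h2⟩
    exact ⟨⟨⟨⟨fun z => F (z.2, z.1), by fun_prop⟩, h0, h1⟩,
      fun t y hy => (h2 y hy t).trans (f.2 y hy).symm⟩⟩

theorem pi0Map_mk {X Y : Type*} [TopologicalSpace X] [TopologicalSpace Y] (φ : C(X, Y)) (x : X) :
    pi0Map φ (ZerothHomotopy.mk x) = ZerothHomotopy.mk (φ x) := rfl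

theorem zerothHomotopy_mk_eq_iff {X : Type*} [TopologicalSpace X] {x y : X} :
    ZerothHomotopy.mk x = ZerothHomotopy.mk y ↔ Joined x y :=
  Quotient.eq (r := pathSetoid X)

/-- Injectivity on path components and homotopy groups: a spheroid that becomes null homotopic is
null homotopic. -/
theorem IsWeakHomotopyEquiv.exists_homotopy_const (hp : IsWeakHomotopyEquiv p) {k : ℕ}
    {h : (Fin k → I) → M} (hh : Continuous h) {v : M} (hv : ∀ y ∈ Cube.boundary (Fin k), h y = v)
    {W : (Fin k → I) × I → N} (hW : Continuous W) (h0 : ∀ y, W (y, 0) = p (h y))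
    (h1 : ∀ y, W (y, 1) = p v) (hb : ∀ y ∈ Cube.boundary (Fin k), ∀ t, W (y, t) = p v) :
    ∃ F : (Fin k → I) × I → M, Continuous F ∧ (∀ y, F (y, 0) = h y) ∧ (∀ y, F (y, 1) = v) ∧
      ∀ y ∈ Cube.boundary (Fin k), ∀ t, F (y, t) = v := by
  obtain ⟨hc, hp0, hpk⟩ := hp
  cases k with
  | zero =>
    have hj : Joined (p (h 0)) (p v) :=
      ⟨⟨⟨fun t => W (0, t), by fun_prop⟩, h0 0, h1 0⟩⟩
    have : ZerothHomotopy.mk (h 0) = ZerothHomotopy.mk v := by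
      apply hp0.1
      rw [pi0Map_mk, pi0Map_mk]
      exact zerothHomotopy_mk_eq_iff.2 hj
    obtain ⟨γ⟩ := zerothHomotopy_mk_eq_iff.1 this
    refine ⟨fun z => γ z.2, by fun_prop, fun y => ?_, fun y => γ.target, ?_⟩
    · rw [Subsingleton.elim y 0]
      exact γ.source
    · rintro y ⟨i, -⟩
      exact i.elim0
  | succ k =>
    let a : GenLoop (Fin (k + 1)) M v := ⟨⟨h, hh⟩, hv⟩
    let b : GenLoop (Fin (k + 1)) M v := ⟨.const _ v, fun _ _ => rfl⟩
    have : (Quotient.mk _ a : HomotopyGroup.Pi (k + 1) M v) = Quotient.mk _ b := by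
      apply (hpk k v).1
      exact Quotient.sound ((genLoop_homotopic_iff _ _).2 ⟨W, hW, h0, h1, hb⟩)
    exact (genLoop_homotopic_iff _ _).1 (Quotient.exact this)

theorem CubeLift.congr {E N : Type u} [TopologicalSpace E] {q : E → N} {m : ℕ}
    {w : (Fin m → I) → N} {u₀ u₁ : (Fin m → I) → E} (h : CubeLift q w u₀)
    (e : ∀ y ∈ Cube.boundary (Fin m), u₁ y = u₀ y) :
    CubeLift q w u₁ := by
  obtain ⟨u, hu, h1, h2⟩ := h
  exact ⟨u, hu, h1, fun y hy => (h2 y hy).trans (e y hy).symm⟩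

/-- Surjectivity on homotopy groups, as a lifting property. -/
theorem IsWeakHomotopyEquiv.cubeLift_const (hp : IsWeakHomotopyEquiv p) {k : ℕ}
    {w : (Fin (k + 1) → I) → N} (hw : Continuous w) {v : M}
    (hv : ∀ y ∈ Cube.boundary (Fin (k + 1)), w y = p v) :
    CubeLift (pathFib p) w (fun _ => PathSpace.const p v) := by
  obtain ⟨hc, hp0, hpk⟩ := hp
  obtain ⟨a, ha⟩ := (hpk k v).2 (Quotient.mk _ ⟨⟨w, hw⟩, hv⟩)
  induction a using Quotient.inductionOn with
  | h a =>
    obtain ⟨F, hF, h0, h1, hb⟩ := (genLoop_homotopic_iff _ _).1 (Quotient.exact ha).symm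
    exact cubeLift_pathFib a.1 a.1.continuous F hF h0 h1 a.2 hb

/-- A weak equivalence, replaced by a fibration, has the right lifting property for the inclusions
of the boundaries of cubes. The map on the boundary is deformed until it is constant: first on all
faces but one, which together are contractible, and then on the remaining face, where it is a
spheroid that becomes null homotopic. What remains is surjectivity on homotopy groups. -/
theorem IsWeakHomotopyEquiv.lifts_pathFib (hp : IsWeakHomotopyEquiv p) (m : ℕ) :
    Lifts (pathFib p) (Cube.boundary (Fin m)) := by
  classical
  have hpc : Continuous p := hp.1
  cases m with
  | zero =>
    refine lifts_pathFib_of_const fun w k hw _ _ => ?_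
    obtain ⟨x, hx⟩ := hp.2.1.2 (ZerothHomotopy.mk (w 0))
    induction x using Quotient.inductionOn with
    | h x =>
      obtain ⟨γ⟩ := zerothHomotopy_mk_eq_iff.1 hx.symm
      have hb : ∀ y : Fin 0 → I, y ∉ Cube.boundary (Fin 0) := by
        rintro y ⟨i, -⟩
        exact i.elim0
      refine cubeLift_pathFib (fun _ => x) continuous_const (fun z => γ z.2) (by fun_prop)
        (fun y => ?_) (fun y => γ.target) (fun y hy => (hb y hy).elim) fun y hy => (hb y hy).elim
      rw [Subsingleton.elim y 0]
      exact γ.source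
  | succ m =>
    refine lifts_pathFib_of_const fun w k hw hk hwk => ?_
    obtain ⟨φ, D, -, hD, hD0, hD1, hD2⟩ := (isNDR_boundary m).exists_deformation
    -- the retraction of the cube onto the union of all faces but one
    let r : (Fin (m + 1) → I) → (Fin (m + 1) → I) := fun y =>
      Fin.cons (D ((fun j => y j.succ, y 0), 0)).2 (D ((fun j => y j.succ, y 0), 0)).1
    have hr : Continuous r := by
      refine (consHomeomorph I m).symm.continuous.comp (g := fun z : I × (Fin m → I) =>
        (Fin.cons z.1 z.2 : Fin (m + 1) → I)) (f := fun y : Fin (m + 1) → I =>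
        ((D ((fun j => y j.succ, y 0), 0)).2, (D ((fun j => y j.succ, y 0), 0)).1)) ?_
      fun_prop
    have htail : Continuous fun y : Fin (m + 1) → I => fun j : Fin m => y j.succ := by fun_prop
    let J : Set (Fin (m + 1) → I) := {y | y 0 = 0 ∨ (fun j => y j.succ) ∈ Cube.boundary (Fin m)}
    let T : Set (Fin (m + 1) → I) := {y | y 0 = 1}
    have hJ : IsClosed J := (isClosed_eq (continuous_apply 0) continuous_const).union
      ((isClosed_boundary m).preimage htail)
    have hT : IsClosed T := isClosed_eq (continuous_apply 0) continuous_const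
    have hJT : ∀ y, y ∈ Cube.boundary (Fin (m + 1)) ↔ y ∈ J ∨ y ∈ T := fun y => by
      simp only [mem_boundary_succ, mem_insert_iff, mem_singleton_iff, J, T, mem_ofPred_eq]
      tauto
    have hrJ : ∀ y, r y ∈ J := fun y => hD0 (fun j => y j.succ, y 0)
    have hrid : ∀ y ∈ J, r y = y := by
      intro y hy
      have := hD1 (fun j => y j.succ, y 0)
      rw [hD2 (fun j => y j.succ, y 0) hy] at this
      simp only [r, this]
      exact Fin.cons_self_tail y
    have hkr : Continuous fun y => k (r y) :=
      (kContOn_univ.1 (hk.comp_continuous hr fun y _ => (hJT _).2 (Or.inl (hrJ y)))).continuous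
    have hcons : Continuous fun z : I × (Fin m → I) => (Fin.cons z.1 z.2 : Fin (m + 1) → I) :=
      (consHomeomorph I m).symm.continuous
    -- the contraction of the union of these faces
    let c : (Fin (m + 1) → I) × I → M := fun z => k (r fun j => unitInterval.symm z.2 * z.1 j)
    have hc : Continuous c := hkr.comp
      (f := fun z : (Fin (m + 1) → I) × I => fun j => unitInterval.symm z.2 * z.1 j) (by fun_prop)
    have hc0 : ∀ y ∈ J, c (y, 0) = k y := fun y hy => by simp [c, hrid y hy]
    have hc1 : ∀ y, c (y, 1) = c (0, 1) := fun y => by simp [c]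
    have hJtop : ∀ z ∈ Cube.boundary (Fin m), ∀ t, (Fin.cons t z : Fin (m + 1) → I) ∈ J :=
      fun z hz t => Or.inr hz
    obtain ⟨F₁, hF₁, hF₁b, -⟩ := (isNDR_boundary m).exists_extension
      (fun z => if z.2 = 0 then k (Fin.cons 1 z.1) else c (Fin.cons 1 z.1, z.2))
      (KContOn.union (isClosed_eq continuous_snd continuous_const)
        ((isClosed_boundary m).preimage continuous_fst)
        ((hk.comp_continuous (g := fun z : (Fin m → I) × I => (Fin.cons 1 z.1 : Fin (m + 1) → I))
          (hcons.comp (continuous_const.prodMk continuous_fst))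
          fun z _ => (hJT _).2 (Or.inr rfl)).congr fun z hz => if_pos hz)
        (((hc.comp ((hcons.comp (continuous_const.prodMk continuous_fst)).prodMk
          continuous_snd)).kCont.kContOn _).congr (f := fun z : (Fin m → I) × I =>
            c (Fin.cons 1 z.1, z.2)) (by
              rintro ⟨z, t⟩ hz
              dsimp only
              split_ifs with h
              · rw [h, hc0 _ (hJtop z hz _)]
              · rfl)))
    have hF₁0 : ∀ z, F₁ (z, 0) = k (Fin.cons 1 z) := fun z => by simp [hF₁b (z, 0)]
    have hF₁b' : ∀ z ∈ Cube.boundary (Fin m), ∀ t, F₁ (z, t) = c (Fin.cons 1 z, t) := by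
      intro z hz t
      rw [hF₁b _ (Or.inr hz)]
      dsimp only
      split_ifs with h
      · rw [h, hc0 _ (hJtop z hz _)]
      · rfl
    have hself : ∀ y ∈ T, (Fin.cons 1 (fun j => y j.succ) : Fin (m + 1) → I) = y := by
      intro y (hy : y 0 = 1)
      rw [← hy]
      exact Fin.cons_self_tail y
    -- a homotopy on the boundary, from one on `J` and one on `T`
    have glue : ∀ (a : (Fin (m + 1) → I) × I → M) (b : (Fin m → I) × I → M), Continuous a →
        Continuous b → (∀ z ∈ Cube.boundary (Fin m), ∀ t, b (z, t) = a (Fin.cons 1 z, t)) →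
        ∃ k₁ : (Fin (m + 1) → I) × I → M, KContOn k₁ {z | z.1 ∈ Cube.boundary (Fin (m + 1))} ∧
          (∀ y ∈ J, ∀ t, k₁ (y, t) = a (y, t)) ∧
          ∀ y ∈ T, ∀ t, k₁ (y, t) = b (fun j => y j.succ, t) := by
      intro a b ha hb hab
      let k₁ : (Fin (m + 1) → I) × I → M := fun z =>
        if z.1 0 = 1 then b (fun j => z.1 j.succ, z.2) else a z
      have h1 : ∀ y ∈ T, ∀ t, k₁ (y, t) = b (fun j => y j.succ, t) := fun y hy t => if_pos hy
      have h2 : ∀ y ∈ J, ∀ t, k₁ (y, t) = a (y, t) := by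
        intro y hy t
        by_cases h : y ∈ T
        · rw [h1 y h]
          rcases hy with hy | hy
          · exact absurd (hy.symm.trans h) zero_ne_one
          · rw [hab _ hy, hself y h]
        · exact if_neg h
      refine ⟨k₁, ?_, h2, h1⟩
      refine (KContOn.union (hJ.preimage continuous_fst) (hT.preimage continuous_fst)
        ((ha.kCont.kContOn _).congr fun z hz => h2 z.1 hz z.2)
        ((((hb.comp ((htail.comp continuous_fst).prodMk continuous_snd)).kCont.kContOn _)).congr
          fun z hz => h1 z.1 hz z.2)).mono fun z hz => (hJT _).1 hz
    obtain ⟨k₁, hk₁, hk₁J, hk₁T⟩ := glue c F₁ hc hF₁.continuous hF₁b'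
    have hk₁0 : ∀ y ∈ Cube.boundary (Fin (m + 1)), k₁ (y, 0) = k y := by
      intro y hy
      rcases (hJT y).1 hy with hy | hy
      · rw [hk₁J y hy, hc0 y hy]
      · rw [hk₁T y hy, hF₁0, hself y hy]
    refine CubeLift.congr (cubeLift_pathFib_of_homotopy hpc hw hk₁
      (fun y hy => (hwk y hy).trans (congrArg p (hk₁0 y hy).symm)) fun w₁ hw₁ hwk₁ _ => ?_)
      fun y hy => by rw [hk₁0 y hy]
    -- the spheroid on the remaining face, which is null homotopic
    obtain ⟨F₂, hF₂, hF₂0, hF₂1, hF₂b⟩ := hp.exists_homotopy_const (h := fun z => F₁ (z, 1))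
      (v := c (0, 1)) (hF₁.continuous.comp (by fun_prop))
      (fun z hz => by rw [hF₁b' z hz, hc1])
      (W := fun z => w₁ (Fin.cons (unitInterval.symm z.2) z.1))
      (hw₁.comp (hcons.comp (show Continuous fun z : (Fin m → I) × I =>
        (unitInterval.symm z.2, z.1) by fun_prop)))
      (fun z => by
        rw [unitInterval.symm_zero, hwk₁ _ ((hJT _).2 (Or.inr rfl)), hk₁T _ rfl]
        rfl)
      (fun z => by
        have hz : (Fin.cons 0 z : Fin (m + 1) → I) ∈ J := Or.inl rfl
        rw [unitInterval.symm_one, hwk₁ _ ((hJT _).2 (Or.inl hz)), hk₁J _ hz, hc1])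
      (fun z hz t => by
        rw [hwk₁ _ ((hJT _).2 (Or.inl (hJtop z hz _))), hk₁J _ (hJtop z hz _), hc1])
    obtain ⟨k₂, hk₂, hk₂J, hk₂T⟩ := glue (fun _ => c (0, 1)) F₂ continuous_const hF₂ hF₂b
    have hk₂0 : ∀ y ∈ Cube.boundary (Fin (m + 1)), k₂ (y, 0) = k₁ (y, 1) := by
      intro y hy
      rcases (hJT y).1 hy with hy | hy
      · rw [hk₂J y hy, hk₁J y hy, hc1 y]
      · rw [hk₂T y hy, hk₁T y hy, hF₂0]
    have hk₂1 : ∀ y ∈ Cube.boundary (Fin (m + 1)), k₂ (y, 1) = c (0, 1) := by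
      intro y hy
      rcases (hJT y).1 hy with hy | hy
      · rw [hk₂J y hy]
      · rw [hk₂T y hy, hF₂1]
    refine CubeLift.congr (cubeLift_pathFib_of_homotopy hpc hw₁ hk₂
      (fun y hy => (hwk₁ y hy).trans (congrArg p (hk₂0 y hy).symm)) fun w₂ hw₂ hwk₂ _ => ?_)
      fun y hy => by rw [hk₂0 y hy]
    exact (hp.cubeLift_const hw₂ fun y hy => by rw [hwk₂ y hy, hk₂1 y hy]).congr
      fun y hy => by rw [hk₂1 y hy]

theorem IsWeakHomotopyEquiv.isTrivialKFibration (hp : IsWeakHomotopyEquiv p) (x : M) :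
    IsTrivialKFibration (pathFib p) where
  kCont := (continuous_pathFib p).kCont
  nonempty := ⟨PathSpace.const p x⟩
  fibration := isKFibration_pathFib p
  lifts_cube := hp.lifts_pathFib

end WeakEquivalenceLifting

/-! ### Weak equivalences from lifting properties -/

section WeakEquivalenceCriterion

variable {M N : Type u} [TopologicalSpace M] [TopologicalSpace N] {p : M → N}

theorem CubeLift.exists_homotopy {m : ℕ} {w : (Fin m → I) → N} {u₀ : (Fin m → I) → PathSpace p}
    (h : CubeLift (pathFib p) w u₀) : ∃ (g : (Fin m → I) → M) (F : (Fin m → I) × I → N),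
      Continuous g ∧ Continuous F ∧ (∀ y, F (y, 0) = w y) ∧ (∀ y, F (y, 1) = p (g y)) ∧
      ∀ y ∈ Cube.boundary (Fin m), g y = (u₀ y).1.1 ∧ ∀ t, F (y, t) = (u₀ y).1.2 t := by
  obtain ⟨u, hu, h1, h2⟩ := h
  have hu' : Continuous fun y => (u y).1 := continuous_subtype_val.comp hu
  refine ⟨fun y => (u y).1.1, fun z => (u z.1).1.2 z.2, continuous_fst.comp hu', ?_, h1,
    fun y => (u y).2, fun y hy => ?_⟩
  · exact (continuous_snd.comp (hu'.comp continuous_fst)).eval continuous_snd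
  · have e := h2 y hy
    exact ⟨congrArg (fun z : PathSpace p => z.1.1) e,
      fun t => congrArg (fun z : PathSpace p => z.1.2 t) e⟩

/-- Two spheroids with homotopic images are homotopic: the spheroids and the constant map are a lift
over the boundary of a cube of one more dimension, and the homotopy of the images is a map of this
cube to the base. -/
theorem exists_homotopy_of_lifts (hpc : Continuous p) {m : ℕ}
    (hp : Lifts (pathFib p) (Cube.boundary (Fin (m + 1)))) {f g : (Fin m → I) → M}
    (hf : Continuous f) (hg : Continuous g) {v : M} (hfv : ∀ y ∈ Cube.boundary (Fin m), f y = v)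
    (hgv : ∀ y ∈ Cube.boundary (Fin m), g y = v)
    {W : (Fin m → I) × I → N} (hW : Continuous W) (h0 : ∀ y, W (y, 0) = p (f y))
    (h1 : ∀ y, W (y, 1) = p (g y)) (hb : ∀ y ∈ Cube.boundary (Fin m), ∀ t, W (y, t) = p v) :
    ∃ F : (Fin m → I) × I → M, Continuous F ∧ (∀ y, F (y, 0) = f y) ∧ (∀ y, F (y, 1) = g y) ∧
      ∀ y ∈ Cube.boundary (Fin m), ∀ t, F (y, t) = v := by
  classical
  have htail : Continuous fun y : Fin (m + 1) → I => fun j : Fin m => y j.succ := by fun_prop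
  let k : (Fin (m + 1) → I) → M := fun y =>
    if y 0 = 0 then f fun j => y j.succ else if y 0 = 1 then g fun j => y j.succ else v
  have k0 : ∀ y : Fin (m + 1) → I, y 0 = 0 → k y = f fun j => y j.succ := fun y hy => if_pos hy
  have k1 : ∀ y : Fin (m + 1) → I, y 0 = 1 → k y = g fun j => y j.succ := fun y hy => by
    simp [k, hy]
  have kb : ∀ y : Fin (m + 1) → I, (fun j => y j.succ) ∈ Cube.boundary (Fin m) → k y = v := by
    intro y hy
    simp only [k, hfv _ hy, hgv _ hy, ite_self]
  have hk : KContOn k (Cube.boundary (Fin (m + 1))) := by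
    have e : Cube.boundary (Fin (m + 1)) = ({y | y 0 = 0} ∪ {y | y 0 = 1}) ∪
        {y | (fun j => y j.succ) ∈ Cube.boundary (Fin m)} := by
      ext y
      simp [mem_boundary_succ]
    have c0 : IsClosed {y : Fin (m + 1) → I | y 0 = 0} :=
      isClosed_eq (continuous_apply 0) continuous_const
    have c1 : IsClosed {y : Fin (m + 1) → I | y 0 = 1} :=
      isClosed_eq (continuous_apply 0) continuous_const
    rw [e]
    refine KContOn.union (c0.union c1) ((isClosed_boundary m).preimage htail)
      (KContOn.union c0 c1 ?_ ?_) ?_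
    · exact ((hf.comp htail).kCont.kContOn _).congr k0
    · exact ((hg.comp htail).kCont.kContOn _).congr k1
    · exact ((continuous_const (y := v)).kCont.kContOn _).congr kb
  have hcons : Continuous fun z : I × (Fin m → I) => (Fin.cons z.1 z.2 : Fin (m + 1) → I) :=
    (consHomeomorph I m).symm.continuous
  obtain ⟨u, hu, hu1, hu2⟩ := hp (fun y => W (fun j => y j.succ, y 0))
    (fun y => PathSpace.const p (k y)) (hW.comp (htail.prodMk (continuous_apply 0))).kCont
    ((PathSpace.continuous_const hpc).kCont.comp_kContOn hk) (by
      intro y hy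
      change p (k y) = _
      rcases mem_boundary_succ.1 hy with (hy | hy) | hy
      · rw [k0 y hy, hy, h0]
      · rw [k1 y hy, hy, h1]
      · rw [kb y hy, hb _ hy])
  have hF : Continuous fun y => (u y).1.1 :=
    continuous_fst.comp (continuous_subtype_val.comp hu.continuous)
  refine ⟨fun z => (u (Fin.cons z.2 z.1)).1.1,
    hF.comp (hcons.comp (continuous_snd.prodMk continuous_fst)), fun y => ?_, fun y => ?_,
    fun y hy t => ?_⟩
  · dsimp only
    rw [hu2 _ (mem_boundary_succ.2 (Or.inl (Or.inl rfl)))]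
    exact k0 _ rfl
  · dsimp only
    rw [hu2 _ (mem_boundary_succ.2 (Or.inl (Or.inr rfl)))]
    exact k1 _ rfl
  · dsimp only
    rw [hu2 _ (mem_boundary_succ.2 (Or.inr hy))]
    exact kb _ hy

/-- A map is a weak equivalence as soon as its replacement by a fibration has the right lifting
property for the inclusions of the boundaries of cubes. -/
theorem isWeakHomotopyEquiv_of_lifts [Nonempty M] (hpc : Continuous p)
    (hp : ∀ m, Lifts (pathFib p) (Cube.boundary (Fin m))) : IsWeakHomotopyEquiv p := by
  have hb0 : ∀ y : Fin 0 → I, y ∉ Cube.boundary (Fin 0) := by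
    rintro y ⟨i, -⟩
    exact i.elim0
  have lift : ∀ {m : ℕ} (w : (Fin m → I) → N) (v : M), Continuous w →
      (∀ y ∈ Cube.boundary (Fin m), w y = p v) →
      CubeLift (pathFib p) w (fun _ => PathSpace.const p v) := by
    intro m w v hw hv
    obtain ⟨u, hu, h1, h2⟩ := hp m w (fun _ => PathSpace.const p v) hw.kCont
      (continuous_const.kCont.kContOn _) fun y hy => (hv y hy).symm
    exact ⟨u, hu.continuous, h1, h2⟩
  refine ⟨hpc, ⟨fun a b hab => ?_, fun b => ?_⟩, fun k x => ⟨fun a b hab => ?_, fun b => ?_⟩⟩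
  · induction a using Quotient.inductionOn with
    | h a =>
    induction b using Quotient.inductionOn with
    | h b =>
      obtain ⟨γ⟩ := zerothHomotopy_mk_eq_iff.1 hab
      obtain ⟨F, hF, h0, h1, -⟩ := exists_homotopy_of_lifts hpc (hp 1) (f := fun _ => a)
        (g := fun _ => b) (v := a) continuous_const continuous_const
        (fun y hy => (hb0 y hy).elim) (fun y hy => (hb0 y hy).elim) (W := fun z => γ z.2)
        (by fun_prop) (fun _ => γ.source) (fun _ => γ.target) (fun y hy => (hb0 y hy).elim)
      exact zerothHomotopy_mk_eq_iff.2 ⟨⟨⟨fun t => F (0, t), by fun_prop⟩, h0 0, h1 0⟩⟩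
  · induction b using Quotient.inductionOn with
    | h b =>
      obtain ⟨g, F, -, hF, h0, h1, -⟩ := (lift (fun _ => b) (Classical.arbitrary M)
        continuous_const fun y hy => (hb0 y hy).elim).exists_homotopy
      exact ⟨ZerothHomotopy.mk (g 0), zerothHomotopy_mk_eq_iff.2
        (Joined.symm ⟨⟨⟨fun t => F (0, t), by fun_prop⟩, h0 0, h1 0⟩⟩)⟩
  · induction a using Quotient.inductionOn with
    | h a =>
    induction b using Quotient.inductionOn with
    | h b =>
      obtain ⟨W, hW, h0, h1, hb⟩ := (genLoop_homotopic_iff _ _).1 (Quotient.exact hab)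
      exact Quotient.sound ((genLoop_homotopic_iff _ _).2 (exists_homotopy_of_lifts hpc (hp (k + 2))
        a.1.continuous b.1.continuous a.2 b.2 hW h0 h1 hb))
  · induction b using Quotient.inductionOn with
    | h b =>
      obtain ⟨g, F, hg, hF, h0, h1, hb⟩ := (lift b.1 x b.1.continuous b.2).exists_homotopy
      refine ⟨Quotient.mk _ ⟨⟨g, hg⟩, fun y hy => (hb y hy).1⟩, ?_⟩
      exact Quotient.sound (Setoid.symm ((genLoop_homotopic_iff _ _).2
        ⟨F, hF, h0, h1, fun y hy t => (hb y hy).2 t⟩))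

/-- A map homotopic to the identity is a weak equivalence. -/
theorem isWeakHomotopyEquiv_of_homotopy_id [Nonempty M] {φ : M → M}
    (H : M × I → M) (hH : Continuous H) (h0 : ∀ x, H (x, 0) = x) (h1 : ∀ x, H (x, 1) = φ x) :
    IsWeakHomotopyEquiv φ := by
  have hφ : Continuous φ := by
    have : Continuous fun x => H (x, 1) := hH.comp (by fun_prop)
    exact this.congr h1
  refine isWeakHomotopyEquiv_of_lifts hφ fun m => lifts_pathFib_of_const fun w k hw hk hwk => ?_
  -- the path of `H` from `H (x, 1 - s)` to `φ x`
  let e : M × I → PathSpace φ := fun z => ⟨(z.1, ⟨fun r => H (z.1, unitInterval.symm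
    (z.2 * unitInterval.symm r)), by fun_prop⟩), by simp [h1]⟩
  have he : Continuous e := by
    refine Continuous.subtype_mk (continuous_fst.prodMk
      (ContinuousMap.continuous_of_continuous_uncurry _ ?_)) _
    change Continuous fun z : (M × I) × I => H (z.1.1, unitInterval.symm
      (z.1.2 * unitInterval.symm z.2))
    fun_prop
  have e0 : ∀ x, e (x, 0) = PathSpace.const φ x := fun x => by
    refine Subtype.ext (Prod.ext rfl (ContinuousMap.ext fun r => ?_))
    change H (x, unitInterval.symm (0 * _)) = φ x
    simp [h1]
  refine CubeLift.congr ((isKFibration_pathFib φ).cubeLift_of_boundary_homotopy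
    (continuous_pathFib φ).kCont hw (u₀ := fun z => e (k z.1, z.2)) ?_ (fun y hy => ?_)
    fun w₁ hw₁ hwk₁ _ => ?_) fun y hy => (e0 (k y)).symm
  · intro K _ _ _ f hf hA
    exact he.comp ((hk K (fun z => (f z).1) (by fun_prop) hA).prodMk (continuous_snd.comp hf))
  · rw [e0, hwk y hy]
    rfl
  · refine ⟨fun y => e (w₁ y, 1), he.comp (by fun_prop), fun y => ?_, fun y hy => ?_⟩
    · change H (w₁ y, unitInterval.symm (1 * unitInterval.symm 0)) = w₁ y
      simp [h0]
    · change e (w₁ y, 1) = e (k y, 1)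
      rw [← hwk₁ y hy]
      congr 2
      change H (k y, unitInterval.symm (1 * unitInterval.symm 0)) = k y
      simp [h0]

/-- A homotopy equivalence is a weak equivalence. -/
theorem isWeakHomotopyEquiv_of_homotopyEquiv {Q : N → M} (hp : Continuous p) (hQ : Continuous Q)
    (h : IsWeakHomotopyEquiv (Q ∘ p)) (h' : IsWeakHomotopyEquiv (p ∘ Q)) :
    IsWeakHomotopyEquiv p := by
  obtain ⟨hc, hc0, hck⟩ := h
  obtain ⟨hd, hd0, hdk⟩ := h'
  have aux : ∀ {A B C D : Type u} {a : A → B} {b : B → C} {c : C → D}, Function.Bijective (b ∘ a) →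
      Function.Bijective (c ∘ b) → Function.Bijective a := by
    intro A B C D a b c h1 h2
    have hb : Function.Bijective b := ⟨h2.1.of_comp, h1.2.of_comp⟩
    exact (Function.Bijective.of_comp_iff' hb a).1 h1
  refine ⟨hp, ?_, fun k x => ?_⟩
  · refine aux (b := pi0Map ⟨Q, hQ⟩) (c := pi0Map ⟨p, hp⟩) ?_ ?_
    · refine (congrArg Function.Bijective (funext fun x => ?_)).mpr (hc0)
      induction x using Quotient.inductionOn with
      | h x => rfl
    · refine (congrArg Function.Bijective (funext fun x => ?_)).mpr (hd0)
      induction x using Quotient.inductionOn with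
      | h x => rfl
  · refine aux (b := piMap ⟨Q, hQ⟩ (k + 1) (p x)) (c := piMap ⟨p, hp⟩ (k + 1) (Q (p x))) ?_ ?_
    · refine (congrArg Function.Bijective (funext fun x => ?_)).mpr (hck k x)
      induction x using Quotient.inductionOn with
      | h x => rfl
    · refine (congrArg Function.Bijective (funext fun x => ?_)).mpr (hdk k (p x))
      induction x using Quotient.inductionOn with
      | h x => rfl

end WeakEquivalenceCriterion

/-! ### Maps on words -/

section ImageWords

variable {G G' G'' : Type u}

theorem AnMap.exists_eq_word (x : ℝ≥0∞ × G) (w : List (ℝ≥0∞ × G)) :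
    (0, x.2) :: w = word (fun j : Fin w.length => w[j].1)
      (Fin.cons x.2 fun j : Fin w.length => w[j].2) := by
  simp [word]

/-- Processing of one letter of a word with cuts. -/
noncomputable def cutStep (φ : List (ℝ≥0∞ × G) → G') (l : ℝ≥0) (x : Bool × ℝ≥0∞ × G)
    (s : List (ℝ≥0∞ × G) × List (ℝ≥0∞ × G')) : List (ℝ≥0∞ × G) × List (ℝ≥0∞ × G') :=
  if x.1 then ([], (x.2.1 - l, φ (x.2 :: s.1)) :: s.2) else (x.2 :: s.1, s.2)

/-- The word of the values of `φ` on the blocks of a word, which is cut at the parameters `t > l`;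
the parameters of the cuts are lowered by `l`. -/
noncomputable def imageWord (φ : List (ℝ≥0∞ × G) → G') (l : ℝ≥0) (w : List (ℝ≥0∞ × G)) :
    List (ℝ≥0∞ × G') :=
  ((AnMap.mark l w).foldr (cutStep φ l) ([], [])).2

/-- The state reached from a word by `cutStep`, with cuts at the parameters `t > l`. -/
noncomputable def cutState (φ : List (ℝ≥0∞ × G) → G') (l : ℝ≥0) (v : List (ℝ≥0∞ × G)) :
    List (ℝ≥0∞ × G) × List (ℝ≥0∞ × G') :=
  (v.map (AnMap.markLetter l)).foldr (cutStep φ l) ([], [])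

theorem cutState_cons_of_lt {φ : List (ℝ≥0∞ × G) → G'} {l : ℝ≥0} {x : ℝ≥0∞ × G}
    (v : List (ℝ≥0∞ × G)) (h : (l : ℝ≥0∞) < x.1) : cutState φ l (x :: v) =
      ([], (x.1 - l, φ (x :: (cutState φ l v).1)) :: (cutState φ l v).2) := by
  simp [cutState, AnMap.markLetter, cutStep, h]

theorem cutState_cons_of_le {φ : List (ℝ≥0∞ × G) → G'} {l : ℝ≥0} {x : ℝ≥0∞ × G}
    (v : List (ℝ≥0∞ × G)) (h : x.1 ≤ (l : ℝ≥0∞)) : cutState φ l (x :: v) =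
      (x :: (cutState φ l v).1, (cutState φ l v).2) := by
  simp [cutState, AnMap.markLetter, cutStep, not_lt.2 h]

theorem imageWord_cons (φ : List (ℝ≥0∞ × G) → G') (l : ℝ≥0) (x : ℝ≥0∞ × G)
    (v : List (ℝ≥0∞ × G)) : imageWord φ l (x :: v) =
      (x.1 - l, φ (x :: (cutState φ l v).1)) :: (cutState φ l v).2 := by
  simp [imageWord, AnMap.mark_cons, cutState, cutStep]

theorem length_foldr_cutStep (φ : List (ℝ≥0∞ × G) → G') (l : ℝ≥0)
    (v : List (Bool × ℝ≥0∞ × G)) : (v.foldr (cutStep φ l) ([], [])).1.length +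
      (v.foldr (cutStep φ l) ([], [])).2.length ≤ v.length := by
  induction v with
  | nil => simp
  | cons x v ih =>
    rw [List.foldr_cons, cutStep]
    split <;> simp <;> omega

theorem foldr_cutStep_append (φ : List (ℝ≥0∞ × G) → G') (l : ℝ≥0) (L : List (Bool × ℝ≥0∞ × G))
    (o : List (ℝ≥0∞ × G')) : L.foldr (cutStep φ l) ([], o) =
      ((L.foldr (cutStep φ l) ([], [])).1, (L.foldr (cutStep φ l) ([], [])).2 ++ o) := by
  induction L with
  | nil => simp
  | cons x u ih =>
    rw [List.foldr_cons, ih, List.foldr_cons, cutStep, cutStep]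
    split <;> simp

theorem length_cutState (φ : List (ℝ≥0∞ × G) → G') (l : ℝ≥0) (v : List (ℝ≥0∞ × G)) :
    (cutState φ l v).1.length + (cutState φ l v).2.length ≤ v.length := by
  simpa [cutState] using length_foldr_cutStep φ l (v.map (AnMap.markLetter l))

theorem length_imageWord (φ : List (ℝ≥0∞ × G) → G') (l : ℝ≥0) (v : List (ℝ≥0∞ × G)) :
    (imageWord φ l v).length ≤ v.length := by
  cases v with
  | nil => rfl
  | cons x v =>
    have := length_cutState φ l v
    rw [imageWord_cons]
    simp only [List.length_cons]
    omega

theorem cutState_eq_self {φ : List (ℝ≥0∞ × G) → G'} {l : ℝ≥0} {v : List (ℝ≥0∞ × G)}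
    (h : ∀ x ∈ v, x.1 ≤ (l : ℝ≥0∞)) : cutState φ l v = (v, []) := by
  induction v with
  | nil => rfl
  | cons x v ih =>
    rw [cutState_cons_of_le v (h x (by simp)), ih fun y hy => h y (by simp [hy])]

/-- A word whose parameters do not exceed the size is not cut. -/
theorem imageWord_of_le {φ : List (ℝ≥0∞ × G) → G'} {l : ℝ≥0} {x : ℝ≥0∞ × G} {v : List (ℝ≥0∞ × G)}
    (h : ∀ x ∈ v, x.1 ≤ (l : ℝ≥0∞)) : imageWord φ l (x :: v) = [(x.1 - l, φ (x :: v))] := by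
  rw [imageWord_cons, cutState_eq_self h]

theorem foldr_cutStep_congr {φ φ' : List (ℝ≥0∞ × G) → G'} {l : ℝ≥0}
    {v : List (Bool × ℝ≥0∞ × G)} (h : ∀ w : List (ℝ≥0∞ × G), w.length ≤ v.length → φ w = φ' w) :
    v.foldr (cutStep φ l) ([], []) = v.foldr (cutStep φ' l) ([], []) := by
  induction v with
  | nil => rfl
  | cons x v ih =>
    have := length_foldr_cutStep φ' l v
    rw [List.foldr_cons, List.foldr_cons, ih fun w hw => h w (by simp only [List.length_cons]; omega),
      cutStep, cutStep, h]
    simp only [List.length_cons]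
    omega

theorem imageWord_congr {φ φ' : List (ℝ≥0∞ × G) → G'} {l : ℝ≥0} {v : List (ℝ≥0∞ × G)}
    (h : ∀ w : List (ℝ≥0∞ × G), w.length ≤ v.length → φ w = φ' w) :
    imageWord φ l v = imageWord φ' l v := by
  have e : (AnMap.mark l v).length = v.length := by cases v <;> simp [AnMap.mark]
  rw [imageWord, imageWord, foldr_cutStep_congr fun w hw => h w (hw.trans e.le)]

/-- The functoriality of `imageWord`: cutting at the parameters `t > l` and then at the parameters
`t - l > l'` amounts to cutting at the parameters `t > l + l'` and then cutting the blocks. -/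
theorem imageWord_imageWord (φ' : List (ℝ≥0∞ × G') → G'') (φ : List (ℝ≥0∞ × G) → G') (l' l : ℝ≥0)
    (w : List (ℝ≥0∞ × G)) : imageWord φ' l' (imageWord φ l w) =
      imageWord (fun v => φ' (imageWord φ l v)) (l + l') w := by
  have key : ∀ v : List (ℝ≥0∞ × G),
      cutState φ l (cutState (fun v => φ' (imageWord φ l v)) (l + l') v).1 =
        ((cutState φ l v).1, (cutState φ' l' (cutState φ l v).2).1) ∧
      (cutState φ' l' (cutState φ l v).2).2 =
        (cutState (fun v => φ' (imageWord φ l v)) (l + l') v).2 := by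
    intro v
    induction v with
    | nil => exact ⟨rfl, rfl⟩
    | cons x v ih =>
      obtain ⟨ih1, ih2⟩ := ih
      rcases le_or_gt x.1 (l : ℝ≥0∞) with h | h
      · have h' : x.1 ≤ ((l + l' : ℝ≥0) : ℝ≥0∞) := h.trans (by exact_mod_cast le_self_add)
        rw [cutState_cons_of_le v h, cutState_cons_of_le v h', cutState_cons_of_le _ h, ih1]
        exact ⟨rfl, ih2⟩
      · rcases le_or_gt (x.1 - l) (l' : ℝ≥0∞) with h1 | h1
        · have h' : x.1 ≤ ((l + l' : ℝ≥0) : ℝ≥0∞) := by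
            rw [ENNReal.coe_add]
            exact tsub_le_iff_left.1 h1
          rw [cutState_cons_of_lt v h, cutState_cons_of_le v h', cutState_cons_of_lt _ h, ih1]
          dsimp only
          rw [cutState_cons_of_le _ h1]
          exact ⟨rfl, ih2⟩
        · have h' : ((l + l' : ℝ≥0) : ℝ≥0∞) < x.1 := by
            rw [ENNReal.coe_add]
            exact lt_tsub_iff_left.1 h1
          rw [cutState_cons_of_lt v h, cutState_cons_of_lt v h']
          dsimp only
          rw [cutState_cons_of_lt _ h1, imageWord_cons, ih1, ← ih2]
          refine ⟨rfl, ?_⟩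
          dsimp only
          rw [ENNReal.coe_add, tsub_add_eq_tsub_tsub]
  cases w with
  | nil => rfl
  | cons x w =>
    obtain ⟨h1, h2⟩ := key w
    rw [imageWord_cons, imageWord_cons, imageWord_cons, imageWord_cons, h1, ← h2,
      ENNReal.coe_add, tsub_add_eq_tsub_tsub]

end ImageWords

section WordMaps

variable {n : ℕ∞} {G G' G'' : Type u} [Monoid G] [Monoid G'] [Monoid G'']

/-- An `A_n`-map of size `l`, as a function on words and without any continuity. -/
structure IsWordMap (n : ℕ∞) (l : ℝ≥0) (φ : List (ℝ≥0∞ × G) → G') : Prop where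
  nil : φ [] = 1
  head : ∀ t t' a v, φ ((t, a) :: v) = φ ((t', a) :: v)
  one : ∀ t, φ [(t, 1)] = 1
  zero : ∀ u v t c b, ((u.length + 2 + v.length : ℕ) : ℕ∞) ≤ n →
    φ (u ++ (t, c) :: (0, b) :: v) = φ (u ++ (t, c * b) :: v)
  mul : ∀ u v t b, (l : ℝ≥0∞) ≤ t → ((u.length + 1 + v.length : ℕ) : ℕ∞) ≤ n →
    φ (u ++ (t, b) :: v) = φ u * φ ((t, b) :: v)
  degen : ∀ u v t t' b, ((u.length + 2 + v.length : ℕ) : ℕ∞) ≤ n →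
    φ (u ++ (t, 1) :: (t', b) :: v) = φ (u ++ (max t t', b) :: v)
  degen_last : ∀ u t, ((u.length + 1 : ℕ) : ℕ∞) ≤ n → φ (u ++ [(t, 1)]) = φ u

theorem AnMap.isWordMap [TopologicalSpace G] [TopologicalSpace G'] (f : AnMap n G G') :
    IsWordMap n f.size f.eval where
  nil := rfl
  head := f.eval_head
  one := f.eval_one
  zero := f.eval_zero
  mul := f.eval_mul
  degen := f.eval_degen
  degen_last := f.eval_degen_last

theorem isWordMap_one (l : ℝ≥0) : IsWordMap n l (fun _ : List (ℝ≥0∞ × G) => (1 : G')) := by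
  constructor <;> simp

/-- The `A_n`-map with given values on words. -/
def IsWordMap.toAnMap [TopologicalSpace G] [TopologicalSpace G'] {l : ℝ≥0}
    {φ : List (ℝ≥0∞ × G) → G'} (h : IsWordMap n l φ)
    (hc : ∀ m : ℕ, (m : ℕ∞) < n → ContinuousGeneratedBy KTest.{u}
      fun x : (Fin m → ℝ≥0∞) × (Fin (m + 1) → G) => φ (AnMap.word x.1 x.2)) : AnMap n G G' :=
  AnMap.ofWord φ l hc h.head h.one h.zero
    (fun x u v t b ht hn => h.mul (x :: u) v t b ht (by simpa [add_assoc] using hn)) h.degen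
    fun x u t hn => h.degen_last (x :: u) t (by simpa [add_assoc] using hn)

namespace AnMap

variable [TopologicalSpace G] [TopologicalSpace G'] [TopologicalSpace G'']

theorem eval_word (f : AnMap n G G') {m : ℕ} (h : (m : ℕ∞) < n) (T : Fin m → ℝ≥0∞)
    (g : Fin (m + 1) → G) : f.eval (word T g) = f.form m h (T, g) :=
  f.eval_eq h T g (length_word T g) (fun j hj => by simp [getElem_word])
    fun j hj => by simp [getElem_word]

/-- An `A_n`-map is determined by its size and its values on words of length at most `n`. -/
theorem ext_eval {f f' : AnMap n G G'} (hs : f.size = f'.size)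
    (h : ∀ w : List (ℝ≥0∞ × G), (w.length : ℕ∞) ≤ n → f.eval w = f'.eval w) : f = f' := by
  have hf : f.form = f'.form := by
    funext m hm
    refine DFunLike.ext _ _ fun x => ?_
    obtain ⟨T, g⟩ := x
    rw [← f.eval_word hm T g, ← f'.eval_word hm T g]
    refine h _ ?_
    rw [length_word]
    exact_mod_cast Order.add_one_le_of_lt hm
  cases f
  cases f'
  cases hs
  cases hf
  rfl

theorem eval_toAnMap {l : ℝ≥0} {φ : List (ℝ≥0∞ × G) → G'} (h : IsWordMap n l φ)
    (hc : ∀ m : ℕ, (m : ℕ∞) < n → ContinuousGeneratedBy KTest.{u}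
      fun x : (Fin m → ℝ≥0∞) × (Fin (m + 1) → G) => φ (AnMap.word x.1 x.2))
    (w : List (ℝ≥0∞ × G)) (hw : (w.length : ℕ∞) ≤ n) : (h.toAnMap hc).eval w = φ w := by
  cases w with
  | nil => exact h.nil.symm
  | cons x w =>
    have hm : (w.length : ℕ∞) < n := lt_of_lt_of_le
      (by rw [List.length_cons]; exact_mod_cast Nat.lt_succ_self _) hw
    rw [eval, dif_pos hm]
    change φ (word _ _) = φ _
    rw [← exists_eq_word x w]
    exact h.head _ _ _ _

theorem underlying_eq (hn : 1 ≤ n) (f : AnMap n G G') (t : ℝ≥0∞) (g : G) :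
    f.underlying hn g = f.eval [(t, g)] :=
  (f.eval_eq (m := 0) (l := [(t, g)]) _ _ _ rfl (fun j hj => by omega) fun j hj => by
    obtain rfl : j = 0 := by omega
    rfl).symm

end AnMap

/-! #### Composites of maps on words -/

theorem AnMap.size_comp [TopologicalSpace G] [TopologicalSpace G']
    [TopologicalSpace G''] (f' : AnMap n G' G'') (f : AnMap n G G') :
    (f'.comp f).size = f.size + f'.size := rfl

section

variable {l l' : ℝ≥0} {φ' : List (ℝ≥0∞ × G') → G''} {φ : List (ℝ≥0∞ × G) → G'}

/-- A map on words as an `A_n`-map between spaces with indiscrete topologies, for which continuity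
is no condition. -/
def IsWordMap.indiscrete (h : IsWordMap n l φ) : @AnMap n G G' _ ⊤ _ ⊤ :=
  @IsWordMap.toAnMap n G G' _ _ ⊤ ⊤ l φ h fun _ _ _ _ => continuous_top

theorem IsWordMap.eval_indiscrete (h : IsWordMap n l φ) (w : List (ℝ≥0∞ × G))
    (hw : (w.length : ℕ∞) ≤ n) : @AnMap.eval n G G' _ ⊤ _ ⊤ h.indiscrete w = φ w :=
  @AnMap.eval_toAnMap n G G' _ _ ⊤ ⊤ l φ h (fun _ _ _ _ => continuous_top) w hw

theorem IsWordMap.compEval_indiscrete (h' : IsWordMap n l' φ') (h : IsWordMap n l φ)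
    (w : List (ℝ≥0∞ × G)) (hw : (w.length : ℕ∞) ≤ n) :
    @AnMap.compEval n G G' G'' _ ⊤ _ ⊤ _ ⊤ h'.indiscrete h.indiscrete w =
      φ' (imageWord φ l w) := by
  have e : imageWord (@AnMap.eval n G G' _ ⊤ _ ⊤ h.indiscrete) l w = imageWord φ l w :=
    imageWord_congr fun v hv => h.eval_indiscrete v (le_trans (by exact_mod_cast hv) hw)
  change @AnMap.eval n G' G'' _ ⊤ _ ⊤ h'.indiscrete
    (imageWord (@AnMap.eval n G G' _ ⊤ _ ⊤ h.indiscrete) l w) = _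
  rw [e]
  exact h'.eval_indiscrete _ (le_trans (by exact_mod_cast length_imageWord φ l w) hw)

/-- Composites of maps on words are maps on words. The relations involve no topology, so those of
composites of `A_n`-maps apply, for the indiscrete topologies. -/
theorem IsWordMap.comp (h' : IsWordMap n l' φ') (h : IsWordMap n l φ) :
    IsWordMap n (l + l') (fun w => φ' (imageWord φ l w)) where
  nil := h'.nil
  head t t' a v := by
    rw [imageWord_cons, imageWord_cons, h.head t t' a]
    exact h'.head _ _ _ _
  one t := by
    rw [imageWord_of_le (by simp), h.one, h'.one]
  zero u v t c b hn := by
    rw [← compEval_indiscrete h' h _ (by simpa [add_comm, add_left_comm] using hn),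
      ← compEval_indiscrete h' h _ (le_trans (by
        simp only [List.length_append, List.length_cons]; exact_mod_cast (by omega)) hn)]
    exact @AnMap.compEval_zero n G G' G'' _ ⊤ _ ⊤ _ ⊤ _ _ u v t c b hn
  mul u v t b ht hn := by
    cases u with
    | nil =>
      change _ = φ' [] * _
      rw [h'.nil, one_mul, List.nil_append]
    | cons x u =>
      simp only [List.length_cons] at hn
      rw [← compEval_indiscrete h' h _ (le_trans (by
          simp only [List.length_append, List.length_cons]; exact_mod_cast (by omega)) hn),
        ← compEval_indiscrete h' h _ (le_trans (by
          simp only [List.length_cons]; exact_mod_cast (by omega)) hn),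
        ← compEval_indiscrete h' h _ (le_trans (by
          simp only [List.length_cons]; exact_mod_cast (by omega)) hn)]
      exact @AnMap.compEval_mul n G G' G'' _ ⊤ _ ⊤ _ ⊤ _ _ x u v t b ht
        (le_trans (by exact_mod_cast (by omega)) hn)
  degen u v t t' b hn := by
    rw [← compEval_indiscrete h' h _ (by simpa [add_comm, add_left_comm] using hn),
      ← compEval_indiscrete h' h _ (le_trans (by
        simp only [List.length_append, List.length_cons]; exact_mod_cast (by omega)) hn)]
    exact @AnMap.compEval_degen n G G' G'' _ ⊤ _ ⊤ _ ⊤ _ _ u v t t' b hn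
  degen_last u t hn := by
    cases u with
    | nil =>
      change φ' (imageWord φ l [(t, 1)]) = φ' []
      rw [imageWord_of_le (by simp), h.one, h'.one, h'.nil]
    | cons x u =>
      simp only [List.length_cons] at hn
      rw [← compEval_indiscrete h' h _ (le_trans (by
          simp only [List.length_append, List.length_cons, List.length_nil]
          exact_mod_cast (by omega)) hn),
        ← compEval_indiscrete h' h _ (le_trans (by
          simp only [List.length_cons]; exact_mod_cast (by omega)) hn)]
      exact @AnMap.compEval_degen_last n G G' G'' _ ⊤ _ ⊤ _ ⊤ _ _ x u t
        (le_trans (by exact_mod_cast (by omega)) hn)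

/-- The composite may be computed from any cuts that are made where the parameters are at least `l`
and such that all parameters without a cut are at most `l`. -/
theorem IsWordMap.comp_eq_of_cuts (h' : IsWordMap n l' φ') (h : IsWordMap n l φ) (x : ℝ≥0∞ × G)
    (v : List (Bool × ℝ≥0∞ × G)) (hn : ((1 + v.length : ℕ) : ℕ∞) ≤ n)
    (hv : ∀ y ∈ v, (y.1 = true → (l : ℝ≥0∞) ≤ y.2.1) ∧ (y.1 = false → y.2.1 ≤ (l : ℝ≥0∞))) :
    φ' (imageWord φ l (x :: v.map Prod.snd)) =
      φ' (((true, x) :: v).foldr (cutStep φ l) ([], [])).2 := by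
  have hn' : (((x :: v.map Prod.snd : List (ℝ≥0∞ × G)).length : ℕ) : ℕ∞) ≤ n := by
    simpa [add_comm] using hn
  rw [← compEval_indiscrete h' h _ hn']
  have e := @AnMap.compEval_eq n G G' G'' _ ⊤ _ ⊤ _ ⊤ h'.indiscrete h.indiscrete x v hn hv
  rw [e]
  have e2 : ((true, x) :: v).foldr
      (cutStep (@AnMap.eval n G G' _ ⊤ _ ⊤ h.indiscrete) l) ([], []) =
      ((true, x) :: v).foldr (cutStep φ l) ([], []) :=
    foldr_cutStep_congr fun w hw => h.eval_indiscrete w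
      (le_trans (Nat.cast_le.2 hw) (by simpa [add_comm] using hn))
  have hlen := length_foldr_cutStep φ l ((true, x) :: v)
  change @AnMap.eval n G' G'' _ ⊤ _ ⊤ h'.indiscrete (((true, x) :: v).foldr
      (cutStep (@AnMap.eval n G G' _ ⊤ _ ⊤ h.indiscrete) l) ([], [])).2 = _
  rw [e2, h'.eval_indiscrete]
  refine le_trans ?_ hn
  simp only [List.length_cons] at hlen ⊢
  exact_mod_cast (by omega)

end

/-! #### The category of `A_n`-maps -/

namespace AnMap

variable {H : Type u} [Monoid H] [TopologicalSpace G] [TopologicalSpace G'] [TopologicalSpace G'']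
  [TopologicalSpace H]

theorem eval_comp (f' : AnMap n G' G'') (f : AnMap n G G') (w : List (ℝ≥0∞ × G))
    (hw : (w.length : ℕ∞) ≤ n) : (f'.comp f).eval w = f'.eval (imageWord f.eval f.size w) :=
  eval_toAnMap (f'.isWordMap.comp f.isWordMap) (continuous_compEval f' f) w hw

theorem comp_assoc (f'' : AnMap n G'' H) (f' : AnMap n G' G'') (f : AnMap n G G') :
    (f''.comp f').comp f = f''.comp (f'.comp f) := by
  refine ext_eval ?_ fun w hw => ?_
  · simp only [size_comp, add_assoc]
  · have hw' : ((imageWord f.eval f.size w).length : ℕ∞) ≤ n :=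
      le_trans (by exact_mod_cast length_imageWord _ _ w) hw
    rw [eval_comp _ _ _ hw, eval_comp _ _ _ hw', eval_comp _ _ _ hw, imageWord_imageWord,
      size_comp]
    congr 1
    exact imageWord_congr fun v hv =>
      (eval_comp f' f v (le_trans (Nat.cast_le.2 hv) hw)).symm

theorem eval_identity [CGMonoid G] (w : List (ℝ≥0∞ × G)) (hw : (w.length : ℕ∞) ≤ n) :
    (identity n G).eval w = (w.map Prod.snd).prod :=
  eval_toAnMap (n := n) (l := 0) (φ := fun w : List (ℝ≥0∞ × G) => (w.map Prod.snd).prod)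
    (by constructor <;> simp [mul_assoc]) (fun m h => by exact ((identity n G).form m h).prop) w hw

/-- The left unit law: cutting at parameters `t > ℓ` and multiplying the values of the blocks gives
the value of the word. -/
theorem identity_comp [CGMonoid G'] (f : AnMap n G G') : (identity n G').comp f = f := by
  refine ext_eval (add_zero _) fun w hw => ?_
  rw [eval_comp _ _ _ hw,
    eval_identity _ (le_trans (by exact_mod_cast length_imageWord _ _ w) hw)]
  have key : ∀ (v : List (ℝ≥0∞ × G)) (x : ℝ≥0∞ × G) (u : List (ℝ≥0∞ × G)),
      ((u.length + 1 + v.length : ℕ) : ℕ∞) ≤ n → f.eval (x :: u ++ v) =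
        f.eval (x :: u ++ (cutState f.eval f.size v).1) *
          ((cutState f.eval f.size v).2.map Prod.snd).prod := by
    intro v
    induction v with
    | nil => simp [cutState]
    | cons y v ih =>
      intro x u hn
      simp only [List.length_cons] at hn
      rcases le_or_gt y.1 (f.size : ℝ≥0∞) with h | h
      · rw [cutState_cons_of_le v h]
        have := ih x (u ++ [y]) (le_trans (by
          simp only [List.length_append, List.length_cons, List.length_nil]
          exact_mod_cast (by omega)) hn)
        simpa using this
      · rw [cutState_cons_of_lt v h]
        have e := f.isWordMap.mul (x :: u) v y.1 y.2 h.le (le_trans (by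
          simp only [List.length_cons]
          exact_mod_cast (by omega)) hn)
        have := ih y [] (le_trans (by
          simp only [List.length_nil]
          exact_mod_cast (by omega)) hn)
        simp only [List.singleton_append] at this
        rw [e, show ((y.1, y.2) :: v : List (ℝ≥0∞ × G)) = y :: v from rfl, this]
        simp
  cases w with
  | nil => rfl
  | cons x v =>
    rw [imageWord_cons]
    have := key v x [] (by simpa [add_comm] using hw)
    simpa using this.symm

/-- The right unit law: the size of the identity is `0`, so that a word may be cut into its
letters. -/
theorem comp_identity [CGMonoid G] (f : AnMap n G G') : f.comp (identity n G) = f := by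
  refine ext_eval (zero_add _) fun w hw => ?_
  rw [eval_comp _ _ _ hw]
  cases w with
  | nil => rfl
  | cons x v =>
    have hn : ((1 + (v.map fun y => (true, y)).length : ℕ) : ℕ∞) ≤ n := by
      simpa [add_comm] using hw
    have e := f.isWordMap.comp_eq_of_cuts (identity n G).isWordMap x (v.map fun y => (true, y)) hn
      (by
        intro y hy
        obtain ⟨z, -, rfl⟩ := List.mem_map.1 hy
        refine ⟨fun _ => ?_, fun h => by simp at h⟩
        exact zero_le)
    rw [List.map_map, show (Prod.snd ∘ fun y : ℝ≥0∞ × G => (true, y)) = id from rfl,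
      List.map_id] at e
    rw [e]
    congr 1
    have h1 : (1 : ℕ∞) ≤ n := le_trans (by simp) hw
    have key : ∀ v : List (ℝ≥0∞ × G), (v.map fun y => (true, y)).foldr
        (cutStep (identity n G).eval (identity n G).size) ([], []) = ([], v) := by
      intro v
      induction v with
      | nil => rfl
      | cons y v ih =>
        rw [List.map_cons, List.foldr_cons, ih, cutStep]
        simp [eval_identity [y] (by simpa using h1),
          show (identity n G).size = 0 from rfl]
    have := key (x :: v)
    rw [List.map_cons] at this
    rw [this]

end AnMap

end WordMaps

/-! ### Continuity of families of maps on words -/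

section WordContinuity

variable {n : ℕ∞} {G G' G'' : Type u} [TopologicalSpace G] [TopologicalSpace G']
  [TopologicalSpace G''] {X : Type v} [TopologicalSpace X] {Z : Type w} [TopologicalSpace Z]

/-- The value at a point of a word of functions. -/
def evalWord {K : Type*} [TopologicalSpace K] (w : List (C(K, ℝ≥0∞) × C(K, G))) (z : K) :
    List (ℝ≥0∞ × G) :=
  w.map fun q => (q.1 z, q.2 z)

/-- The value at a point of a word of functions with cuts. -/
def evalCuts {K : Type*} [TopologicalSpace K] (w : List (Bool × C(K, ℝ≥0∞) × C(K, G))) (z : K) :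
    List (Bool × ℝ≥0∞ × G) :=
  w.map fun q => (q.1, q.2.1 z, q.2.2 z)

theorem length_evalWord {K : Type*} [TopologicalSpace K] (w : List (C(K, ℝ≥0∞) × C(K, G)))
    (z : K) : (evalWord w z).length = w.length := by
  simp [evalWord]

/-- For a family, over `X`, of maps on words: joint continuity, in the sense of compactly generated
spaces and over the subset `A` of `X`, on words of length at most `m`. -/
def WordContOn (m : ℕ) (e : X → List (ℝ≥0∞ × G) → G') (A : Set X) : Prop :=
  ∀ (K : Type u) [TopologicalSpace K] [CompactSpace K] [T2Space K] (p : K → X), Continuous p →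
    (∀ z, p z ∈ A) → ∀ w : List (C(K, ℝ≥0∞) × C(K, G)), w.length ≤ m →
      Continuous fun z => e (p z) (evalWord w z)

theorem WordContOn.comp {m : ℕ} {e : X → List (ℝ≥0∞ × G) → G'} {A : Set X} (h : WordContOn m e A)
    {g : Z → X} (hg : Continuous g) {B : Set Z} (hAB : ∀ z ∈ B, g z ∈ A) :
    WordContOn m (fun z => e (g z)) B :=
  fun K _ _ _ p hp hB w hw => h K (fun z => g (p z)) (hg.comp hp) (fun z => hAB _ (hB z)) w hw

theorem WordContOn.congr {m : ℕ} {e e' : X → List (ℝ≥0∞ × G) → G'} {A : Set X}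
    (h : WordContOn m e A) (h' : ∀ x ∈ A, ∀ w : List (ℝ≥0∞ × G), w.length ≤ m → e' x w = e x w) :
    WordContOn m e' A :=
  fun K _ _ _ p hp hA w hw => (h K p hp hA w hw).congr fun z =>
    (h' _ (hA z) _ (by rwa [length_evalWord])).symm

/-- The passage from words to points of `[0,∞]^m × G^{m+1}`. -/
theorem WordContOn.kContOn {m : ℕ} {e : X → List (ℝ≥0∞ × G) → G'} {A : Set X}
    (h : WordContOn (m + 1) e A) :
    KContOn (fun z : X × (Fin m → ℝ≥0∞) × (Fin (m + 1) → G) => e z.1 (AnMap.word z.2.1 z.2.2))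
      {z | z.1 ∈ A} := by
  intro K _ _ _ p hp hA
  let w : List (C(K, ℝ≥0∞) × C(K, G)) :=
    (⟨fun _ => 0, continuous_const⟩, ⟨fun z => (p z).2.2 0, by fun_prop⟩) ::
      List.ofFn fun j : Fin m => (⟨fun z => (p z).2.1 j, by fun_prop⟩,
        ⟨fun z => (p z).2.2 j.succ, by fun_prop⟩)
  refine (h K (fun z => (p z).1) (by fun_prop) hA w (by simp [w])).congr fun z => ?_
  simp [evalWord, w, AnMap.word, List.map_ofFn, Function.comp_def]

section Fold

variable {K : Type u} [TopologicalSpace K] [CompactSpace K] [T2Space K]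

/-- Cutting a word that depends continuously on a point, at fixed places, gives words that depend
continuously on the point. -/
theorem exists_foldr_cutStep {m : ℕ} {e : K → List (ℝ≥0∞ × G) → G'} (he : WordContOn m e univ)
    {s : K → ℝ≥0} (hs : Continuous s) (L : List (Bool × C(K, ℝ≥0∞) × C(K, G))) (hL : L.length ≤ m) :
    ∃ (p : List (C(K, ℝ≥0∞) × C(K, G))) (o : List (C(K, ℝ≥0∞) × C(K, G'))),
      p.length + o.length ≤ L.length ∧ ∀ z,
        (evalCuts L z).foldr (cutStep (e z) (s z)) ([], []) = (evalWord p z, evalWord o z) := by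
  induction L with
  | nil => exact ⟨[], [], by simp, fun z => rfl⟩
  | cons y L ih =>
    simp only [List.length_cons] at hL
    obtain ⟨p, o, h1, h2⟩ := ih (by omega)
    obtain ⟨c, y⟩ := y
    cases c
    · refine ⟨y :: p, o, by simp only [List.length_cons]; omega, fun z => ?_⟩
      rw [evalCuts, List.map_cons, List.foldr_cons, ← evalCuts, h2]
      simp [cutStep, evalWord]
    · have h3 := he K id continuous_id (fun _ => mem_univ _) (y :: p)
        (by simp only [List.length_cons]; omega)
      have h4 : Continuous fun z => y.1 z - (s z : ℝ≥0∞) :=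
        ENNReal.continuousOn_sub.comp_continuous
          (f := fun z => (y.1 z, (s z : ℝ≥0∞))) (by fun_prop) fun z => by simp
      refine ⟨[], (⟨_, h4⟩, ⟨_, h3⟩) :: o, by simp only [List.length_cons, List.length_nil]; omega,
        fun z => ?_⟩
      rw [evalCuts, List.map_cons, List.foldr_cons, ← evalCuts, h2]
      simp [cutStep, evalWord]

/-- Joint continuity of the composite of two maps on words, with prescribed cuts. If there is a
cut after the first letter, then the blocks are shorter than the word. -/
theorem continuous_foldr_cutStep {m : ℕ} {e' : K → List (ℝ≥0∞ × G') → G''}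
    (he' : ∀ j, WordContOn j e' univ) {e : K → List (ℝ≥0∞ × G) → G'} (he : WordContOn m e univ)
    {s : K → ℝ≥0} (hs : Continuous s) (x : Bool × C(K, ℝ≥0∞) × C(K, G))
    (L : List (Bool × C(K, ℝ≥0∞) × C(K, G)))
    (hL : L.length + 1 ≤ m ∨ L.length ≤ m ∧ ∃ y ∈ L, y.1 = true) : Continuous fun z =>
      e' z ((evalCuts (x :: L) z).foldr (cutStep (e z) (s z)) ([], [])).2 := by
  rcases hL with hL | ⟨hL, ⟨b, y⟩, hy, rfl⟩
  · obtain ⟨p, o, -, h⟩ := exists_foldr_cutStep he hs (x :: L) (by simpa using hL)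
    refine (he' _ K id continuous_id (fun _ => mem_univ _) o le_rfl).congr fun z => ?_
    rw [h]
    rfl
  · obtain ⟨L₁, L₂, rfl⟩ := List.append_of_mem hy
    simp only [List.length_append, List.length_cons] at hL
    obtain ⟨p, o, -, h⟩ := exists_foldr_cutStep he hs ((true, y) :: L₂)
      (by simp only [List.length_cons]; omega)
    obtain ⟨p', o', -, h'⟩ := exists_foldr_cutStep he hs (x :: L₁)
      (by simp only [List.length_cons]; omega)
    refine (he' _ K id continuous_id (fun _ => mem_univ _) (o' ++ o) le_rfl).congr fun z => ?_
    have h0 : (evalCuts ((true, y) :: L₂) z).foldr (cutStep (e z) (s z)) ([], []) =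
        ([], evalWord o z) := by
      have h1 := h z
      refine Prod.ext ?_ ((congrArg Prod.snd h1).trans rfl)
      simp [evalCuts, cutStep]
    have e1 : evalCuts (x :: (L₁ ++ (true, y) :: L₂)) z =
        evalCuts (x :: L₁) z ++ evalCuts ((true, y) :: L₂) z := by
      simp [evalCuts]
    rw [e1, List.foldr_append, h0, foldr_cutStep_append, h']
    simp [evalWord]

end Fold

variable [Monoid G] [Monoid G'] [Monoid G'']

/-- Joint continuity of the composite of two maps on words. The letters marked `true` are those
whose parameter is known to be at least the size. -/
theorem continuous_imageWord {m : ℕ} (N : ℕ) : ∀ {K : Type u} [TopologicalSpace K]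
    [CompactSpace K] [T2Space K] {e' : K → List (ℝ≥0∞ × G') → G''} {s s' : K → ℝ≥0}
    (_ : ∀ z, IsWordMap n (s' z) (e' z)) (_ : ∀ j, WordContOn j e' univ)
    {e : K → List (ℝ≥0∞ × G) → G'} (_ : ∀ z, IsWordMap n (s z) (e z)) (_ : WordContOn m e univ)
    (_ : Continuous s) (x : C(K, ℝ≥0∞) × C(K, G)) (L v' : List (Bool × C(K, ℝ≥0∞) × C(K, G)))
    (_ : v'.length = N)
    (_ : ∀ y ∈ L, ∀ z, (y.1 = true → (s z : ℝ≥0∞) ≤ y.2.1 z) ∧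
      (y.1 = false → y.2.1 z ≤ (s z : ℝ≥0∞)))
    (_ : ∀ y ∈ v', ∀ z, y.1 = true → (s z : ℝ≥0∞) ≤ y.2.1 z)
    (_ : ((1 + (L.length + v'.length) : ℕ) : ℕ∞) ≤ n)
    (_ : (L ++ v').length + 1 ≤ m ∨ (L ++ v').length ≤ m ∧ ∃ y ∈ L ++ v', y.1 = true),
    Continuous fun z => e' z (imageWord (e z) (s z)
      (evalWord (x :: (L ++ v').map Prod.snd) z)) := by
  induction N with
  | zero =>
    intro K _ _ _ e' s s' hw' he' e hw he hs x L v' hv' hL _ hn hm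
    obtain rfl : v' = [] := List.length_eq_zero_iff.1 hv'
    rw [List.append_nil] at hm ⊢
    refine (continuous_foldr_cutStep he' he hs (true, x) L hm).congr fun z => ?_
    have := (hw' z).comp_eq_of_cuts (hw z) (x.1 z, x.2 z) (evalCuts L z)
      (by simpa [evalCuts] using hn) (by
        intro y hy
        obtain ⟨q, hq, rfl⟩ := List.mem_map.1 hy
        exact hL q hq z)
    rw [show evalCuts ((true, x) :: L) z = (true, x.1 z, x.2 z) :: evalCuts L z from rfl, ← this]
    simp [evalCuts, evalWord, Function.comp_def]
  | succ N ih =>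
    intro K _ _ _ e' s s' hw' he' e hw he hs x L v' hv' hL hF hn hm
    cases v' with
    | nil => simp at hv'
    | cons y v' =>
      simp only [List.length_cons, add_left_inj] at hv' hn
      -- the case of a letter that is put into one of the two classes on all of the space
      have main : ∀ (C : Set K), IsClosed C → ∀ b : Bool, (y.1 = true → b = true) →
          (∀ z ∈ C, (b = true → (s z : ℝ≥0∞) ≤ y.2.1 z) ∧
            (b = false → y.2.1 z ≤ (s z : ℝ≥0∞))) → Continuous fun z : C => e' z
            (imageWord (e z) (s z) (evalWord (x :: (L ++ y :: v').map Prod.snd) z)) := by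
        intro C hC b hyb hb
        have := isCompact_iff_compactSpace.1 hC.isCompact
        let g : C(C, K) := ⟨Subtype.val, continuous_subtype_val⟩
        let pull : Bool × C(K, ℝ≥0∞) × C(K, G) → Bool × C(C, ℝ≥0∞) × C(C, G) :=
          fun q => (q.1, q.2.1.comp g, q.2.2.comp g)
        refine (ih (K := C) (e' := fun z => e' z) (s := fun z => s z) (s' := fun z => s' z)
          (fun z => hw' z) (fun j => (he' j).comp g.continuous fun _ _ => mem_univ _)
          (e := fun z => e z) (fun z => hw z) (he.comp g.continuous fun _ _ => mem_univ _)
          (hs.comp g.continuous) (x.1.comp g, x.2.comp g)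
          (L.map pull ++ [(b, y.2.1.comp g, y.2.2.comp g)]) (v'.map pull)
          (by simpa using hv') ?_ ?_ ?_ ?_).congr fun z => ?_
        · intro q hq z
          simp only [List.mem_append, List.mem_map, List.mem_singleton] at hq
          rcases hq with ⟨q, hq, rfl⟩ | rfl
          · exact hL q hq z
          · exact hb z z.2
        · intro q hq z
          obtain ⟨q₀, hq₀, rfl⟩ := List.mem_map.1 hq
          exact hF q₀ (List.mem_cons_of_mem _ hq₀) z
        · simp only [List.length_append, List.length_map, List.length_cons, List.length_nil]
          refine le_trans ?_ hn
          exact_mod_cast (by omega)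
        · simp only [List.length_append, List.length_map, List.length_cons, List.length_nil,
            List.mem_append] at hm ⊢
          rcases hm with hm | ⟨hm, q, hq, hq'⟩
          · left
            omega
          · right
            refine ⟨by omega, ?_⟩
            rcases hq with hq | hq
            · exact ⟨pull q, Or.inl (Or.inl (List.mem_map_of_mem hq)), hq'⟩
            · rcases List.mem_cons.1 hq with rfl | hq
              · exact ⟨_, Or.inl (Or.inr (List.mem_singleton.2 rfl)), hyb hq'⟩
              · exact ⟨pull q, Or.inr (List.mem_map_of_mem hq), hq'⟩
        · simp [evalWord, pull, g, Function.comp_def]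
      have c1 : IsClosed {z : K | (s z : ℝ≥0∞) ≤ y.2.1 z} := isClosed_le (by fun_prop) (by fun_prop)
      have c2 : IsClosed {z : K | y.2.1 z ≤ (s z : ℝ≥0∞)} := isClosed_le (by fun_prop) (by fun_prop)
      cases hy : y.1 with
      | true =>
        have := main univ isClosed_univ true (fun _ => rfl) fun z _ =>
          ⟨fun _ => hF y (by simp) z hy, fun h => by simp at h⟩
        exact continuousOn_univ.1 (continuousOn_iff_continuous_domRestrict.2 this)
      | false =>
        exact continuous_of_closed_cover c1 c2
          (fun z => le_total (s z : ℝ≥0∞) (y.2.1 z))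
          (main _ c1 true (fun _ => rfl) fun z hz => ⟨fun _ => hz, fun h => by simp at h⟩)
          (main _ c2 false (fun h => by simp [hy] at h) fun z hz =>
            ⟨fun h => by simp at h, fun _ => hz⟩)

/-- Joint continuity of the composite of two maps on words. -/
theorem WordContOn.imageWord {m : ℕ} (hm : (m : ℕ∞) ≤ n) {e' : X → List (ℝ≥0∞ × G') → G''}
    {s s' : X → ℝ≥0} {A : Set X} (hw' : ∀ x, IsWordMap n (s' x) (e' x))
    (he' : ∀ j, WordContOn j e' A) {e : X → List (ℝ≥0∞ × G) → G'}
    (hw : ∀ x, IsWordMap n (s x) (e x)) (he : WordContOn m e A) (hs : ContinuousOn s A) :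
    WordContOn m (fun x w => e' x (imageWord (e x) (s x) w)) A := by
  intro K _ _ _ p hp hA w hwm
  cases w with
  | nil => exact he' 0 K p hp hA [] le_rfl
  | cons x v =>
    simp only [List.length_cons] at hwm
    have := continuous_imageWord (m := m) v.length (fun z => hw' (p z))
      (fun j => (he' j).comp hp fun z _ => hA z) (fun z => hw (p z)) (he.comp hp fun z _ => hA z)
      (hs.comp_continuous hp hA) x [] (v.map fun y => (false, y)) (by simp) (by simp)
      (by
        intro y hy
        obtain ⟨q, -, rfl⟩ := List.mem_map.1 hy
        simp)
      (le_trans (Nat.cast_le.2 (by simp; omega)) hm) (Or.inl (by simpa using hwm))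
    simpa [Function.comp_def] using this

namespace AnMap

/-- The data that define the topology on the space of `A_n`-maps. -/
def toProd (f : AnMap n G G') : ℝ≥0 × ∀ m : {m : ℕ // (m : ℕ∞) < n},
    KMap ((Fin m.1 → ℝ≥0∞) × (Fin (m.1 + 1) → G)) G' :=
  (f.size, fun m => f.form m.1 m.2)

theorem continuous_toProd : Continuous (toProd : AnMap n G G' → _) := by
  let t : TopologicalSpace (AnMap n G G') := .induced toProd inferInstance
  have h : Continuous[t, _] (toProd : AnMap n G G' → _) := continuous_induced_dom
  exact continuous_le_dom (TopologicalSpace.generatedBy_le (X := KTest.{u}) (tY := t)) h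

theorem continuous_iff_toProd {K : Type u} [TopologicalSpace K] [CompactSpace K] [T2Space K]
    {F : K → AnMap n G G'} : Continuous F ↔ Continuous fun z => (F z).toProd := by
  refine ⟨fun h => continuous_toProd.comp h, fun h => ?_⟩
  let t : TopologicalSpace (AnMap n G G') := .induced toProd inferInstance
  have h' : Continuous[_, t] F := continuous_induced_rng.2 h
  refine continuous_iff_coinduced_le.2 ?_
  exact le_iSup₂ (f := fun (K : CompHaus.{u}) (f : @ContinuousMap K (AnMap n G G') _ t) =>
    TopologicalSpace.coinduced f inferInstance) (CompHaus.of K) (@ContinuousMap.mk K _ _ t F h')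

instance : IsGeneratedBy KTest.{u} (AnMap n G G') :=
  IsGeneratedBy.iff_le_generatedBy.2 <| by
    let t : TopologicalSpace (AnMap n G G') := .induced toProd inferInstance
    exact (TopologicalSpace.generatedBy_generatedBy (X := KTest.{u}) (AnMap n G G')).ge

theorem continuous_size : Continuous (size : AnMap n G G' → ℝ≥0) :=
  continuous_fst.comp continuous_toProd

/-- Continuity of a family of `A_n`-maps implies joint continuity on words. -/
theorem wordContOn {F : X → AnMap n G G'} {A : Set X} (hF : KContOn F A) (m : ℕ) :
    WordContOn m (fun x => (F x).eval) A := by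
  intro K _ _ _ p hp hA w _
  have hF' := hF K p hp hA
  cases w with
  | nil => exact continuous_const
  | cons x w =>
    by_cases h : (w.length : ℕ∞) < n
    · have h1 : Continuous fun z => (F (p z)).form w.length h :=
        (continuous_apply (⟨_, h⟩ : {m : ℕ // (m : ℕ∞) < n})).comp
          (continuous_snd.comp (continuous_toProd.comp hF'))
      refine (continuous_kMap_iff.1 h1 K (fun z => (z, fun j => w[j].1 z, fun j => (x :: w)[j].2 z))
        (by fun_prop)).congr fun z => ?_
      exact ((F (p z)).eval_eq h _ _ (by simp [evalWord]) (by simp [evalWord]) (by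
        intro j hj
        cases j <;> simp [evalWord])).symm
    · refine (continuous_const (y := (1 : G'))).congr fun z => ?_
      change (1 : G') = eval _ ((_, _) :: w.map _)
      rw [eval, dif_neg (by simpa using h)]

/-- A family of `A_n`-maps over a compact Hausdorff space is continuous if the sizes and, jointly,
the values on words are. -/
theorem continuous_of_wordContOn {K : Type u} [TopologicalSpace K] [CompactSpace K] [T2Space K]
    {F : K → AnMap n G G'} (hs : Continuous fun z => (F z).size)
    (h : ∀ m : ℕ, (m : ℕ∞) ≤ n → WordContOn m (fun z => (F z).eval) univ) : Continuous F := by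
  refine continuous_iff_toProd.2 (hs.prodMk (continuous_pi fun m => continuous_kMap_iff.2 ?_))
  refine (kContOn_univ.1 ((h (m.1 + 1) ?_).kContOn.mono fun _ _ => mem_univ _)).comp_continuous
    (g := fun z : K × (Fin m.1 → ℝ≥0∞) × (Fin (m.1 + 1) → G) => z) continuous_id |>.kContOn univ
    |>.congr (fun z _ => ?_) |> kContOn_univ.1
  · exact_mod_cast Order.add_one_le_of_lt m.2
  · exact ((F z.1).eval_word m.2 z.2.1 z.2.2).symm

/-- Composition of `A_n`-maps is jointly continuous, in the sense of compactly generated spaces. -/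
theorem kContOn_comp {F' : X → AnMap n G' G''} {F : X → AnMap n G G'} {A : Set X}
    (hF' : KContOn F' A) (hF : KContOn F A) : KContOn (fun x => (F' x).comp (F x)) A := by
  intro K _ _ _ p hp hA
  have h' := hF' K p hp hA
  have h := hF K p hp hA
  have hs := continuous_size.comp h
  refine continuous_of_wordContOn (hs.add (continuous_size.comp h')) fun m hm => ?_
  refine (WordContOn.imageWord hm (fun z => (F' (p z)).isWordMap)
    (fun j => wordContOn (h'.kCont.kContOn univ) j) (fun z => (F (p z)).isWordMap)
    (wordContOn (h.kCont.kContOn univ) m) hs.continuousOn).congr fun z _ w hw => ?_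
  exact eval_comp _ _ _ (le_trans (Nat.cast_le.2 hw) hm)

/-- A continuous map in the sense of compactly generated spaces, on a space of `A_n`-maps, is
continuous. -/
theorem continuous_of_kCont {Y : Type u} [TopologicalSpace Y] {P : AnMap n G G' → Y}
    (hP : KCont P) : Continuous P :=
  (IsGeneratedBy.continuous_iff (X := KTest.{u}) P).2 fun _ f => hP _ f f.continuous

theorem continuous_of_kCont_prod {Y : Type u} [TopologicalSpace Y] {P : AnMap n G G' × I → Y}
    (hP : KCont P) : Continuous P := by
  have hP' : ∀ f, Continuous fun t => P (f, t) := fun f =>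
    (hP.comp_continuous (g := fun t : I => (f, t)) (by fun_prop)).continuous
  have h : Continuous fun f => (⟨fun t => P (f, t), hP' f⟩ : C(I, Y)) := by
    refine continuous_of_kCont fun K _ _ _ p hp => ?_
    refine ContinuousMap.continuous_of_continuous_uncurry _ ?_
    exact hP (K × I) (fun z => (p z.1, z.2)) (by fun_prop)
  exact ContinuousMap.continuous_uncurry_of_continuous ⟨_, h⟩

/-- An `A_n`-map, with its size raised to at least `r`. -/
def raise (f : AnMap n G G') (r : ℝ≥0) : AnMap n G G' :=
  { f with
    size := max f.size r
    face_ge := fun p h k t ht => f.face_ge p h k t (le_trans (by simp) ht) }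

theorem eval_raise (f : AnMap n G G') (r : ℝ≥0) : (f.raise r).eval = f.eval := by
  funext w
  cases w <;> rfl

theorem raise_of_le (f : AnMap n G G') {r : ℝ≥0} (h : r ≤ f.size) : f.raise r = f :=
  ext_eval (max_eq_left h) fun w _ => by rw [eval_raise]

theorem kContOn_raise {F : X → AnMap n G G'} {r : X → ℝ≥0} {A : Set X} (hF : KContOn F A)
    (hr : ContinuousOn r A) : KContOn (fun x => (F x).raise (r x)) A := by
  intro K _ _ _ p hp hA
  have h := hF K p hp hA
  refine continuous_of_wordContOn ((continuous_size.comp h).max (hr.comp_continuous hp hA))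
    fun m _ => (wordContOn (h.kCont.kContOn univ) m).congr fun z _ w _ => by rw [eval_raise]

end AnMap

end WordContinuity

/-! ### Maps on words with prescribed values on irreducible words -/

section IrreducibleWords

variable {G G' : Type u} [Monoid G] [Monoid G']

/-- A word that none of the defining relations of an `A_n`-map of size `l` makes shorter. The
parameter of the first letter is normalized to `0`. -/
def IsIrreducibleWord (l : ℝ≥0) (w : List (ℝ≥0∞ × G)) : Prop :=
  ∃ (g : G) (v : List (ℝ≥0∞ × G)), w = (0, g) :: v ∧ g ≠ 1 ∧
    ∀ y ∈ v, y.1 ≠ 0 ∧ y.1 < l ∧ y.2 ≠ 1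

/-- On a word that is not irreducible, the value of a map on words is determined by its values on
shorter words. -/
theorem IsWordMap.eq_of_not_irreducible {n : ℕ∞} {l : ℝ≥0} {φ φ' : List (ℝ≥0∞ × G) → G'}
    (h : IsWordMap n l φ) (h' : IsWordMap n l φ') {t : ℝ≥0∞} {g : G} {v : List (ℝ≥0∞ × G)}
    (hwn : (((t, g) :: v).length : ℕ∞) ≤ n) (hirr : ¬ IsIrreducibleWord l ((0, g) :: v))
    (ih' : ∀ w : List (ℝ≥0∞ × G), w.length < ((t, g) :: v).length → φ w = φ' w) :
    φ ((t, g) :: v) = φ' ((t, g) :: v) := by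
  simp only [List.length_cons] at ih' hwn
  by_cases hg : g = 1
  · subst hg
    rcases v with _ | ⟨⟨t', b⟩, v⟩
    · rw [h.one, h'.one]
    · simp only [List.length_cons] at ih' hwn
      have hlen : ((([] : List (ℝ≥0∞ × G)).length + 2 + v.length : ℕ) : ℕ∞) ≤ n :=
        le_trans (Nat.cast_le.2 (by simp only [List.length_nil]; omega)) hwn
      have e := h.degen [] v t t' b hlen
      have e' := h'.degen [] v t t' b hlen
      simp only [List.nil_append] at e e'
      rw [e, e']
      exact ih' _ (by simp)
  · have : ∃ y ∈ v, y.1 = 0 ∨ (l : ℝ≥0∞) ≤ y.1 ∨ y.2 = 1 := by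
      by_contra hcon
      push Not at hcon
      exact hirr ⟨g, v, rfl, hg, hcon⟩
    obtain ⟨⟨s, b⟩, hy, hcase⟩ := this
    obtain ⟨v₁, v₂, rfl⟩ := List.append_of_mem hy
    simp only [List.length_append, List.length_cons] at ih' hwn
    rcases hcase with hs | hs | hb
    · dsimp only at hs
      subst hs
      obtain ⟨u, x, hu⟩ : ∃ u x, (t, g) :: v₁ = u ++ [x] := by
        rcases List.eq_nil_or_concat' ((t, g) :: v₁) with h0 | ⟨u, x, h0⟩
        · simp at h0
        · exact ⟨u, x, h0⟩
      have hul := congrArg List.length hu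
      simp only [List.length_append, List.length_cons, List.length_nil] at hul
      obtain ⟨s, c⟩ := x
      have e0 : (t, g) :: (v₁ ++ (0, b) :: v₂) = u ++ (s, c) :: (0, b) :: v₂ := by
        rw [← List.cons_append, hu]
        simp
      have hlen : ((u.length + 2 + v₂.length : ℕ) : ℕ∞) ≤ n :=
        le_trans (Nat.cast_le.2 (by omega)) hwn
      rw [e0, h.zero _ _ _ _ _ hlen, h'.zero _ _ _ _ _ hlen]
      exact ih' _ (by simp only [List.length_append, List.length_cons]; omega)
    · have hlen : ((((t, g) :: v₁).length + 1 + v₂.length : ℕ) : ℕ∞) ≤ n :=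
        le_trans (Nat.cast_le.2 (by simp only [List.length_cons]; omega)) hwn
      rw [← List.cons_append, h.mul _ _ _ _ hs hlen, h'.mul _ _ _ _ hs hlen,
        ih' _ (by simp only [List.length_cons]; omega),
        ih' _ (by simp only [List.length_cons]; omega)]
    · dsimp only at hb
      subst hb
      rw [← List.cons_append]
      rcases v₂ with _ | ⟨⟨t', b⟩, v₂⟩
      · have hlen : ((((t, g) :: v₁).length + 1 : ℕ) : ℕ∞) ≤ n :=
          le_trans (Nat.cast_le.2 (by simp)) hwn
        rw [h.degen_last _ _ hlen, h'.degen_last _ _ hlen]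
        exact ih' _ (by simp)
      · simp only [List.length_cons] at ih' hwn
        have hlen : ((((t, g) :: v₁).length + 2 + v₂.length : ℕ) : ℕ∞) ≤ n :=
          le_trans (Nat.cast_le.2 (by simp only [List.length_cons]; omega)) hwn
        rw [h.degen _ _ _ _ _ hlen, h'.degen _ _ _ _ _ hlen]
        exact ih' _ (by simp only [List.length_append, List.length_cons]; omega)

/-- Maps on words are determined by their values on irreducible words. -/
theorem IsWordMap.ext_irreducible {n : ℕ∞} {l : ℝ≥0} {φ φ' : List (ℝ≥0∞ × G) → G'}
    (h : IsWordMap n l φ) (h' : IsWordMap n l φ') {m : ℕ} (hm : (m : ℕ∞) ≤ n)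
    (hi : ∀ w, IsIrreducibleWord l w → w.length ≤ m → φ w = φ' w) (w : List (ℝ≥0∞ × G))
    (hw : w.length ≤ m) : φ w = φ' w := by
  induction hN : w.length using Nat.strong_induction_on generalizing w with
  | _ N ih =>
  subst hN
  rcases w with _ | ⟨⟨t, g⟩, v⟩
  · rw [h.nil, h'.nil]
  by_cases hirr : IsIrreducibleWord l ((0, g) :: v)
  · rw [h.head t 0, h'.head t 0]
    exact hi _ hirr (by simpa using hw)
  · exact h.eq_of_not_irreducible h' (le_trans (Nat.cast_le.2 hw) hm) hirr
      fun v hv => ih _ hv v (by omega) rfl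

open Classical in
/-- Merging of letters with parameter `0` with their predecessors, one step. -/
noncomputable def mergeStep (x : ℝ≥0∞ × G) : List (ℝ≥0∞ × G) → List (ℝ≥0∞ × G)
  | [] => [x]
  | y :: v => if y.1 = 0 then (x.1, x.2 * y.2) :: v else x :: y :: v

/-- Merging of all letters with parameter `0` with their predecessors. -/
noncomputable def mergeWord (w : List (ℝ≥0∞ × G)) : List (ℝ≥0∞ × G) := w.foldr mergeStep []

open Classical in
/-- Removal of unit letters, one step. -/
noncomputable def unitStep (x : ℝ≥0∞ × G) (w : List (ℝ≥0∞ × G)) : List (ℝ≥0∞ × G) :=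
  if x.2 = 1 then match w with
    | [] => []
    | y :: v => (max x.1 y.1, y.2) :: v
  else x :: w

/-- Removal of all unit letters. -/
noncomputable def unitWord (w : List (ℝ≥0∞ × G)) : List (ℝ≥0∞ × G) := w.foldr unitStep []

theorem mergeStep_of_ne {x y : ℝ≥0∞ × G} {v : List (ℝ≥0∞ × G)} (h : y.1 ≠ 0) :
    mergeStep x (y :: v) = x :: y :: v := if_neg h

theorem mergeStep_zero (x : ℝ≥0∞ × G) (b : G) (v : List (ℝ≥0∞ × G)) :
    mergeStep x ((0, b) :: v) = (x.1, x.2 * b) :: v := if_pos rfl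

theorem unitStep_of_ne {x : ℝ≥0∞ × G} {w : List (ℝ≥0∞ × G)} (h : x.2 ≠ 1) :
    unitStep x w = x :: w := if_neg h

theorem unitStep_one_nil (t : ℝ≥0∞) : unitStep (t, (1 : G)) [] = [] := if_pos rfl

theorem unitStep_one_cons (t : ℝ≥0∞) (y : ℝ≥0∞ × G) (v : List (ℝ≥0∞ × G)) :
    unitStep (t, (1 : G)) (y :: v) = (max t y.1, y.2) :: v := if_pos rfl

theorem unitStep_one_one (t t' : ℝ≥0∞) (w : List (ℝ≥0∞ × G)) :
    unitStep (t, (1 : G)) (unitStep (t', 1) w) = unitStep (max t t', 1) w := by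
  cases w with
  | nil => rw [unitStep_one_nil, unitStep_one_nil, unitStep_one_nil]
  | cons y v => rw [unitStep_one_cons, unitStep_one_cons, unitStep_one_cons, max_assoc]

theorem mergeStep_cons (x : ℝ≥0∞ × G) (w : List (ℝ≥0∞ × G)) :
    ∃ b v, ∀ t, mergeStep (t, x.2) w = (t, b) :: v := by
  cases w with
  | nil => exact ⟨x.2, [], fun t => rfl⟩
  | cons y w =>
    by_cases h : y.1 = 0
    · exact ⟨x.2 * y.2, w, fun t => if_pos h⟩
    · exact ⟨x.2, y :: w, fun t => if_neg h⟩

/-- Two suffixes of merged words with the same effect, up to the removal of units. -/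
def UnitRel (w w' : List (ℝ≥0∞ × G)) : Prop :=
  ∃ p v v' : List (ℝ≥0∞ × G), w = p ++ v ∧ w' = p ++ v' ∧ (∀ y ∈ v.head?, y.1 ≠ 0) ∧
    (∀ y ∈ v'.head?, y.1 ≠ 0) ∧ unitWord v = unitWord v'

theorem UnitRel.unitWord_eq {w w' : List (ℝ≥0∞ × G)} (h : UnitRel w w') :
    unitWord w = unitWord w' := by
  obtain ⟨p, v, v', rfl, rfl, -, -, h⟩ := h
  rw [unitWord, List.foldr_append, unitWord, List.foldr_append]
  exact congrArg (fun z => p.foldr unitStep z) h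

theorem UnitRel.mergeStep {w w' : List (ℝ≥0∞ × G)} (h : UnitRel w w') (x : ℝ≥0∞ × G) :
    UnitRel (mergeStep x w) (mergeStep x w') := by
  obtain ⟨p, v, v', rfl, rfl, hv, hv', h⟩ := h
  cases p with
  | nil =>
    refine ⟨[x], v, v', ?_, ?_, hv, hv', h⟩
    · cases v with
      | nil => rfl
      | cons y v => exact mergeStep_of_ne (hv y (by simp))
    · cases v' with
      | nil => rfl
      | cons y v => exact mergeStep_of_ne (hv' y (by simp))
  | cons y p =>
    by_cases hy : y.1 = 0
    · exact ⟨(x.1, x.2 * y.2) :: p, v, v', if_pos hy, if_pos hy, hv, hv', h⟩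
    · exact ⟨x :: y :: p, v, v', if_neg hy, if_neg hy, hv, hv', h⟩

theorem UnitRel.refl (w : List (ℝ≥0∞ × G)) : UnitRel w w :=
  ⟨w, [], [], by simp, by simp, by simp, by simp, rfl⟩

theorem UnitRel.foldr {w w' : List (ℝ≥0∞ × G)} (h : UnitRel w w') (u : List (ℝ≥0∞ × G)) :
    UnitRel (u.foldr _root_.mergeStep w) (u.foldr _root_.mergeStep w') := by
  induction u with
  | nil => exact h
  | cons x u ih => exact ih.mergeStep x

theorem unitWord_merge_append {v v' : List (ℝ≥0∞ × G)} (h : UnitRel (mergeWord v) (mergeWord v'))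
    (u : List (ℝ≥0∞ × G)) : unitWord (mergeWord (u ++ v)) = unitWord (mergeWord (u ++ v')) := by
  rw [mergeWord, mergeWord, List.foldr_append, List.foldr_append]
  exact (h.foldr u).unitWord_eq

theorem mergeWord_zero (t : ℝ≥0∞) (c b : G) (v : List (ℝ≥0∞ × G)) :
    mergeWord ((t, c) :: (0, b) :: v) = mergeWord ((t, c * b) :: v) := by
  change mergeStep (t, c) (mergeStep (0, b) (mergeWord v)) = mergeStep (t, c * b) (mergeWord v)
  cases mergeWord v with
  | nil => exact mergeStep_zero _ _ _
  | cons y w =>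
    by_cases h : y.1 = 0
    · obtain ⟨_, a⟩ := y
      dsimp only at h
      subst h
      rw [mergeStep_zero, mergeStep_zero, mergeStep_zero, mul_assoc]
    · rw [mergeStep_of_ne h, mergeStep_of_ne h, mergeStep_zero]

/-- A unit letter can be merged with its successor. -/
theorem unitWord_mergeWord_degen (u v : List (ℝ≥0∞ × G)) (t t' : ℝ≥0∞) (b : G) :
    unitWord (mergeWord (u ++ (t, 1) :: (t', b) :: v)) =
      unitWord (mergeWord (u ++ (max t t', b) :: v)) := by
  obtain ⟨b', v', hb⟩ := mergeStep_cons (0, b) (mergeWord v)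
  have e1 : ∀ s, mergeWord ((s, b) :: v) = (s, b') :: v' := hb
  by_cases ht' : t' = 0
  · subst ht'
    rw [max_eq_left (by simp)]
    refine unitWord_merge_append ?_ u
    rw [mergeWord_zero, one_mul]
    exact .refl _
  · have e2 : mergeWord ((t, 1) :: (t', b) :: v) = (t, 1) :: (t', b') :: v' := by
      change mergeStep (t, 1) (mergeWord ((t', b) :: v)) = _
      rw [e1, mergeStep_of_ne ht']
    have e3 : unitWord ((t, 1) :: (t', b') :: v') = unitWord ((max t t', b') :: v') := by
      change unitStep (t, 1) (unitStep (t', b') (unitWord v')) =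
        unitStep (max t t', b') (unitWord v')
      by_cases hb' : b' = 1
      · rw [hb', unitStep_one_one]
      · rw [unitStep_of_ne (x := (t', b')) hb', unitStep_one_cons,
          unitStep_of_ne (x := (max t t', b')) hb']
    by_cases ht : t = 0
    · subst ht
      rw [max_eq_right (by simp)] at e3 ⊢
      rcases List.eq_nil_or_concat' u with rfl | ⟨u, ⟨s, c⟩, rfl⟩
      · rw [List.nil_append, List.nil_append, e2, e1, e3]
      · rw [List.append_assoc, List.append_assoc]
        refine unitWord_merge_append ?_ u
        have e4 : mergeWord ([(s, c)] ++ (0, 1) :: (t', b) :: v) = (s, c) :: (t', b') :: v' := by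
          change mergeStep (s, c) (mergeWord ((0, 1) :: (t', b) :: v)) = _
          rw [e2, mergeStep_zero, mul_one]
        have e5 : mergeWord ([(s, c)] ++ (t', b) :: v) = (s, c) :: (t', b') :: v' := by
          change mergeStep (s, c) (mergeWord ((t', b) :: v)) = _
          rw [e1, mergeStep_of_ne ht']
        rw [e4, e5]
        exact .refl _
    · refine unitWord_merge_append ?_ u
      rw [e1, e2]
      exact ⟨[], _, _, rfl, rfl, by simpa using ht, by simpa using fun h => (ht h).elim, e3⟩

theorem unitWord_mergeWord_degen_last (u : List (ℝ≥0∞ × G)) (t : ℝ≥0∞) :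
    unitWord (mergeWord (u ++ [(t, 1)])) = unitWord (mergeWord u) := by
  have e1 : mergeWord [(t, (1 : G))] = [(t, 1)] := rfl
  have e2 : unitWord [(t, (1 : G))] = [] := unitStep_one_nil t
  by_cases ht : t = 0
  · subst ht
    rcases List.eq_nil_or_concat' u with rfl | ⟨u, ⟨s, c⟩, rfl⟩
    · exact e2
    · rw [List.append_assoc]
      refine unitWord_merge_append ?_ u
      have e4 : mergeWord ([(s, c)] ++ [(0, 1)]) = [(s, c)] := by
        change mergeStep (s, c) [(0, 1)] = _
        rw [mergeStep_zero, mul_one]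
      rw [e4]
      exact .refl _
  · have := unitWord_merge_append (v := [(t, 1)]) (v' := []) ?_ u
    · simpa using this
    · exact ⟨[], _, _, rfl, rfl, by simpa using ht, by simp, e2⟩

theorem mergeWord_append {v : List (ℝ≥0∞ × G)} {t : ℝ≥0∞} (ht : t ≠ 0) (b : G)
    (u : List (ℝ≥0∞ × G)) : mergeWord (u ++ (t, b) :: v) = mergeWord u ++ mergeWord ((t, b) :: v) := by
  obtain ⟨b', v', hb⟩ := mergeStep_cons (0, b) (mergeWord v)
  have e1 : mergeWord ((t, b) :: v) = (t, b') :: v' := hb t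
  induction u with
  | nil => rfl
  | cons x u ih =>
    change mergeStep x (mergeWord (u ++ (t, b) :: v)) = mergeStep x (mergeWord u) ++ _
    rw [ih]
    cases mergeWord u with
    | nil => rw [e1]; exact mergeStep_of_ne ht
    | cons y w =>
      by_cases h : y.1 = 0
      · simp [mergeStep, h]
      · simp [mergeStep, h]

theorem unitWord_append_of_nil {p q : List (ℝ≥0∞ × G)} (h : unitWord q = []) :
    unitWord (p ++ q) = unitWord p := by
  rw [unitWord, List.foldr_append]
  exact congrArg (fun z => p.foldr unitStep z) h

/-- Unit letters at the end of the first word can only raise the parameter of the next letter. -/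
theorem unitWord_append_of_cons {p q r : List (ℝ≥0∞ × G)} {t : ℝ≥0∞} {b : G}
    (h : unitWord q = (t, b) :: r) :
    ∃ t', t ≤ t' ∧ unitWord (p ++ q) = unitWord p ++ (t', b) :: r := by
  induction p with
  | nil => exact ⟨t, le_rfl, h⟩
  | cons x p ih =>
    obtain ⟨t', ht', e⟩ := ih
    change ∃ t', t ≤ t' ∧ unitStep x (unitWord (p ++ q)) = unitStep x (unitWord p) ++ (t', b) :: r
    rw [e]
    obtain ⟨s, a⟩ := x
    by_cases ha : a = 1
    · subst ha
      cases unitWord p with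
      | nil =>
        exact ⟨max s t', ht'.trans (le_max_right _ _), by
          rw [List.nil_append, unitStep_one_cons, unitStep_one_nil]; rfl⟩
      | cons y w =>
        exact ⟨t', ht', by rw [List.cons_append, unitStep_one_cons, unitStep_one_cons]; rfl⟩
    · exact ⟨t', ht', by rw [unitStep_of_ne ha, unitStep_of_ne ha]; rfl⟩

end IrreducibleWords

section Blocks

variable {G G' : Type u} [Monoid G']

/-- The value of a block, for prescribed values `U`. -/
noncomputable def blockValue (U : List (ℝ≥0∞ × G) → G') : List (ℝ≥0∞ × G) → G'
  | [] => 1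
  | x :: v => U ((0, x.2) :: v)

open Classical in
/-- One step of the decomposition into blocks, which are cut off in front of the letters with
parameters at least `l`. -/
noncomputable def blockStep (l : ℝ≥0) (U : List (ℝ≥0∞ × G) → G') (x : ℝ≥0∞ × G)
    (s : List (ℝ≥0∞ × G) × G') : List (ℝ≥0∞ × G) × G' :=
  if (l : ℝ≥0∞) ≤ x.1 then ([], blockValue U (x :: s.1) * s.2) else (x :: s.1, s.2)

/-- The product of the values of the blocks of a word. -/
noncomputable def blockProd (l : ℝ≥0) (U : List (ℝ≥0∞ × G) → G') (w : List (ℝ≥0∞ × G)) : G' :=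
  blockValue U (w.foldr (blockStep l U) ([], 1)).1 * (w.foldr (blockStep l U) ([], 1)).2

theorem foldr_blockStep (l : ℝ≥0) (U : List (ℝ≥0∞ × G) → G') (w : List (ℝ≥0∞ × G)) (c : G') :
    w.foldr (blockStep l U) ([], c) = ((w.foldr (blockStep l U) ([], 1)).1,
      (w.foldr (blockStep l U) ([], 1)).2 * c) := by
  induction w with
  | nil => simp
  | cons x w ih =>
    rw [List.foldr_cons, ih, List.foldr_cons, blockStep, blockStep]
    split <;> simp [mul_assoc]

theorem blockProd_head (l : ℝ≥0) (U : List (ℝ≥0∞ × G) → G') (t : ℝ≥0∞) (a : G)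
    (v : List (ℝ≥0∞ × G)) : blockProd l U ((t, a) :: v) =
      U ((0, a) :: (v.foldr (blockStep l U) ([], 1)).1) *
        (v.foldr (blockStep l U) ([], 1)).2 := by
  rw [blockProd, List.foldr_cons, blockStep]
  split <;> simp [blockValue]

theorem blockProd_append {l : ℝ≥0} (U : List (ℝ≥0∞ × G) → G') (u v : List (ℝ≥0∞ × G)) {t : ℝ≥0∞}
    (ht : (l : ℝ≥0∞) ≤ t) (b : G) :
    blockProd l U (u ++ (t, b) :: v) = blockProd l U u * blockProd l U ((t, b) :: v) := by
  have e : ((t, b) :: v).foldr (blockStep l U) ([], 1) = ([], blockProd l U ((t, b) :: v)) := by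
    rw [blockProd_head, List.foldr_cons, blockStep, if_pos ht, blockValue]
  rw [blockProd, List.foldr_append, e, foldr_blockStep, ← mul_assoc]
  rfl

end Blocks

section Extension

variable {G G' : Type u} [Monoid G] [Monoid G']

/-- The map on words with given values on irreducible words: merge the letters with parameter `0`
with their predecessors, remove the units, cut into blocks, and multiply the values of the
blocks. -/
noncomputable def extendWord (l : ℝ≥0) (U : List (ℝ≥0∞ × G) → G') (w : List (ℝ≥0∞ × G)) : G' :=
  blockProd l U (unitWord (mergeWord w))

/-- All values of `U` on irreducible words can be prescribed: the normal form of a word is unchanged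
by the relations, and its blocks are multiplied. -/
theorem isWordMap_extendWord {l : ℝ≥0} (hl : 0 < l) (U : List (ℝ≥0∞ × G) → G') (n : ℕ∞) :
    IsWordMap n l (extendWord l U) where
  nil := by simp [extendWord, mergeWord, unitWord, blockProd, blockValue]
  head t t' a v := by
    obtain ⟨b', v', hb⟩ := mergeStep_cons (0, a) (mergeWord v)
    have e1 : ∀ s, mergeWord ((s, a) :: v) = (s, b') :: v' := hb
    rw [extendWord, extendWord, e1, e1]
    change blockProd l U (unitStep (t, b') (unitWord v')) =
      blockProd l U (unitStep (t', b') (unitWord v'))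
    by_cases hb' : b' = 1
    · rw [hb']
      cases unitWord v' with
      | nil => rw [unitStep_one_nil, unitStep_one_nil]
      | cons y v => rw [unitStep_one_cons, unitStep_one_cons, blockProd_head, blockProd_head]
    · rw [unitStep_of_ne (x := (t, b')) hb', unitStep_of_ne (x := (t', b')) hb', blockProd_head,
        blockProd_head]
  one t := by
    have : unitWord (mergeWord [(t, (1 : G))]) = [] := unitStep_one_nil t
    rw [extendWord, this]
    simp [blockProd, blockValue]
  zero u v t c b _ := by
    rw [extendWord, extendWord, unitWord_merge_append _ u]
    rw [mergeWord_zero]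
    exact .refl _
  mul u v t b ht _ := by
    have ht0 : t ≠ 0 := fun h => by
      rw [h] at ht
      exact hl.ne' (by simpa using ht)
    obtain ⟨b', v', hb⟩ := mergeStep_cons (0, b) (mergeWord v)
    have e1 : mergeWord ((t, b) :: v) = (t, b') :: v' := hb t
    simp only [extendWord]
    rw [mergeWord_append ht0]
    have hcase : unitWord (mergeWord ((t, b) :: v)) = [] ∨
        ∃ s c r, t ≤ s ∧ unitWord (mergeWord ((t, b) :: v)) = (s, c) :: r := by
      rw [e1]
      change unitStep (t, b') (unitWord v') = [] ∨
        ∃ s c r, t ≤ s ∧ unitStep (t, b') (unitWord v') = (s, c) :: r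
      by_cases hb' : b' = 1
      · rw [hb']
        cases unitWord v' with
        | nil => exact Or.inl (unitStep_one_nil t)
        | cons y r => exact Or.inr ⟨_, _, r, le_max_left _ _, unitStep_one_cons _ _ _⟩
      · exact Or.inr ⟨_, _, _, le_rfl, unitStep_of_ne hb'⟩
    rcases hcase with h | ⟨s, c, r, hs, h⟩
    · rw [unitWord_append_of_nil h, h]
      simp [blockProd, blockValue]
    · obtain ⟨s', hs', e⟩ := unitWord_append_of_cons (p := mergeWord u) h
      rw [e, h, blockProd_append _ _ _ (ht.trans (hs.trans hs')), blockProd_head,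
        blockProd_head]
  degen u v t t' b _ := by rw [extendWord, extendWord, unitWord_mergeWord_degen]
  degen_last u t _ := by rw [extendWord, extendWord, unitWord_mergeWord_degen_last]

theorem extendWord_eq {l : ℝ≥0} (U : List (ℝ≥0∞ × G) → G') {w : List (ℝ≥0∞ × G)}
    (hw : IsIrreducibleWord l w) : extendWord l U w = U w := by
  obtain ⟨g, v, rfl, hg, hv⟩ := hw
  have e1 : ∀ v : List (ℝ≥0∞ × G), (∀ y ∈ v, y.1 ≠ 0 ∧ y.1 < l ∧ y.2 ≠ 1) →
      mergeWord v = v ∧ unitWord v = v ∧ v.foldr (blockStep l U) ([], 1) = (v, 1) := by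
    intro v
    induction v with
    | nil => exact fun _ => ⟨rfl, rfl, rfl⟩
    | cons y v ih =>
      intro hv
      obtain ⟨h1, h2, h3⟩ := ih fun z hz => hv z (by simp [hz])
      obtain ⟨hy0, hyl, hy1⟩ := hv y (by simp)
      refine ⟨?_, ?_, ?_⟩
      · change mergeStep y (mergeWord v) = _
        rw [h1]
        cases v with
        | nil => rfl
        | cons z v => exact mergeStep_of_ne (hv z (by simp)).1
      · change unitStep y (unitWord v) = _
        rw [h2, unitStep_of_ne hy1]
      · rw [List.foldr_cons, h3, blockStep, if_neg (not_le.2 hyl)]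
  obtain ⟨h1, h2, h3⟩ := e1 v hv
  have e2 : mergeWord ((0, g) :: v) = (0, g) :: v := by
    change mergeStep (0, g) (mergeWord v) = _
    rw [h1]
    cases v with
    | nil => rfl
    | cons z v => exact mergeStep_of_ne (hv z (by simp)).1
  have e3 : unitWord ((0, g) :: v) = (0, g) :: v := by
    change unitStep (0, g) (unitWord v) = _
    rw [h2, unitStep_of_ne hg]
  rw [extendWord, e2, e3, blockProd_head, h3, mul_one]

end Extension

/-! ### Extension of families of maps on words to longer words -/

section Parameters

/-- The parameter of a point of the unit interval, for the size `l`. -/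
noncomputable def scaleParam (l : ℝ≥0) (τ : I) : ℝ≥0∞ := ENNReal.ofReal (l * τ)

/-- The point of the unit interval given by a parameter, for the size `l`. -/
noncomputable def clipParam (l : ℝ≥0) (t : ℝ≥0∞) : I :=
  projIcc 0 1 zero_le_one ((min t l).toReal / l)

theorem continuous_scaleParam (l : ℝ≥0) : Continuous (scaleParam l) :=
  ENNReal.continuous_ofReal.comp (by fun_prop)

theorem continuous_clipParam (l : ℝ≥0) : Continuous (clipParam l) := by
  refine continuous_projIcc.comp (Continuous.div_const ?_ _)
  exact ENNReal.continuousOn_toReal.comp_continuous (by fun_prop)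
    fun t => ((min_le_right t (l : ℝ≥0∞)).trans_lt ENNReal.coe_lt_top).ne

variable {l : ℝ≥0}

theorem clipParam_mem (hl : 0 < l) (t : ℝ≥0∞) : ((clipParam l t : I) : ℝ) = (min t l).toReal / l := by
  have h1 : (min t (l : ℝ≥0∞)).toReal ≤ l := by
    have := ENNReal.toReal_mono ENNReal.coe_ne_top (min_le_right t (l : ℝ≥0∞))
    simpa using this
  rw [clipParam, projIcc_of_mem zero_le_one ⟨by positivity, div_le_one_of_le₀ h1 l.2⟩]

theorem scaleParam_clipParam (hl : 0 < l) (t : ℝ≥0∞) : scaleParam l (clipParam l t) = min t l := by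
  have h0 : (l : ℝ) ≠ 0 := by exact_mod_cast hl.ne'
  rw [scaleParam, clipParam_mem hl, mul_div_cancel₀ _ h0, ENNReal.ofReal_toReal]
  exact ((min_le_right t (l : ℝ≥0∞)).trans_lt ENNReal.coe_lt_top).ne

theorem clipParam_scaleParam (hl : 0 < l) (τ : I) : clipParam l (scaleParam l τ) = τ := by
  have h0 : (l : ℝ) ≠ 0 := by exact_mod_cast hl.ne'
  have h1 : scaleParam l τ ≤ l := by
    rw [scaleParam, ← ENNReal.ofReal_coe_nnreal]
    exact ENNReal.ofReal_le_ofReal (mul_le_of_le_one_right l.2 τ.2.2)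
  refine Subtype.ext ?_
  rw [clipParam_mem hl, min_eq_left h1, scaleParam, ENNReal.toReal_ofReal
    (mul_nonneg (NNReal.coe_nonneg l) τ.2.1), mul_div_cancel_left₀ _ h0]

theorem clipParam_zero (hl : 0 < l) : clipParam l 0 = 0 :=
  Subtype.ext (by rw [clipParam_mem hl]; simp)

theorem clipParam_of_le (hl : 0 < l) {t : ℝ≥0∞} (h : (l : ℝ≥0∞) ≤ t) : clipParam l t = 1 := by
  have h0 : (l : ℝ) ≠ 0 := by exact_mod_cast hl.ne'
  exact Subtype.ext (by rw [clipParam_mem hl, min_eq_right h]; simp [h0])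

end Parameters

theorem scaleParam_zero (l : ℝ≥0) : scaleParam l 0 = 0 := by simp [scaleParam]

theorem scaleParam_one (l : ℝ≥0) : scaleParam l 1 = l := by simp [scaleParam]

theorem scaleParam_le (l : ℝ≥0) (τ : I) : scaleParam l τ ≤ l := by
  rw [scaleParam, ← ENNReal.ofReal_coe_nnreal]
  exact ENNReal.ofReal_le_ofReal (mul_le_of_le_one_right l.2 τ.2.2)

section Truncation

variable {n : ℕ∞} {G G' : Type u} [Monoid G] [Monoid G'] {l : ℝ≥0} {φ : List (ℝ≥0∞ × G) → G'}

/-- Parameters may be lowered to the size. -/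
theorem IsWordMap.map_min (h : IsWordMap n l φ) (v : List (ℝ≥0∞ × G)) :
    ∀ u : List (ℝ≥0∞ × G), ((u.length + v.length : ℕ) : ℕ∞) ≤ n →
      φ (u ++ v.map fun q => (min q.1 (l : ℝ≥0∞), q.2)) = φ (u ++ v) := by
  induction v with
  | nil => simp
  | cons q v ih =>
    intro u hn
    simp only [List.length_cons] at hn
    have e1 := ih (u ++ [(min q.1 (l : ℝ≥0∞), q.2)]) (le_trans (Nat.cast_le.2 (by
      simp only [List.length_append, List.length_cons, List.length_nil]; omega)) hn)
    simp only [List.append_assoc, List.singleton_append] at e1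
    rw [List.map_cons, e1]
    rcases le_total q.1 (l : ℝ≥0∞) with hq | hq
    · rw [min_eq_left hq]
    · have hn' : ((u.length + 1 + v.length : ℕ) : ℕ∞) ≤ n :=
        le_trans (Nat.cast_le.2 (by omega)) hn
      rw [min_eq_right hq, h.mul u v l q.2 le_rfl hn', h.head l q.1]
      exact (h.mul u v q.1 q.2 hq hn').symm

theorem IsWordMap.word_clip (h : IsWordMap n l φ) (hl : 0 < l) {m : ℕ} (hm : ((m + 1 : ℕ) : ℕ∞) ≤ n)
    (T : Fin m → ℝ≥0∞) (g : Fin (m + 1) → G) :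
    φ (AnMap.word (fun j => scaleParam l (clipParam l (T j))) g) = φ (AnMap.word T g) := by
  have := h.map_min (List.ofFn fun j => (T j, g j.succ)) [(0, g 0)]
    (by simpa [add_comm] using hm)
  simpa [AnMap.word, scaleParam_clipParam hl, List.map_ofFn, Function.comp_def] using this

theorem AnMap.isIrreducibleWord_word {m : ℕ} (T : Fin m → ℝ≥0∞) (g : Fin (m + 1) → G)
    (h : ¬ IsIrreducibleWord l (AnMap.word T g)) :
    (∃ j, T j = 0 ∨ (l : ℝ≥0∞) ≤ T j) ∨ ∃ i, g i = 1 := by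
  by_contra hcon
  push Not at hcon
  refine h ⟨g 0, _, rfl, hcon.2 0, fun y hy => ?_⟩
  obtain ⟨j, rfl⟩ := (List.mem_ofFn' _ _).1 hy
  exact ⟨(hcon.1 j).1, (hcon.1 j).2, hcon.2 _⟩

end Truncation

section FamilyExtension

variable {n : ℕ∞} {G G' : Type u} [Monoid G] [Monoid G'] [TopologicalSpace G] [TopologicalSpace G']
  {X : Type v} [TopologicalSpace X] {l : ℝ≥0}

/-- A family of maps on words that is continuous on words of length at most `m` can be changed on
longer words, with prescribed continuous values on the words of length `m + 1`, provided that the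
values are the old ones where they are determined by shorter words. Nothing is changed over the
points of `B`. -/
theorem WordContOn.exists_extension {m : ℕ} (hm : ((m + 1 : ℕ) : ℕ∞) ≤ n) (hl : 0 < l)
    {e : X → List (ℝ≥0∞ × G) → G'} (he : ∀ x, IsWordMap n l (e x)) (hc : WordContOn m e univ)
    (B : Set X) (y : X × (Fin m → I) × (Fin (m + 1) → G) → G') (hy : KCont y)
    (hye : ∀ x τ g, (x ∈ B ∨ τ ∈ Cube.boundary (Fin m) ∨ ∃ i, g i = 1) →
      y (x, τ, g) = e x (AnMap.word (fun j => scaleParam l (τ j)) g)) :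
    ∃ e' : X → List (ℝ≥0∞ × G) → G', (∀ x, IsWordMap n l (e' x)) ∧ (∀ x ∈ B, e' x = e x) ∧
      (∀ x w, w.length ≤ m → e' x w = e x w) ∧
      (∀ x τ g, e' x (AnMap.word (fun j => scaleParam l (τ j)) g) = y (x, τ, g)) ∧
      WordContOn (m + 1) e' univ := by
  classical
  let U : X → List (ℝ≥0∞ × G) → G' := fun x w => if w.length ≤ m then e x w else
    if h : w.length = m + 1 then
      y (x, fun j => clipParam l (w[(j : ℕ) + 1]'(by omega)).1, fun j => (w[(j : ℕ)]'(by omega)).2)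
    else 1
  let e' : X → List (ℝ≥0∞ × G) → G' := fun x => if x ∈ B then e x else extendWord l (U x)
  have h1 : ∀ x, IsWordMap n l (e' x) := fun x => by
    by_cases hx : x ∈ B
    · simpa only [e', if_pos hx] using he x
    · simpa only [e', if_neg hx] using isWordMap_extendWord hl (U x) n
  have h2 : ∀ x ∈ B, e' x = e x := fun x hx => if_pos hx
  have h3 : ∀ x w, w.length ≤ m → e' x w = e x w := by
    intro x w hw
    by_cases hx : x ∈ B
    · rw [h2 x hx]
    · refine (h1 x).ext_irreducible (he x) (le_trans (Nat.cast_le.2 m.le_succ) hm)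
        (fun w hw hwm => ?_) w hw
      simp only [e', if_neg hx]
      rw [extendWord_eq _ hw]
      exact if_pos hwm
  have h4 : ∀ x T g, e' x (AnMap.word T g) = y (x, fun j => clipParam l (T j), g) := by
    intro x T g
    by_cases hd : x ∈ B ∨ (fun j => clipParam l (T j)) ∈ Cube.boundary (Fin m) ∨ ∃ i, g i = 1
    · rw [hye _ _ _ hd, (he x).word_clip hl hm]
      by_cases hx : x ∈ B
      · rw [h2 x hx]
      · by_cases hirr : IsIrreducibleWord l (AnMap.word T g)
        · simp only [e', if_neg hx]
          rw [extendWord_eq _ hirr]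
          simp only [U, AnMap.length_word, add_le_iff_nonpos_right, nonpos_iff_eq_zero, one_ne_zero,
            if_false, dif_pos, AnMap.getElem_word]
          have e1 := hye _ _ _ hd
          rw [(he x).word_clip hl hm] at e1
          simpa using e1
        · refine (h1 x).eq_of_not_irreducible (he x) ?_ hirr fun w hw => h3 x w ?_
          · simpa using hm
          · simp at hw
            omega
    · push Not at hd
      simp only [e', if_neg hd.1]
      have hirr : IsIrreducibleWord l (AnMap.word T g) := by
        by_contra hcon
        rcases AnMap.isIrreducibleWord_word T g hcon with ⟨j, hj | hj⟩ | ⟨i, hi⟩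
        · exact hd.2.1 ⟨j, Or.inl (by simp only [hj, clipParam_zero hl])⟩
        · exact hd.2.1 ⟨j, Or.inr (clipParam_of_le hl hj)⟩
        · exact hd.2.2 i hi
      rw [extendWord_eq _ hirr]
      simp only [U, AnMap.length_word, add_le_iff_nonpos_right, nonpos_iff_eq_zero, one_ne_zero,
        if_false, dif_pos, AnMap.getElem_word]
      simp
  refine ⟨e', h1, h2, h3, fun x τ g => ?_, ?_⟩
  · rw [h4]
    simp only [clipParam_scaleParam hl]
  · intro K _ _ _ p hp hA w hw
    rcases hw.lt_or_eq with hw | hw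
    · exact (hc K p hp hA w (by omega)).congr fun z =>
        (h3 _ _ (by rw [length_evalWord]; omega)).symm
    · cases w with
      | nil => simp at hw
      | cons q w =>
        obtain rfl : w.length = m := by simpa using hw
        refine (hy K (fun z => (p z, fun j => clipParam l (w[j].1 z),
          fun j => (q :: w)[j].2 z)) ?_).congr fun z => ?_
        · refine hp.prodMk (Continuous.prodMk ?_ (by fun_prop))
          exact continuous_pi fun j => (continuous_clipParam l).comp (map_continuous _)
        · rw [← h4 (p z) (fun j => w[j].1 z) (fun j => (q :: w)[j].2 z)]
          change e' (p z) (AnMap.word _ _) = e' (p z) ((q.1 z, q.2 z) :: evalWord w z)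
          rw [(h1 _).head (q.1 z) 0]
          congr 1
          rw [AnMap.word]
          congr 1
          refine List.ext_getElem (by simp [evalWord]) fun j _ _ => ?_
          simp [evalWord]

end FamilyExtension

/-! ### Continuity where shorter words determine the values -/

section BoundaryContinuity

variable {n : ℕ∞} {G G' : Type u} [Monoid G] [Monoid G'] [TopologicalSpace G] [TopologicalSpace G']

theorem continuous_mul_of_cgMonoid [CGMonoid G] {K : Type u} [TopologicalSpace K] [CompactSpace K]
    [T2Space K] {a b : K → G} (ha : Continuous a) (hb : Continuous b) :
    Continuous fun z => a z * b z :=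
  CGMonoid.continuous_mul (G := G) (i := CompHaus.of K) ⟨fun z => (a z, b z), ha.prodMk hb⟩

variable {X : Type v} [TopologicalSpace X] {l : ℝ≥0}

/-- A family of maps on words that is continuous on words of length at most `m` is continuous on
those words of length `m + 1` on which the values are determined by shorter words. -/
theorem WordContOn.kContOn_boundary [CGMonoid G] [CGMonoid G'] {m : ℕ}
    (hm : ((m + 1 : ℕ) : ℕ∞) ≤ n) {e : X → List (ℝ≥0∞ × G) → G'}
    (he : ∀ x, IsWordMap n l (e x)) {A : Set X} (hc : WordContOn m e A) :
    KContOn (fun z : X × (Fin m → ℝ≥0∞) × (Fin (m + 1) → G) => e z.1 (AnMap.word z.2.1 z.2.2))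
      {z | z.1 ∈ A ∧ ((∃ j, z.2.1 j = 0) ∨ (∃ j, (l : ℝ≥0∞) ≤ z.2.1 j) ∨ ∃ i, z.2.2 i = 1)} := by
  intro K _ _ _ p hp hA
  have hg1 : IsClosed ({1} : Set G) :=
    have := CGMonoid.weakHausdorff (G := G)
    isClosed_singleton_of_weakHausdorff 1
  have hT : ∀ j, Continuous fun z => (p z).2.1 j := fun j => by fun_prop
  have hg : ∀ i, Continuous fun z => (p z).2.2 i := fun i => by fun_prop
  let C : Fin m ⊕ Fin m ⊕ Fin (m + 1) → Set K := fun s => match s with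
    | .inl j => {z | (p z).2.1 j = 0}
    | .inr (.inl j) => {z | (l : ℝ≥0∞) ≤ (p z).2.1 j}
    | .inr (.inr i) => {z | (p z).2.2 i = 1}
  have hC : ∀ s, IsClosed (C s) := by
    rintro (j | j | i)
    · exact isClosed_eq (hT j) continuous_const
    · exact isClosed_le continuous_const (hT j)
    · exact hg1.preimage (hg i)
  refine continuous_of_finite_closed_cover hC (fun z => ?_) fun s => ?_
  · rcases (hA z).2 with ⟨j, hj⟩ | ⟨j, hj⟩ | ⟨i, hi⟩
    · exact ⟨.inl j, hj⟩
    · exact ⟨.inr (.inl j), hj⟩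
    · exact ⟨.inr (.inr i), hi⟩
  · have := isCompact_iff_compactSpace.1 (hC s).isCompact
    let x : C(C s, ℝ≥0∞) × C(C s, G) := (⟨fun _ => 0, continuous_const⟩,
      ⟨fun z => (p z).2.2 0, (hg 0).comp continuous_subtype_val⟩)
    let r : Fin m → C(C s, ℝ≥0∞) × C(C s, G) := fun j =>
      (⟨fun z => (p z).2.1 j, (hT j).comp continuous_subtype_val⟩,
        ⟨fun z => (p z).2.2 j.succ, (hg j.succ).comp continuous_subtype_val⟩)
    have hW : ∀ z : C s, AnMap.word (p z).2.1 (p z).2.2 = evalWord (x :: List.ofFn r) z := by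
      intro z
      simp [evalWord, AnMap.word, x, r, List.map_ofFn, Function.comp_def]
    simp only [hW]
    have hp' : Continuous fun z : C s => (p z).1 :=
      continuous_fst.comp (hp.comp continuous_subtype_val)
    have hc' := hc (C s) (fun z => (p z).1) hp' fun z => (hA z).1
    have hlen : (x :: List.ofFn r).length = m + 1 := by simp
    have hunit : ∀ y ∈ x :: List.ofFn r, (∀ z, y.2 z = 1) →
        Continuous fun z : C s => e (p z).1 (evalWord (x :: List.ofFn r) z) := by
      intro y hy hy1
      obtain ⟨u, v, hw⟩ := List.append_of_mem hy
      rw [hw] at hlen ⊢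
      simp only [List.length_append, List.length_cons] at hlen
      rcases v with _ | ⟨y', v⟩
      · refine (hc' u (by simp at hlen; omega)).congr fun z => ?_
        have := (he (p z).1).degen_last (evalWord u z) (y.1 z)
          (by
            rw [length_evalWord]
            exact le_trans (Nat.cast_le.2 (by simp at hlen; omega)) hm)
        simpa [evalWord, hy1 z] using this.symm
      · simp only [List.length_cons] at hlen
        refine (hc' (u ++ (⟨fun z => max (y.1 z) (y'.1 z), by fun_prop⟩, y'.2) :: v) (by
          simp only [List.length_append, List.length_cons]; omega)).congr fun z => ?_
        have := (he (p z).1).degen (evalWord u z) (evalWord v z) (y.1 z) (y'.1 z) (y'.2 z)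
          (le_trans (Nat.cast_le.2 (by rw [length_evalWord, length_evalWord]; omega)) hm)
        simpa [evalWord, hy1 z] using this.symm
    rcases s with j | j | i
    · obtain ⟨u, v, hw⟩ := List.append_of_mem (List.mem_ofFn.2 ⟨j, rfl⟩ : r j ∈ List.ofFn r)
      obtain ⟨u', q, hu⟩ : ∃ u' q, x :: u = u' ++ [q] := by
        rcases List.eq_nil_or_concat' (x :: u) with h0 | ⟨u', q, h0⟩
        · simp at h0
        · exact ⟨u', q, h0⟩
      have hw' : x :: List.ofFn r = u' ++ q :: r j :: v := by
        rw [hw, ← List.cons_append, hu]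
        simp
      rw [hw'] at hlen ⊢
      simp only [List.length_append, List.length_cons] at hlen
      refine (hc' (u' ++ (q.1, ⟨fun z => q.2 z * (r j).2 z,
        continuous_mul_of_cgMonoid (map_continuous _) (map_continuous _)⟩) :: v) (by
          simp only [List.length_append, List.length_cons]; omega)).congr fun z => ?_
      have := (he (p z).1).zero (evalWord u' z) (evalWord v z) (q.1 z) (q.2 z) ((r j).2 z)
        (le_trans (Nat.cast_le.2 (by rw [length_evalWord, length_evalWord]; omega)) hm)
      have hz : (r j).1 z = 0 := z.2
      simpa [evalWord, hz] using this.symm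
    · obtain ⟨u, v, hw⟩ := List.append_of_mem (List.mem_ofFn.2 ⟨j, rfl⟩ : r j ∈ List.ofFn r)
      rw [hw, ← List.cons_append] at hlen ⊢
      simp only [List.length_append, List.length_cons] at hlen
      refine (continuous_mul_of_cgMonoid (hc' (x :: u) (by simp only [List.length_cons]; omega))
        (hc' (r j :: v) (by simp only [List.length_cons]; omega))).congr fun z => ?_
      have := (he (p z).1).mul (evalWord (x :: u) z) (evalWord v z) ((r j).1 z) ((r j).2 z) z.2
        (le_trans (Nat.cast_le.2 (by
          simp only [length_evalWord, List.length_cons]; omega)) hm)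
      simpa [evalWord] using this.symm
    · have hi : ∀ z : C (.inr (.inr i)), (p z).2.2 i = 1 := fun z => z.2
      induction i using Fin.cases with
      | zero => exact hunit x (by simp) hi
      | succ i => exact hunit (r i) (List.mem_cons_of_mem _ (List.mem_ofFn.2 ⟨i, rfl⟩)) hi

end BoundaryContinuity

section CutWords

variable {G G' : Type u}

/-- The image of a word with a cut after the first letter depends on the values on shorter words
only. -/
theorem imageWord_congr_of_cut {φ φ' : List (ℝ≥0∞ × G) → G'} {l : ℝ≥0} {x : ℝ≥0∞ × G}
    {v : List (ℝ≥0∞ × G)} (hv : ∃ y ∈ v, (l : ℝ≥0∞) < y.1)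
    (h : ∀ w : List (ℝ≥0∞ × G), w.length ≤ v.length → φ w = φ' w) :
    imageWord φ l (x :: v) = imageWord φ' l (x :: v) := by
  obtain ⟨y, hy, hyl⟩ := hv
  obtain ⟨u, w, rfl⟩ := List.append_of_mem hy
  simp only [List.length_append, List.length_cons] at h
  have e : ∀ φ : List (ℝ≥0∞ × G) → G', imageWord φ l (x :: (u ++ y :: w)) =
      imageWord φ l (x :: u) ++ (y.1 - l, φ (y :: (cutState φ l w).1)) :: (cutState φ l w).2 := by
    intro φ
    have h0 : cutState φ l (y :: w) =
        ([], (y.1 - l, φ (y :: (cutState φ l w).1)) :: (cutState φ l w).2) :=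
      cutState_cons_of_lt w hyl
    have e0 : AnMap.mark l (x :: (u ++ y :: w)) =
        AnMap.mark l (x :: u) ++ (y :: w).map (AnMap.markLetter l) := by
      simp [AnMap.mark_cons]
    rw [imageWord, e0, List.foldr_append]
    change ((AnMap.mark l (x :: u)).foldr (cutStep φ l) (cutState φ l (y :: w))).2 = _
    rw [h0, foldr_cutStep_append]
    rfl
  have e1 : cutState φ l w = cutState φ' l w :=
    foldr_cutStep_congr fun w' hw' => h w' (by simp at hw'; omega)
  have := length_cutState φ' l w
  rw [e, e, e1, h _ (by simp only [List.length_cons]; omega),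
    imageWord_congr fun w' hw' => h w' (by simp only [List.length_cons] at hw'; omega)]

end CutWords

/-! ### A reparametrization of the cube -/

section Box

variable {N : ℕ}

/-- The scaling of all coordinates but the last one by `c`. -/
def boxScale (c : ℝ) (x : (Fin N → ℝ) × ℝ) : (Fin N → ℝ) × ℝ := (c • x.1, x.2)

theorem continuous_boxScale (c : ℝ) : Continuous (boxScale (N := N) c) := by
  unfold boxScale
  fun_prop

theorem boxScale_smul (c r : ℝ) (x : (Fin N → ℝ) × ℝ) :
    boxScale c (r • x) = r • boxScale c x := by
  simp [boxScale, smul_comm c r]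

theorem boxScale_boxScale {c : ℝ} (hc : 0 < c) (x : (Fin N → ℝ) × ℝ) :
    boxScale c⁻¹ (boxScale c x) = x := by
  simp [boxScale, smul_smul, inv_mul_cancel₀ hc.ne']

theorem boxScale_eq_zero {c : ℝ} (hc : 0 < c) {x : (Fin N → ℝ) × ℝ} :
    boxScale c x = 0 ↔ x = 0 := by
  simp [boxScale, Prod.ext_iff, hc.ne']

/-- The scaling of all coordinates but the last one by `c`, normalized so as to preserve the maximum
norm. -/
noncomputable def boxRescale (c : ℝ) (x : (Fin N → ℝ) × ℝ) : (Fin N → ℝ) × ℝ :=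
  (‖x‖ / ‖boxScale c x‖) • boxScale c x

theorem norm_boxRescale {c : ℝ} (hc : 0 < c) (x : (Fin N → ℝ) × ℝ) : ‖boxRescale c x‖ = ‖x‖ := by
  rcases eq_or_ne x 0 with rfl | hx
  · simp [boxRescale]
  · have : ‖boxScale c x‖ ≠ 0 := norm_ne_zero_iff.2 fun h => hx ((boxScale_eq_zero hc).1 h)
    rw [boxRescale, norm_smul, Real.norm_of_nonneg (by positivity), div_mul_cancel₀ _ this]

theorem boxRescale_boxRescale {c : ℝ} (hc : 0 < c) (x : (Fin N → ℝ) × ℝ) :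
    boxRescale c⁻¹ (boxRescale c x) = x := by
  rcases eq_or_ne x 0 with rfl | hx
  · simp [boxRescale]
  · have h1 : ‖x‖ ≠ 0 := norm_ne_zero_iff.2 hx
    have h2 : ‖boxScale c x‖ ≠ 0 := norm_ne_zero_iff.2 fun h => hx ((boxScale_eq_zero hc).1 h)
    have e : boxScale c⁻¹ (boxRescale c x) = (‖x‖ / ‖boxScale c x‖) • x := by
      rw [boxRescale, boxScale_smul, boxScale_boxScale hc]
    rw [boxRescale, norm_boxRescale hc, e, norm_smul, Real.norm_of_nonneg (by positivity),
      smul_smul]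
    rw [show ‖x‖ / (‖x‖ / ‖boxScale c x‖ * ‖x‖) * (‖x‖ / ‖boxScale c x‖) = 1 by field_simp,
      one_smul]

theorem continuous_boxRescale {c : ℝ} (hc : 0 < c) : Continuous (boxRescale (N := N) c) := by
  refine continuous_iff_continuousAt.2 fun x => ?_
  rcases eq_or_ne x 0 with rfl | hx
  · have h0 : boxRescale c (0 : (Fin N → ℝ) × ℝ) = 0 := by simp [boxRescale]
    rw [ContinuousAt, h0]
    refine squeeze_zero_norm (fun y => (norm_boxRescale hc y).le) ?_
    exact (continuous_norm.tendsto' 0 0 norm_zero)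
  · have h2 : ‖boxScale c x‖ ≠ 0 := norm_ne_zero_iff.2 fun h => hx ((boxScale_eq_zero hc).1 h)
    have h3 := (continuous_boxScale (N := N) c).continuousAt (x := x)
    exact (continuous_norm.continuousAt.div h3.norm h2).smul h3

/-- The vector of the coordinates of a point of a cube. -/
def boxVec (z : (Fin N → I) × I) : (Fin N → ℝ) × ℝ := (fun j => z.1 j, z.2)

theorem continuous_boxVec : Continuous (boxVec (N := N)) := by
  unfold boxVec
  fun_prop

theorem boxVec_injective : Function.Injective (boxVec (N := N)) := by
  intro z z' h
  simp only [boxVec, Prod.mk.injEq] at h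
  exact Prod.ext (funext fun j => Subtype.ext (congrFun h.1 j)) (Subtype.ext h.2)

theorem norm_boxVec_le (z : (Fin N → I) × I) : ‖boxVec z‖ ≤ 1 := by
  refine max_le ((pi_norm_le_iff_of_nonneg zero_le_one).2 fun j => ?_) ?_
  · rw [boxVec, Real.norm_of_nonneg (z.1 j).2.1]
    exact (z.1 j).2.2
  · rw [boxVec, Real.norm_of_nonneg z.2.2.1]
    exact z.2.2.2

/-- A point whose coordinates have maximum `1` has a coordinate `1`. -/
theorem exists_eq_one_of_norm_boxVec {z : (Fin N → I) × I} (h : ‖boxVec z‖ = 1) :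
    (∃ j, z.1 j = 1) ∨ z.2 = 1 := by
  by_contra hcon
  push Not at hcon
  refine h.not_lt (max_lt ((pi_norm_lt_iff zero_lt_one).2 fun j => ?_) ?_)
  · rw [boxVec, Real.norm_of_nonneg (z.1 j).2.1]
    exact lt_of_le_of_ne (z.1 j).2.2 fun h => hcon.1 j (Subtype.ext h)
  · rw [boxVec, Real.norm_of_nonneg z.2.2.1]
    exact lt_of_le_of_ne z.2.2.2 fun h => hcon.2 (Subtype.ext h)

theorem norm_boxVec_of_fst {z : (Fin N → I) × I} {j : Fin N} (h : z.1 j = 1) : ‖boxVec z‖ = 1 := by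
  refine le_antisymm (norm_boxVec_le z) ?_
  have h1 := (norm_le_pi_norm (boxVec z).1 j).trans (norm_fst_le (boxVec z))
  simpa [boxVec, h] using h1

theorem norm_boxVec_of_snd {z : (Fin N → I) × I} (h : z.2 = 1) : ‖boxVec z‖ = 1 := by
  refine le_antisymm (norm_boxVec_le z) ?_
  simpa only [boxVec, h, Icc.coe_one, norm_one] using norm_snd_le (boxVec z)

/-- The self-map of the cube given by `boxRescale`. -/
noncomputable def boxMap (c : ℝ) (z : (Fin N → I) × I) : (Fin N → I) × I :=
  (fun j => projIcc 0 1 zero_le_one ((boxRescale c (boxVec z)).1 j),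
    projIcc 0 1 zero_le_one (boxRescale c (boxVec z)).2)

theorem continuous_boxMap {c : ℝ} (hc : 0 < c) : Continuous (boxMap (N := N) c) := by
  have h := (continuous_boxRescale (N := N) hc).comp continuous_boxVec
  refine Continuous.prodMk (continuous_pi fun j => continuous_projIcc.comp ?_)
    (continuous_projIcc.comp (continuous_snd.comp h))
  exact (continuous_apply j).comp (continuous_fst.comp h)

theorem boxVec_boxMap {c : ℝ} (hc : 0 < c) (z : (Fin N → I) × I) :
    boxVec (boxMap c z) = boxRescale c (boxVec z) := by
  have h := (norm_boxRescale hc (boxVec z)).le.trans (norm_boxVec_le z)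
  have hr : 0 ≤ ‖boxVec z‖ / ‖boxScale c (boxVec z)‖ := by positivity
  refine Prod.ext (funext fun j => ?_) ?_
  · have h1 := ((norm_le_pi_norm _ j).trans (norm_fst_le _)).trans h
    have h0 : 0 ≤ (boxRescale c (boxVec z)).1 j :=
      mul_nonneg hr (mul_nonneg hc.le (z.1 j).2.1)
    rw [Real.norm_of_nonneg h0] at h1
    simp only [boxVec, boxMap] at h0 h1 ⊢
    rw [projIcc_of_mem zero_le_one ⟨h0, h1⟩]
  · have h1 := (norm_snd_le _).trans h
    have h0 : 0 ≤ (boxRescale c (boxVec z)).2 := mul_nonneg hr z.2.2.1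
    rw [Real.norm_of_nonneg h0] at h1
    simp only [boxVec, boxMap] at h0 h1 ⊢
    rw [projIcc_of_mem zero_le_one ⟨h0, h1⟩]

theorem boxMap_boxMap {c : ℝ} (hc : 0 < c) (z : (Fin N → I) × I) :
    boxMap c⁻¹ (boxMap c z) = z :=
  boxVec_injective (by
    rw [boxVec_boxMap (inv_pos.2 hc), boxVec_boxMap hc, boxRescale_boxRescale hc])

theorem norm_boxMap {c : ℝ} (hc : 0 < c) (z : (Fin N → I) × I) :
    ‖boxVec (boxMap c z)‖ = ‖boxVec z‖ := by
  rw [boxVec_boxMap hc, norm_boxRescale hc]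

theorem coe_boxMap_fst {c : ℝ} (hc : 0 < c) (z : (Fin N → I) × I) (j : Fin N) :
    (((boxMap c z).1 j : I) : ℝ) =
      ‖boxVec z‖ / ‖boxScale c (boxVec z)‖ * (c * z.1 j) :=
  congrFun (congrArg Prod.fst (boxVec_boxMap hc z)) j

theorem coe_boxMap_snd {c : ℝ} (hc : 0 < c) (z : (Fin N → I) × I) :
    (((boxMap c z).2 : I) : ℝ) = ‖boxVec z‖ / ‖boxScale c (boxVec z)‖ * z.2 :=
  congrArg Prod.snd (boxVec_boxMap hc z)

theorem boxMap_fst_eq_zero {c : ℝ} (hc : 0 < c) {z : (Fin N → I) × I} {j : Fin N}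
    (h : z.1 j = 0) : (boxMap c z).1 j = 0 :=
  Subtype.ext (by rw [coe_boxMap_fst hc, h]; simp)

theorem boxMap_zero {c : ℝ} (hc : 0 < c) (τ : Fin N → I) : boxMap c (τ, 0) = (τ, 0) := by
  refine boxVec_injective ?_
  rw [boxVec_boxMap hc]
  have e : boxScale c (boxVec (τ, (0 : I))) = c • boxVec (τ, (0 : I)) := by
    simp [boxScale, boxVec]
  rw [boxRescale, e]
  rcases eq_or_ne (boxVec (τ, (0 : I))) 0 with h | h
  · rw [h]
    simp
  · have h1 : ‖boxVec (τ, (0 : I))‖ ≠ 0 := norm_ne_zero_iff.2 h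
    rw [norm_smul, Real.norm_of_nonneg hc.le, smul_smul,
      show ‖boxVec (τ, (0 : I))‖ / (c * ‖boxVec (τ, (0 : I))‖) * c = 1 by field_simp, one_smul]

/-- For `c ≤ 1`, the last face of the cube is mapped to the part of this face in which the other
coordinates are at most `c`. -/
theorem boxMap_one {c : ℝ} (hc : 0 < c) (hc1 : c ≤ 1) (τ : Fin N → I) :
    (boxMap c (τ, 1)).2 = 1 ∧ ∀ j, (((boxMap c (τ, 1)).1 j : I) : ℝ) = c * τ j := by
  have h1 : ‖boxVec (τ, (1 : I))‖ = 1 := norm_boxVec_of_snd rfl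
  have h2 : ‖boxScale c (boxVec (τ, (1 : I)))‖ = 1 := by
    refine le_antisymm (max_le ((pi_norm_le_iff_of_nonneg zero_le_one).2 fun j => ?_) ?_) ?_
    · have : 0 ≤ c * (τ j : ℝ) := mul_nonneg hc.le (τ j).2.1
      change ‖c * (τ j : ℝ)‖ ≤ 1
      rw [Real.norm_of_nonneg this]
      exact mul_le_one₀ hc1 (τ j).2.1 (τ j).2.2
    · simp [boxScale, boxVec]
    · simpa only [boxScale, boxVec, Icc.coe_one, norm_one] using
        norm_snd_le (boxScale c (boxVec (τ, (1 : I))))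
  refine ⟨Subtype.ext ?_, fun j => ?_⟩
  · rw [coe_boxMap_snd hc, h1, h2]
    simp
  · rw [coe_boxMap_fst hc, h1, h2]
    simp

/-- For `c ≤ 1`, the faces where one of the first coordinates is `1` are mapped to faces of this kind
or to the part of the last face in which one of the other coordinates is at least `c`. -/
theorem boxMap_of_fst_eq_one {c : ℝ} (hc : 0 < c) {z : (Fin N → I) × I} {j : Fin N}
    (h : z.1 j = 1) : (∃ i, (boxMap c z).1 i = 1) ∨
      (boxMap c z).2 = 1 ∧ c ≤ ((boxMap c z).1 j : I) := by
  have h1 : ‖boxVec z‖ = 1 := norm_boxVec_of_fst h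
  rcases exists_eq_one_of_norm_boxVec ((norm_boxMap hc z).trans h1) with h2 | h2
  · exact Or.inl h2
  · refine Or.inr ⟨h2, ?_⟩
    have e := coe_boxMap_snd hc z
    rw [h2] at e
    rw [coe_boxMap_fst hc, h]
    have hr : 0 ≤ ‖boxVec z‖ / ‖boxScale c (boxVec z)‖ := by positivity
    have : (1 : ℝ) ≤ ‖boxVec z‖ / ‖boxScale c (boxVec z)‖ := by
      refine le_of_eq_of_le e (mul_le_of_le_one_right hr z.2.2.2)
    simpa using le_mul_of_one_le_left hc.le this

/-- The converse of `boxMap_of_fst_eq_one` for the inverse map. -/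
theorem boxMap_inv_fst_eq_one {c : ℝ} (hc : 0 < c) {z : (Fin N → I) × I}
    (h : ‖boxVec z‖ = 1) {j : Fin N} (hj : c ≤ (z.1 j : I)) : ∃ i, (boxMap c⁻¹ z).1 i = 1 := by
  have hc' := inv_pos.2 hc
  rcases exists_eq_one_of_norm_boxVec ((norm_boxMap hc' z).trans h) with h2 | h2
  · exact h2
  · refine ⟨j, Subtype.ext (le_antisymm ((boxMap c⁻¹ z).1 j).2.2 ?_)⟩
    have e := coe_boxMap_snd hc' z
    rw [h2] at e
    have hr : 0 ≤ ‖boxVec z‖ / ‖boxScale c⁻¹ (boxVec z)‖ := by positivity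
    have h3 : (1 : ℝ) ≤ ‖boxVec z‖ / ‖boxScale c⁻¹ (boxVec z)‖ := by
      refine le_of_eq_of_le e (mul_le_of_le_one_right hr z.2.2.2)
    rw [coe_boxMap_fst hc']
    have h4 : 1 ≤ c⁻¹ * (z.1 j : ℝ) := by
      rw [inv_mul_eq_div]
      exact (one_le_div hc).2 hj
    exact one_le_mul_of_one_le_of_one_le h3 h4

end Box

/-! ### The inductive construction of lifts -/

theorem isClosed_exists_of_finite {X ι : Type*} [TopologicalSpace X] [Finite ι] {p : ι → X → Prop}
    (h : ∀ i, IsClosed {x | p i x}) : IsClosed {x | ∃ i, p i x} := by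
  rw [ofPred_exists]
  exact isClosed_iUnion_of_finite h

section CutContinuity

variable {n : ℕ∞} {G G' G'' : Type u} [Monoid G] [Monoid G'] [Monoid G''] [TopologicalSpace G]
  [TopologicalSpace G'] [TopologicalSpace G''] {X : Type v} [TopologicalSpace X] {l : ℝ≥0}

/-- A composite is continuous on words with a cut after the first letter, provided that the inner map
is continuous on shorter words. -/
theorem WordContOn.kContOn_cut {m : ℕ} (hm : ((m + 1 : ℕ) : ℕ∞) ≤ n)
    {e : X → List (ℝ≥0∞ × G) → G'} (he : ∀ x, IsWordMap n l (e x)) {A : Set X}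
    (hc : WordContOn m e A) (f' : AnMap n G' G'') :
    KContOn (fun z : X × (Fin m → ℝ≥0∞) × (Fin (m + 1) → G) =>
      f'.eval (_root_.imageWord (e z.1) l (AnMap.word z.2.1 z.2.2)))
      {z | z.1 ∈ A ∧ ∃ j, (l : ℝ≥0∞) ≤ z.2.1 j} := by
  classical
  intro K _ _ _ p hp hA
  have hT : ∀ j, Continuous fun z => (p z).2.1 j := fun j => by fun_prop
  have hg : ∀ i, Continuous fun z => (p z).2.2 i := fun i => by fun_prop
  let C : Fin m → Set K := fun j => {z | (l : ℝ≥0∞) ≤ (p z).2.1 j}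
  have hC : ∀ j, IsClosed (C j) := fun j => isClosed_le continuous_const (hT j)
  refine continuous_of_finite_closed_cover hC (fun z => (hA z).2) fun j => ?_
  have := isCompact_iff_compactSpace.1 (hC j).isCompact
  let x : C(C j, ℝ≥0∞) × C(C j, G) := (⟨fun _ => 0, continuous_const⟩,
    ⟨fun z => (p z).2.2 0, (hg 0).comp continuous_subtype_val⟩)
  let r : Fin m → C(C j, ℝ≥0∞) × C(C j, G) := fun i =>
    (⟨fun z => (p z).2.1 i, (hT i).comp continuous_subtype_val⟩,
      ⟨fun z => (p z).2.2 i.succ, (hg i.succ).comp continuous_subtype_val⟩)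
  have hp' : Continuous fun z : C j => (p z).1 :=
    continuous_fst.comp (hp.comp continuous_subtype_val)
  have key := continuous_imageWord (n := n) (m := m) m (K := C j) (e' := fun _ => f'.eval)
    (s' := fun _ => f'.size) (s := fun _ => l) (fun _ => f'.isWordMap)
    (fun i => AnMap.wordContOn (F := fun _ : C j => f')
      (continuous_const.kCont.kContOn univ) i) (e := fun z => e (p z).1) (fun z => he _)
    (hc.comp hp' fun z _ => (hA z).1) continuous_const x []
    (List.ofFn fun i => (decide (i = j), r i)) (by simp) (by simp) (by
      intro y hy z hy1
      obtain ⟨i, rfl⟩ := (List.mem_ofFn' _ _).1 hy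
      have hij : i = j := by simpa using hy1
      subst hij
      exact z.2) (by simpa [add_comm] using hm)
    (Or.inr ⟨by simp, (true, r j), by
      rw [List.nil_append]
      exact List.mem_ofFn.2 ⟨j, by simp⟩, rfl⟩)
  refine key.congr fun z => ?_
  simp [evalWord, AnMap.word, x, r, List.map_ofFn, Function.comp_def]

end CutContinuity

theorem continuous_word_scale {H : Type*} [TopologicalSpace H] {X : Type*} [TopologicalSpace X]
    {Y : Type*} [TopologicalSpace Y] {m : ℕ} (l : ℝ≥0) {p : X → Y} (hp : Continuous p)
    {τ : X → Fin m → I} (hτ : Continuous τ)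
    {g : X → Fin (m + 1) → H} (hg : Continuous g) :
    Continuous fun z => (p z, (fun j => scaleParam l (τ z j)), g z) :=
  hp.prodMk ((continuous_pi fun j => (continuous_scaleParam l).comp
    ((continuous_apply j).comp hτ)).prodMk hg)

section Stage

variable {n : ℕ∞} {G' H H' : Type u} [Monoid G'] [TopologicalSpace G']
  [Monoid H] [TopologicalSpace H] [Monoid H'] [TopologicalSpace H'] {k : ℕ}

/-- A partial solution of the lifting problem: a family `ψ` of lifts of `a` up to a homotopy `ω`,
which extends the lifts `h` over the boundary of a cube. The families are continuous on words of
length at most `m`. -/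
structure IsPartialLift (f' : AnMap n G' H') (a : (Fin k → I) → AnMap n H H')
    (h : (Fin k → I) → AnMap n H G') (l : ℝ≥0) (m : ℕ) (ψ : (Fin k → I) → List (ℝ≥0∞ × H) → G')
    (ω : (Fin k → I) × I → List (ℝ≥0∞ × H) → H') : Prop where
  isWordMap_lift : ∀ x, IsWordMap n l (ψ x)
  isWordMap_homotopy : ∀ z, IsWordMap n (l + f'.size) (ω z)
  lift_boundary : ∀ x ∈ Cube.boundary (Fin k), ψ x = (h x).eval
  homotopy_zero : ∀ x, ω (x, 0) = (a x).eval
  homotopy_boundary : ∀ x ∈ Cube.boundary (Fin k), ∀ s, ω (x, s) = (a x).eval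
  homotopy_one : ∀ x w, (w.length : ℕ∞) ≤ n → ω (x, 1) w = f'.eval (imageWord (ψ x) l w)
  continuous_lift : (m : ℕ∞) ≤ n → WordContOn m ψ univ
  continuous_homotopy : (m : ℕ∞) ≤ n → WordContOn m ω univ

variable {f' : AnMap n G' H'} {a : (Fin k → I) → AnMap n H H'} {h : (Fin k → I) → AnMap n H G'}
  {l : ℝ≥0}

/-- On the empty word all values are `1`, so that there is no condition of continuity yet. -/
theorem exists_isPartialLift_zero (hs : ∀ x ∈ Cube.boundary (Fin k), (h x).size = l)
    (hsa : ∀ x, (a x).size = l + f'.size)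
    (hc : ∀ x ∈ Cube.boundary (Fin k), f'.comp (h x) = a x) :
    ∃ ψ ω, IsPartialLift f' a h l 0 ψ ω := by
  classical
  let ψ : (Fin k → I) → List (ℝ≥0∞ × H) → G' := fun x =>
    if x ∈ Cube.boundary (Fin k) then (h x).eval else fun _ => 1
  let ω : (Fin k → I) × I → List (ℝ≥0∞ × H) → H' := fun z =>
    if z.2 = 0 ∨ z.1 ∈ Cube.boundary (Fin k) then (a z.1).eval else
      fun w => f'.eval (imageWord (ψ z.1) l w)
  have hψ : ∀ x, IsWordMap n l (ψ x) := by
    intro x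
    by_cases hx : x ∈ Cube.boundary (Fin k)
    · simp only [ψ, if_pos hx]
      rw [← hs x hx]
      exact (h x).isWordMap
    · simp only [ψ, if_neg hx]
      exact isWordMap_one l
  have hω : ∀ z, IsWordMap n (l + f'.size) (ω z) := by
    intro z
    by_cases hz : z.2 = 0 ∨ z.1 ∈ Cube.boundary (Fin k)
    · simp only [ω, if_pos hz]
      rw [← hsa z.1]
      exact (a z.1).isWordMap
    · simp only [ω, if_neg hz]
      exact f'.isWordMap.comp (hψ z.1)
  refine ⟨ψ, ω, hψ, hω, fun x hx => if_pos hx, fun x => if_pos (Or.inl rfl),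
    fun x hx s => if_pos (Or.inr hx), fun x w hw => ?_, fun _ K _ _ _ p hp hA w hw => ?_,
    fun _ K _ _ _ p hp hA w hw => ?_⟩
  · by_cases hx : x ∈ Cube.boundary (Fin k)
    · simp only [ω, ψ, hx, or_true, if_true]
      rw [← hc x hx, AnMap.eval_comp _ _ _ hw, hs x hx]
    · simp [ω, hx]
  · obtain rfl : w = [] := List.length_eq_zero_iff.1 (by omega)
    exact continuous_const.congr fun z => (hψ (p z)).nil.symm
  · obtain rfl : w = [] := List.length_eq_zero_iff.1 (by omega)
    exact continuous_const.congr fun z => (hω (p z)).nil.symm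

/-- The lift is continuous on words of length `m + 1` over the boundary of the cube and where the
values are determined by shorter words. -/
theorem IsPartialLift.kContOn_lift [CGMonoid G'] [CGMonoid H] {m : ℕ}
    {ψ : (Fin k → I) → List (ℝ≥0∞ × H) → G'}
    {ω : (Fin k → I) × I → List (ℝ≥0∞ × H) → H'} (st : IsPartialLift f' a h l m ψ ω)
    (hm : ((m + 1 : ℕ) : ℕ∞) ≤ n) (hh : KContOn h (Cube.boundary (Fin k))) :
    KContOn (fun z : ((Fin k → I) × (Fin m → I)) × (Fin (m + 1) → H) =>
      ψ z.1.1 (AnMap.word (fun j => scaleParam l (z.1.2 j)) z.2))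
      {z | z.1.1 ∈ Cube.boundary (Fin k) ∨ z.1.2 ∈ Cube.boundary (Fin m) ∨ ∃ i, z.2 i = 1} := by
  have hm' : (m : ℕ∞) ≤ n := le_trans (Nat.cast_le.2 m.le_succ) hm
  have hg1 : IsClosed ({1} : Set H) :=
    have := CGMonoid.weakHausdorff (G := H)
    isClosed_singleton_of_weakHausdorff 1
  have hsc : Continuous fun z : ((Fin k → I) × (Fin m → I)) × (Fin (m + 1) → H) =>
      (z.1.1, (fun j => scaleParam l (z.1.2 j)), z.2) :=
    continuous_word_scale l (by fun_prop) (by fun_prop) (by fun_prop)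
  have h1 := ((AnMap.wordContOn hh (m + 1)).kContOn.comp_continuous hsc
    (B := {z | z.1.1 ∈ Cube.boundary (Fin k)}) fun z hz => hz).congr
    (g := fun z => ψ z.1.1 (AnMap.word (fun j => scaleParam l (z.1.2 j)) z.2))
    fun z hz => by rw [st.lift_boundary _ hz]
  have h2 := (WordContOn.kContOn_boundary hm st.isWordMap_lift
    (st.continuous_lift hm')).comp_continuous hsc
    (B := {z | z.1.2 ∈ Cube.boundary (Fin m) ∨ ∃ i, z.2 i = 1}) (by
      rintro z (⟨j, hj | hj⟩ | hz)
      · exact ⟨mem_univ _, Or.inl ⟨j, by simp only [hj, scaleParam_zero]⟩⟩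
      · exact ⟨mem_univ _, Or.inr (Or.inl ⟨j, by simp only [hj, scaleParam_one, le_refl]⟩)⟩
      · exact ⟨mem_univ _, Or.inr (Or.inr hz)⟩)
  refine KContOn.union ((isClosed_boundary k).preimage (by fun_prop)) ?_ h1 h2
  exact ((isClosed_boundary m).preimage (by fun_prop)).union
    (isClosed_exists_of_finite fun i => hg1.preimage (by fun_prop))

/-- The homotopy is continuous on words of length `m + 1` over the boundary of the cube, where the
values are determined by shorter words, and at the end on words whose composite has a cut. -/
theorem IsPartialLift.kContOn_homotopy [CGMonoid H] [CGMonoid H'] {m : ℕ}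
    {ψ : (Fin k → I) → List (ℝ≥0∞ × H) → G'}
    {ω : (Fin k → I) × I → List (ℝ≥0∞ × H) → H'} (st : IsPartialLift f' a h l m ψ ω)
    (hm : ((m + 1 : ℕ) : ℕ∞) ≤ n) (ha : Continuous a) :
    KContOn (fun z : ((Fin k → I) × I) × (Fin m → ℝ≥0∞) × (Fin (m + 1) → H) =>
      ω z.1 (AnMap.word z.2.1 z.2.2))
      {z | z.1.1 ∈ Cube.boundary (Fin k) ∨ ((∃ j, z.2.1 j = 0) ∨
        (∃ j, ((l + f'.size : ℝ≥0) : ℝ≥0∞) ≤ z.2.1 j) ∨ ∃ i, z.2.2 i = 1) ∨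
          z.1.2 = 1 ∧ ∃ j, (l : ℝ≥0∞) ≤ z.2.1 j} := by
  have hm' : (m : ℕ∞) ≤ n := le_trans (Nat.cast_le.2 m.le_succ) hm
  have hg1 : IsClosed ({1} : Set H) :=
    have := CGMonoid.weakHausdorff (G := H)
    isClosed_singleton_of_weakHausdorff 1
  have h1 := ((AnMap.wordContOn (F := fun z : (Fin k → I) × I => a z.1)
    ((ha.comp continuous_fst).kCont.kContOn univ) (m + 1)).kContOn.mono
    (A := {z : ((Fin k → I) × I) × (Fin m → ℝ≥0∞) × (Fin (m + 1) → H) |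
      z.1 ∈ (univ : Set ((Fin k → I) × I))}) (B := {z | z.1.1 ∈ Cube.boundary (Fin k)})
    fun z _ => mem_univ z.1).congr
    (g := fun z => ω z.1 (AnMap.word z.2.1 z.2.2))
    fun z hz => by rw [← st.homotopy_boundary z.1.1 hz z.1.2]
  have h2 := (WordContOn.kContOn_boundary hm st.isWordMap_homotopy
    (st.continuous_homotopy hm')).mono
    (show {z : ((Fin k → I) × I) × (Fin m → ℝ≥0∞) × (Fin (m + 1) → H) | (∃ j, z.2.1 j = 0) ∨
        (∃ j, ((l + f'.size : ℝ≥0) : ℝ≥0∞) ≤ z.2.1 j) ∨ ∃ i, z.2.2 i = 1} ⊆ _ from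
      fun z hz => ⟨mem_univ _, hz⟩)
  have h3 := ((WordContOn.kContOn_cut hm st.isWordMap_lift (st.continuous_lift hm')
    f').comp_continuous (g := fun z : ((Fin k → I) × I) × (Fin m → ℝ≥0∞) × (Fin (m + 1) → H) =>
      (z.1.1, z.2)) (by fun_prop) (B := {z | z.1.2 = 1 ∧ ∃ j, (l : ℝ≥0∞) ≤ z.2.1 j})
      fun z hz => ⟨mem_univ _, hz.2⟩).congr (g := fun z => ω z.1 (AnMap.word z.2.1 z.2.2)) (by
        rintro ⟨⟨x, s⟩, T, g⟩ ⟨hs, -⟩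
        dsimp only at hs
        subst hs
        exact st.homotopy_one x _ (by rw [AnMap.length_word]; exact hm))
  have c2 : IsClosed {z : ((Fin k → I) × I) × (Fin m → ℝ≥0∞) × (Fin (m + 1) → H) |
      (∃ j, z.2.1 j = 0) ∨ (∃ j, ((l + f'.size : ℝ≥0) : ℝ≥0∞) ≤ z.2.1 j) ∨ ∃ i, z.2.2 i = 1} := by
    refine IsClosed.union ?_ (IsClosed.union ?_ ?_)
    · exact isClosed_exists_of_finite fun j => isClosed_eq (by fun_prop) (by fun_prop)
    · exact isClosed_exists_of_finite fun j => isClosed_le (by fun_prop) (by fun_prop)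
    · exact isClosed_exists_of_finite fun i => hg1.preimage (by fun_prop)
  have c3 : IsClosed {z : ((Fin k → I) × I) × (Fin m → ℝ≥0∞) × (Fin (m + 1) → H) |
      z.1.2 = 1 ∧ ∃ j, (l : ℝ≥0∞) ≤ z.2.1 j} := by
    refine IsClosed.inter (isClosed_eq (by fun_prop) (by fun_prop)) ?_
    exact isClosed_exists_of_finite fun j => isClosed_le (by fun_prop) (by fun_prop)
  exact KContOn.union ((isClosed_boundary k).preimage (by fun_prop)) (c2.union c3) h1
    (KContOn.union c2 c3 h2 h3)

end Stage

/-! ### Families of paths and products of cubes -/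

section PathFamilies

variable {M N : Type u} [TopologicalSpace M] [TopologicalSpace N] {p : M → N}

/-- A family of paths ending in values of `p` is a map to the path fibration. -/
theorem exists_pathSpace_family [Nonempty M] {Z : Type v} [TopologicalSpace Z] {A : Set Z}
    {b : Z → M} {W : Z × I → N} (hb : KContOn b A) (hW : KContOn W {z | z.1 ∈ A})
    (h1 : ∀ z ∈ A, W (z, 1) = p (b z)) :
    ∃ u : Z → PathSpace p, KContOn u A ∧
      ∀ z ∈ A, (u z).1.1 = b z ∧ ∀ d, (u z).1.2 d = W (z, d) := by
  classical
  have hWz : ∀ z ∈ A, Continuous fun d : I => W (z, d) := fun z hz =>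
    hW.continuous_comp (p := fun d : I => (z, d)) (by fun_prop) fun _ => hz
  let u : Z → PathSpace p := fun z =>
    if hz : z ∈ A then ⟨(b z, ⟨fun d => W (z, d), hWz z hz⟩), h1 z hz⟩
    else PathSpace.const p (Classical.arbitrary M)
  have hu : ∀ z ∈ A, (u z).1.1 = b z ∧ ∀ d, (u z).1.2 d = W (z, d) := by
    intro z hz
    have e : u z = ⟨(b z, ⟨fun d => W (z, d), hWz z hz⟩), h1 z hz⟩ := dif_pos hz
    rw [e]
    exact ⟨rfl, fun d => rfl⟩
  refine ⟨u, fun K _ _ _ f hf hA => ?_, hu⟩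
  refine Continuous.subtype_mk (f := fun k => (u (f k)).1) (Continuous.prodMk ?_ ?_) _
  · exact (hb K f hf hA).congr fun k => ((hu _ (hA k)).1).symm
  · refine ContinuousMap.continuous_of_continuous_uncurry _ ?_
    exact (hW (K × I) (fun z => (f z.1, z.2)) (by fun_prop) fun z => hA z.1).congr fun z =>
      ((hu _ (hA z.1)).2 z.2).symm

theorem continuous_pathSpace_fst : Continuous fun e : PathSpace p => e.1.1 :=
  continuous_fst.comp continuous_subtype_val

theorem continuous_pathSpace_eval : Continuous fun z : PathSpace p × I => z.1.1.2 z.2 :=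
  (continuous_snd.comp (continuous_subtype_val.comp continuous_fst)).eval continuous_snd

end PathFamilies

/-- The lifting property of a trivial fibration for a product of two cubes and a power of a space, if
it has the lifting property for a point of this space. -/
theorem lifts_cube_prod_cube_prod_pow {H : Type u} [TopologicalSpace H] [Monoid H]
    (hH : ∀ (E N : Type u) [TopologicalSpace E] [TopologicalSpace N] (q : E → N),
      IsTrivialKFibration q → Lifts q ({1} : Set H))
    (hc : IsClosed ({1} : Set H)) (hn : IsNDR ({1} : Set H)) (k m j : ℕ)
    {E N : Type u} [TopologicalSpace E] [TopologicalSpace N] {q : E → N}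
    (hq : IsTrivialKFibration q) :
    Lifts q {z : ((Fin k → I) × (Fin m → I)) × (Fin j → H) |
      z.1.1 ∈ Cube.boundary (Fin k) ∨ z.1.2 ∈ Cube.boundary (Fin m) ∨ ∃ i, z.2 i = 1} := by
  refine (lifts_cube_prod_pow hH hc hn (k + m) j hq).of_homeomorph
    ((Fin.appendHomeomorph k m).prodCongr (Homeomorph.refl _)) ?_
  rintro ⟨⟨x, τ⟩, g⟩
  have e : ((Fin.appendHomeomorph k m).prodCongr (Homeomorph.refl (Fin j → H))) ((x, τ), g) =
    (Fin.append x τ, g) := rfl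
  rw [e]
  simp only [mem_ofPred_eq, Cube.boundary]
  constructor
  · rintro (⟨i, hi⟩ | ⟨i, hi⟩ | h)
    · exact Or.inl ⟨Fin.castAdd m i, by rwa [Fin.append_left]⟩
    · exact Or.inl ⟨Fin.natAdd k i, by rwa [Fin.append_right]⟩
    · exact Or.inr h
  · rintro (⟨i, hi⟩ | h)
    · induction i using Fin.addCases with
      | left i => exact Or.inl ⟨i, by rwa [Fin.append_left] at hi⟩
      | right i => exact Or.inr (Or.inl ⟨i, by rwa [Fin.append_right] at hi⟩)
    · exact Or.inr (Or.inr h)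

section ScaleParam

variable {l L : ℝ≥0}

theorem le_scaleParam_of_div_le (hL : 0 < L) {r : I} (h : (l / L : ℝ) ≤ r) :
    (l : ℝ≥0∞) ≤ scaleParam L r := by
  have hL' : (0 : ℝ) < L := hL
  rw [scaleParam, ← ENNReal.ofReal_coe_nnreal]
  refine ENNReal.ofReal_le_ofReal ?_
  rw [div_le_iff₀ hL'] at h
  linarith

theorem div_le_of_le_scaleParam (hL : 0 < L) {r : I} (h : (l : ℝ≥0∞) ≤ scaleParam L r) :
    (l / L : ℝ) ≤ r := by
  have hL' : (0 : ℝ) < L := hL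
  rw [scaleParam, ← ENNReal.ofReal_coe_nnreal,
    ENNReal.ofReal_le_ofReal_iff (mul_nonneg hL'.le r.2.1)] at h
  rw [div_le_iff₀ hL']
  linarith

theorem scaleParam_eq_scaleParam (hL : 0 < L) {r τ : I} (h : (r : ℝ) = l / L * τ) :
    scaleParam L r = scaleParam l τ := by
  have hL' : (L : ℝ) ≠ 0 := NNReal.coe_ne_zero.2 hL.ne'
  rw [scaleParam, scaleParam, h]
  congr 1
  field_simp

end ScaleParam

/-! ### Extension of partial lifts to longer words -/

section Step

variable {n : ℕ∞} {G' H H' : Type u} [Monoid G'] [TopologicalSpace G']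
  [Monoid H] [TopologicalSpace H] [Monoid H'] [TopologicalSpace H'] {k : ℕ}
  {f' : AnMap n G' H'} {a : (Fin k → I) → AnMap n H H'} {h : (Fin k → I) → AnMap n H G'}
  {l : ℝ≥0} {m : ℕ} {ψ : (Fin k → I) → List (ℝ≥0∞ × H) → G'}
  {ω : (Fin k → I) × I → List (ℝ≥0∞ × H) → H'}

/-- Over the boundary and on words that are determined by shorter ones, a partial lift and its
homotopy form a continuous family of points of the path fibration of the underlying map. The
homotopy is reparametrized such that its end lies over the words with parameters at most `l`. -/
theorem IsPartialLift.exists_pathSpace_family [CGMonoid G'] [CGMonoid H] [CGMonoid H'] (hn : 1 ≤ n)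
    (st : IsPartialLift f' a h l m ψ ω) (hm : ((m + 1 : ℕ) : ℕ∞) ≤ n) (hl : 0 < l)
    (ha : Continuous a) (hh : KContOn h (Cube.boundary (Fin k))) :
    ∃ u₀ : ((Fin k → I) × (Fin m → I)) × (Fin (m + 1) → H) → PathSpace (f'.underlying hn),
      KContOn u₀ {z | z.1.1 ∈ Cube.boundary (Fin k) ∨ z.1.2 ∈ Cube.boundary (Fin m) ∨
        ∃ i, z.2 i = 1} ∧
      ∀ z, (z.1.1 ∈ Cube.boundary (Fin k) ∨ z.1.2 ∈ Cube.boundary (Fin m) ∨ ∃ i, z.2 i = 1) →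
        (u₀ z).1.1 = ψ z.1.1 (AnMap.word (fun j => scaleParam l (z.1.2 j)) z.2) ∧
        ∀ d, (u₀ z).1.2 d = ω (z.1.1, (boxMap (l / (l + f'.size : ℝ≥0)) (z.1.2, d)).2)
          (AnMap.word (fun j => scaleParam (l + f'.size)
            ((boxMap (l / (l + f'.size : ℝ≥0)) (z.1.2, d)).1 j)) z.2) := by
  set L : ℝ≥0 := l + f'.size with hL
  have hL0 : 0 < L := lt_of_lt_of_le hl le_self_add
  have hLR : (0 : ℝ) < L := hL0
  have hlR : (0 : ℝ) < l := hl
  have hc : (0 : ℝ) < l / L := by positivity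
  have hc1 : (l / L : ℝ) ≤ 1 := (div_le_one hLR).2 (by exact_mod_cast le_self_add)
  have hP : Continuous (boxMap (N := m) (l / L : ℝ)) := continuous_boxMap hc
  refine _root_.exists_pathSpace_family (p := f'.underlying hn)
    (W := fun z => ω (z.1.1.1, (boxMap (l / L : ℝ) (z.1.1.2, z.2)).2)
      (AnMap.word (fun j => scaleParam L ((boxMap (l / L : ℝ) (z.1.1.2, z.2)).1 j)) z.1.2))
    (st.kContOn_lift hm hh) ?_ ?_
  · have hPz : Continuous fun z : (((Fin k → I) × (Fin m → I)) × (Fin (m + 1) → H)) × I =>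
        boxMap (l / L : ℝ) (z.1.1.2, z.2) := hP.comp (by fun_prop)
    refine (st.kContOn_homotopy hm ha).comp_continuous
      (g := fun z : (((Fin k → I) × (Fin m → I)) × (Fin (m + 1) → H)) × I =>
        ((z.1.1.1, (boxMap (l / L : ℝ) (z.1.1.2, z.2)).2),
          (fun j => scaleParam L ((boxMap (l / L : ℝ) (z.1.1.2, z.2)).1 j)), z.1.2))
      (continuous_word_scale L ((by fun_prop : Continuous _).prodMk hPz.snd) hPz.fst
        (by fun_prop)) ?_
    rintro ⟨⟨⟨x, τ⟩, g⟩, d⟩ (hx | ⟨j, hj | hj⟩ | hg)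
    · exact Or.inl hx
    · exact Or.inr (Or.inl (Or.inl ⟨j, by
        dsimp only at hj ⊢
        rw [boxMap_fst_eq_zero hc hj, scaleParam_zero]⟩))
    · rcases boxMap_of_fst_eq_one hc (z := (τ, d)) hj with ⟨i, hi⟩ | ⟨h1, h2⟩
      · exact Or.inr (Or.inl (Or.inr (Or.inl ⟨i, by
          dsimp only
          rw [hi, scaleParam_one]⟩)))
      · exact Or.inr (Or.inr ⟨h1, j, le_scaleParam_of_div_le hL0 h2⟩)
    · exact Or.inr (Or.inl (Or.inr (Or.inr hg)))
  · rintro ⟨⟨x, τ⟩, g⟩ -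
    obtain ⟨h1, h2⟩ := boxMap_one hc hc1 τ
    dsimp only
    rw [h1, st.homotopy_one _ _ (by rw [AnMap.length_word]; exact hm)]
    simp only [fun j => scaleParam_eq_scaleParam hL0 (h2 j)]
    rw [AnMap.word, imageWord_of_le, ← AnMap.underlying_eq hn]
    intro y hy
    obtain ⟨j, rfl⟩ := (List.mem_ofFn' _ _).1 hy
    exact scaleParam_le _ _

end Step

theorem IsIrreducibleWord.eq_word {H : Type u} [Monoid H] {l : ℝ≥0} {m : ℕ}
    {w : List (ℝ≥0∞ × H)} (hw : IsIrreducibleWord l w) (hwm : w.length = m + 1) :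
    ∃ (T : Fin m → ℝ≥0∞) (g : Fin (m + 1) → H), w = AnMap.word T g := by
  obtain ⟨g, v, rfl, -, -⟩ := hw
  obtain rfl : v.length = m := by simpa using hwm
  exact ⟨_, _, AnMap.exists_eq_word (0, g) v⟩

section Step

variable {n : ℕ∞} {G' H H' : Type u} [Monoid G'] [TopologicalSpace G']
  [Monoid H] [TopologicalSpace H] [Monoid H'] [TopologicalSpace H'] {k : ℕ}
  {f' : AnMap n G' H'} {a : (Fin k → I) → AnMap n H H'} {h : (Fin k → I) → AnMap n H G'}
  {l : ℝ≥0} {m : ℕ} {ψ : (Fin k → I) → List (ℝ≥0∞ × H) → G'}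
  {ω : (Fin k → I) × I → List (ℝ≥0∞ × H) → H'}

/-- The lifts and the homotopy over words of length `m + 1` that the lifting property of the path
fibration of the underlying map provides: a map `y` that extends the partial lift, and a homotopy `Γ`
that extends the given one and ends in the composite with `y`. -/
theorem IsPartialLift.exists_extend_letter [CGMonoid G'] [CGMonoid H] [CGMonoid H'] (hn : 1 ≤ n)
    (hp : ∀ (E N : Type u) [TopologicalSpace E] [TopologicalSpace N] (q : E → N),
      IsTrivialKFibration q → Lifts q ({1} : Set H))
    (hnd : IsNDR ({1} : Set H)) (hf' : f'.IsWeakEquiv hn)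
    (st : IsPartialLift f' a h l m ψ ω) (hm : ((m + 1 : ℕ) : ℕ∞) ≤ n) (hl : 0 < l)
    (ha : Continuous a) (hh : KContOn h (Cube.boundary (Fin k))) :
    ∃ (y : (Fin k → I) × (Fin m → I) × (Fin (m + 1) → H) → G')
      (Γ : ((Fin k → I) × I) × (Fin m → I) × (Fin (m + 1) → H) → H'), KCont y ∧ KCont Γ ∧
      (∀ x τ g, (x ∈ Cube.boundary (Fin k) ∨ τ ∈ Cube.boundary (Fin m) ∨ ∃ i, g i = 1) →
        y (x, τ, g) = ψ x (AnMap.word (fun j => scaleParam l (τ j)) g)) ∧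
      (∀ x s τ g, (s = 0 ∨ x ∈ Cube.boundary (Fin k) ∨ τ ∈ Cube.boundary (Fin m) ∨
          (∃ i, g i = 1) ∨ s = 1 ∧ ∃ j, (l : ℝ≥0∞) ≤ scaleParam (l + f'.size) (τ j)) →
        Γ ((x, s), τ, g) = ω (x, s) (AnMap.word (fun j => scaleParam (l + f'.size) (τ j)) g)) ∧
      ∀ x τ τ' g, (∀ j, scaleParam (l + f'.size) (τ' j) = scaleParam l (τ j)) →
        Γ ((x, 1), τ', g) = f'.underlying hn (y (x, τ, g)) := by
  have hg1 : IsClosed ({1} : Set H) :=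
    have := CGMonoid.weakHausdorff (G := H)
    isClosed_singleton_of_weakHausdorff 1
  obtain ⟨u₀, hu₀, hu₀'⟩ := st.exists_pathSpace_family hn hm hl ha hh
  set L : ℝ≥0 := l + f'.size with hL
  have hL0 : 0 < L := lt_of_lt_of_le hl le_self_add
  have hLR : (0 : ℝ) < L := hL0
  have hlR : (0 : ℝ) < l := hl
  have hc : (0 : ℝ) < l / L := by positivity
  have hc' := inv_pos.2 hc
  have hc1 : (l / L : ℝ) ≤ 1 := (div_le_one hLR).2 (by exact_mod_cast le_self_add)
  have hPQ : ∀ z : (Fin m → I) × I, boxMap (l / L : ℝ) (boxMap (l / L : ℝ)⁻¹ z) = z := fun z => by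
    have := boxMap_boxMap hc' z
    rwa [inv_inv] at this
  obtain ⟨u, hu, hu1, hu2⟩ := lifts_cube_prod_cube_prod_pow hp hg1 hnd k m (m + 1)
    (IsWeakHomotopyEquiv.isTrivialKFibration hf' 1)
    (fun z => (a z.1.1).eval (AnMap.word (fun j => scaleParam L (z.1.2 j)) z.2)) u₀
    (by
      have := ((AnMap.wordContOn (ha.kCont.kContOn univ) (m + 1)).kContOn.comp_continuous
        (g := fun z : ((Fin k → I) × (Fin m → I)) × (Fin (m + 1) → H) =>
          (z.1.1, (fun j => scaleParam L (z.1.2 j)), z.2))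
        (continuous_word_scale L (by fun_prop) (by fun_prop) (by fun_prop)) (B := univ)
        fun z _ => mem_univ _)
      exact fun K _ _ _ p hp => this K p hp fun _ => mem_univ _)
    hu₀ (by
      rintro ⟨⟨x, τ⟩, g⟩ hz
      rw [pathFib, (hu₀' _ hz).2]
      dsimp only
      rw [boxMap_zero hc, st.homotopy_zero])
  -- The homotopy is read off from the paths of `u` through the inverse of the reparametrization.
  have hΓ : ∀ x s τ g, (x ∈ Cube.boundary (Fin k) ∨
      (boxMap (l / L : ℝ)⁻¹ (τ, s)).1 ∈ Cube.boundary (Fin m) ∨ ∃ i, g i = 1) →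
      (u ((x, (boxMap (l / L : ℝ)⁻¹ (τ, s)).1), g)).1.2 (boxMap (l / L : ℝ)⁻¹ (τ, s)).2 =
        ω (x, s) (AnMap.word (fun j => scaleParam L (τ j)) g) := by
    intro x s τ g hz
    rw [hu2 _ hz, (hu₀' _ hz).2]
    simp only [Prod.mk.eta, hPQ]
  refine ⟨fun z => (u ((z.1, z.2.1), z.2.2)).1.1,
    fun z => (u ((z.1.1, (boxMap (l / L : ℝ)⁻¹ (z.2.1, z.1.2)).1), z.2.2)).1.2
      (boxMap (l / L : ℝ)⁻¹ (z.2.1, z.1.2)).2, ?_, ?_, fun x τ g hz => ?_, ?_, ?_⟩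
  · exact continuous_pathSpace_fst.kCont.comp (hu.comp_continuous (by fun_prop))
  · have hQ : Continuous fun z : ((Fin k → I) × I) × (Fin m → I) × (Fin (m + 1) → H) =>
        boxMap (l / L : ℝ)⁻¹ (z.2.1, z.1.2) := (continuous_boxMap hc').comp (by fun_prop)
    intro K _ _ _ p hp
    exact continuous_pathSpace_eval.comp ((hu K
      (fun z => (((p z).1.1, (boxMap (l / L : ℝ)⁻¹ ((p z).2.1, (p z).1.2)).1), (p z).2.2))
      (by
        have := hQ.fst.comp hp
        have h1 : Continuous fun z => (p z).1.1 := by fun_prop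
        have h2 : Continuous fun z => (p z).2.2 := by fun_prop
        exact (h1.prodMk this).prodMk h2)).prodMk (hQ.snd.comp hp))
  · dsimp only
    rw [hu2 _ hz, (hu₀' _ hz).1]
  · rintro x s τ g (rfl | hx | ⟨j, hj | hj⟩ | hg | ⟨rfl, j, hj⟩)
    · dsimp only
      rw [boxMap_zero hc', st.homotopy_zero]
      exact hu1 ((x, τ), g)
    · exact hΓ x s τ g (Or.inl hx)
    · exact hΓ x s τ g (Or.inr (Or.inl ⟨j, Or.inl (boxMap_fst_eq_zero hc' hj)⟩))
    · obtain ⟨i, hi⟩ := boxMap_inv_fst_eq_one hc (z := (τ, s)) (norm_boxVec_of_fst hj) (j := j)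
        (by
          dsimp only
          rw [hj]
          exact hc1)
      exact hΓ x s τ g (Or.inr (Or.inl ⟨i, Or.inr hi⟩))
    · exact hΓ x s τ g (Or.inr (Or.inr hg))
    · obtain ⟨i, hi⟩ := boxMap_inv_fst_eq_one hc (z := (τ, 1)) (norm_boxVec_of_snd rfl) (j := j)
        (div_le_of_le_scaleParam hL0 hj)
      exact hΓ x 1 τ g (Or.inr (Or.inl ⟨i, Or.inr hi⟩))
  · intro x τ τ' g hτ
    obtain ⟨h1, h2⟩ := boxMap_one hc hc1 τ
    have e : (τ', (1 : I)) = boxMap (l / L : ℝ) (τ, 1) := by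
      refine Prod.ext (funext fun j => ?_) h1.symm
      have := (hτ j).trans (scaleParam_eq_scaleParam hL0 (h2 j)).symm
      exact (clipParam_scaleParam hL0 (τ' j)).symm.trans
        ((congrArg _ this).trans (clipParam_scaleParam hL0 _))
    dsimp only
    rw [e, boxMap_boxMap hc]
    exact (u ((x, τ), g)).2

/-- A partial lift extends to words with one more letter. -/
theorem IsPartialLift.exists_succ [CGMonoid G'] [CGMonoid H] [CGMonoid H'] (hn : 1 ≤ n)
    (hp : ∀ (E N : Type u) [TopologicalSpace E] [TopologicalSpace N] (q : E → N),
      IsTrivialKFibration q → Lifts q ({1} : Set H))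
    (hnd : IsNDR ({1} : Set H)) (hf' : f'.IsWeakEquiv hn)
    (st : IsPartialLift f' a h l m ψ ω) (hl : 0 < l)
    (ha : Continuous a) (hh : KContOn h (Cube.boundary (Fin k))) :
    ∃ ψ' ω', IsPartialLift f' a h l (m + 1) ψ' ω' ∧
      (∀ x w, w.length ≤ m → ψ' x w = ψ x w) ∧ ∀ z w, w.length ≤ m → ω' z w = ω z w := by
  classical
  by_cases hm : ((m + 1 : ℕ) : ℕ∞) ≤ n
  swap
  · exact ⟨ψ, ω, { st with
      continuous_lift := fun h => absurd h hm
      continuous_homotopy := fun h => absurd h hm }, fun _ _ _ => rfl, fun _ _ _ => rfl⟩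
  have hm' : (m : ℕ∞) ≤ n := le_trans (Nat.cast_le.2 m.le_succ) hm
  have hL0 : 0 < l + f'.size := lt_of_lt_of_le hl le_self_add
  obtain ⟨y, Γ, hy, hΓ, hy1, hΓ1, hyΓ⟩ := st.exists_extend_letter hn hp hnd hf' hm hl ha hh
  obtain ⟨ψ', p1, p2, p3, p4, p5⟩ := WordContOn.exists_extension hm hl st.isWordMap_lift
    (st.continuous_lift hm') (Cube.boundary (Fin k)) y hy hy1
  obtain ⟨ω₁, q1, q2, q3, q4, q5⟩ := WordContOn.exists_extension hm hL0 st.isWordMap_homotopy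
    (st.continuous_homotopy hm') {z | z.2 = 0 ∨ z.1 ∈ Cube.boundary (Fin k)} Γ hΓ
    (by
      rintro ⟨x, s⟩ τ g ((hs | hx) | hτ | hg)
      · exact hΓ1 x s τ g (Or.inl hs)
      · exact hΓ1 x s τ g (Or.inr (Or.inl hx))
      · exact hΓ1 x s τ g (Or.inr (Or.inr (Or.inl hτ)))
      · exact hΓ1 x s τ g (Or.inr (Or.inr (Or.inr (Or.inl hg)))))
  have hshort : ∀ x (w : List (ℝ≥0∞ × H)), w.length ≤ m →
      f'.eval (imageWord (ψ' x) l w) = ω₁ (x, 1) w := by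
    intro x w hw
    rw [imageWord_congr fun v hv => p3 x v (hv.trans hw), q3 _ _ hw,
      st.homotopy_one _ _ (le_trans (Nat.cast_le.2 hw) hm')]
  -- Both sides are maps on words, so it suffices to compare them on irreducible words.
  have hend : ∀ x (w : List (ℝ≥0∞ × H)), w.length ≤ m + 1 →
      f'.eval (imageWord (ψ' x) l w) = ω₁ (x, 1) w := by
    intro x
    refine (f'.isWordMap.comp (p1 x)).ext_irreducible (q1 (x, 1)) hm fun w hirr hw => ?_
    rcases hw.lt_or_eq with hw | hw
    · exact hshort x w (by omega)
    obtain ⟨T, g, rfl⟩ := hirr.eq_word hw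
    obtain ⟨g₀, v, hv, -, hv'⟩ := hirr
    have hT : ∀ j, T j ≤ ((l + f'.size : ℝ≥0) : ℝ≥0∞) := by
      intro j
      have hj : (T j, g j.succ) ∈ v := by
        rw [← (List.cons.inj hv).2]
        exact List.mem_ofFn.2 ⟨j, rfl⟩
      exact (hv' _ hj).2.1.le
    have e1 : AnMap.word T g = AnMap.word (fun j => scaleParam (l + f'.size)
        (clipParam (l + f'.size) (T j))) g := by
      simp only [scaleParam_clipParam hL0, fun j => min_eq_left (hT j)]
    by_cases hcut : ∃ j, (l : ℝ≥0∞) < T j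
    · -- The values of both sides are already determined by `ψ` and `ω`.
      obtain ⟨j, hj⟩ := hcut
      have e2 : imageWord (ψ' x) l (AnMap.word T g) = imageWord (ψ x) l (AnMap.word T g) :=
        imageWord_congr_of_cut ⟨(T j, g j.succ), List.mem_ofFn.2 ⟨j, rfl⟩, hj⟩
          fun w hw => p3 x w (by simpa using hw)
      rw [e2, ← st.homotopy_one _ _ (by rw [AnMap.length_word]; exact hm), e1, q4,
        hΓ1 _ _ _ _ (Or.inr (Or.inr (Or.inr (Or.inr ⟨rfl, j, ?_⟩))))]
      rw [scaleParam_clipParam hL0, min_eq_left (hT j)]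
      exact hj.le
    · -- Without a cut, the composite is computed by the underlying map.
      push Not at hcut
      have e2 : AnMap.word T g = AnMap.word (fun j => scaleParam l (clipParam l (T j))) g := by
        simp only [scaleParam_clipParam hl, fun j => min_eq_left (hcut j)]
      have e3 : imageWord (ψ' x) l (AnMap.word T g) = [((0 : ℝ≥0∞) - l, ψ' x (AnMap.word T g))] :=
        imageWord_of_le (l := l) fun z hz => by
          obtain ⟨j, rfl⟩ := (List.mem_ofFn' _ _).1 hz
          exact hcut j
      rw [e3, ← AnMap.underlying_eq hn, e2, p4, ← e2, e1, q4,
        hyΓ x (fun j => clipParam l (T j))]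
      intro j
      rw [scaleParam_clipParam hL0, scaleParam_clipParam hl, min_eq_left (hT j),
        min_eq_left (hcut j)]
  -- At the end, the homotopy has to be the composite on words of every length, not only on those of
  -- length at most `m + 1`.
  let ω' : (Fin k → I) × I → List (ℝ≥0∞ × H) → H' := fun z =>
    if z.1 ∉ Cube.boundary (Fin k) ∧ z.2 = 1 then fun w => f'.eval (imageWord (ψ' z.1) l w)
    else ω₁ z
  have hω' : ∀ z (w : List (ℝ≥0∞ × H)), w.length ≤ m + 1 → ω' z w = ω₁ z w := by
    rintro ⟨x, s⟩ w hw
    by_cases hz : x ∉ Cube.boundary (Fin k) ∧ s = 1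
    · obtain ⟨hx, rfl⟩ := hz
      simp only [ω', hx, not_false_eq_true, and_self, if_true]
      exact hend x w hw
    · exact congrFun (if_neg hz) w
  have hωb : ∀ x ∈ Cube.boundary (Fin k), ∀ s, ω' (x, s) = ω (x, s) := fun x hx s =>
    (if_neg fun hz => hz.1 hx).trans (q2 _ (Or.inr hx))
  refine ⟨ψ', ω', ⟨p1, fun z => ?_, fun x hx => (p2 x hx).trans (st.lift_boundary x hx),
    fun x => ?_, fun x hx s => (hωb x hx s).trans (st.homotopy_boundary x hx s), fun x w hw => ?_,
    fun _ => p5, fun _ => q5.congr fun z _ w hw => hω' z w hw⟩, p3,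
    fun z w hw => (hω' z w (by omega)).trans (q3 z w hw)⟩
  · by_cases hz : z.1 ∉ Cube.boundary (Fin k) ∧ z.2 = 1
    · simp only [ω', if_pos hz]
      exact f'.isWordMap.comp (p1 z.1)
    · simp only [ω', if_neg hz]
      exact q1 z
  · exact (if_neg fun hz => zero_ne_one hz.2).trans ((q2 _ (Or.inl rfl)).trans (st.homotopy_zero x))
  · by_cases hx : x ∈ Cube.boundary (Fin k)
    · rw [hωb x hx, st.homotopy_one _ _ hw, p2 x hx]
    · exact congrFun (if_pos ⟨hx, rfl⟩) w

end Step

/-! ### Passage to the limit -/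

/-- A map that agrees with maps on words up to every length is a map on words. -/
theorem IsWordMap.of_agree {n : ℕ∞} {G G' : Type u} [Monoid G] [Monoid G'] {l : ℝ≥0}
    {φ : List (ℝ≥0∞ × G) → G'}
    (h : ∀ m : ℕ, ∃ φ', IsWordMap n l φ' ∧ ∀ w : List (ℝ≥0∞ × G), w.length ≤ m → φ w = φ' w) :
    IsWordMap n l φ where
  nil := by
    obtain ⟨φ', h, e⟩ := h 0
    rw [e _ (by simp), h.nil]
  head t t' a v := by
    obtain ⟨φ', h, e⟩ := h (v.length + 1)
    rw [e _ (by simp), e _ (by simp), h.head t t']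
  one t := by
    obtain ⟨φ', h, e⟩ := h 1
    rw [e _ (by simp), h.one]
  zero u v t c b hn := by
    obtain ⟨φ', h, e⟩ := h (u.length + 2 + v.length)
    rw [e _ (by simp; omega), e _ (by simp; omega), h.zero u v t c b hn]
  mul u v t b ht hn := by
    obtain ⟨φ', h, e⟩ := h (u.length + 1 + v.length)
    rw [e (u ++ (t, b) :: v) (by simp; omega), e u (by omega), e ((t, b) :: v) (by simp),
      h.mul u v t b ht hn]
  degen u v t t' b hn := by
    obtain ⟨φ', h, e⟩ := h (u.length + 2 + v.length)
    rw [e _ (by simp; omega), e _ (by simp; omega), h.degen u v t t' b hn]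
  degen_last u t hn := by
    obtain ⟨φ', h, e⟩ := h (u.length + 1)
    rw [e _ (by simp), e _ (by simp), h.degen_last u t hn]

section Families

variable {n : ℕ∞} {G G' : Type u} [Monoid G] [Monoid G'] [TopologicalSpace G] [TopologicalSpace G']
  {X : Type v} [TopologicalSpace X] {l : ℝ≥0}

/-- A continuous family of maps on words is a continuous family of `A_n`-maps. -/
theorem AnMap.exists_family {φ : X → List (ℝ≥0∞ × G) → G'} (h : ∀ x, IsWordMap n l (φ x))
    (hc : ∀ m : ℕ, (m : ℕ∞) ≤ n → WordContOn m φ univ) :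
    ∃ F : X → AnMap n G G', KCont F ∧ ∀ x, (F x).size = l ∧
      ∀ w : List (ℝ≥0∞ × G), (w.length : ℕ∞) ≤ n → (F x).eval w = φ x w := by
  let F : X → AnMap n G G' := fun x => (h x).toAnMap fun m hm K p =>
    (hc (m + 1) (by exact_mod_cast Order.add_one_le_of_lt hm)).kContOn K (fun z => (x, p z))
      (by fun_prop) fun _ => mem_univ _
  have hF : ∀ x (w : List (ℝ≥0∞ × G)), (w.length : ℕ∞) ≤ n → (F x).eval w = φ x w := fun x w hw =>
    AnMap.eval_toAnMap _ _ w hw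
  refine ⟨F, fun K _ _ _ p hp => ?_, fun x => ⟨rfl, hF x⟩⟩
  refine AnMap.continuous_of_wordContOn continuous_const fun m hm => ?_
  exact ((hc m hm).comp hp fun _ _ => mem_univ _).congr fun z _ w hw =>
    hF _ w (le_trans (Nat.cast_le.2 hw) hm)

end Families

section Limit

variable {n : ℕ∞} {G' H H' : Type u} [Monoid G'] [TopologicalSpace G'] [CGMonoid G']
  [Monoid H] [TopologicalSpace H] [CGMonoid H] [Monoid H'] [TopologicalSpace H'] [CGMonoid H']
  {k : ℕ} {f' : AnMap n G' H'} {l : ℝ≥0}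

/-- The lifting problem for composition with a weak equivalence over a cube, with constant paths over
the boundary, is solvable if the sizes are constant and positive. -/
theorem AnMap.cubeLift_comp (hn : 1 ≤ n)
    (hp : ∀ (E N : Type u) [TopologicalSpace E] [TopologicalSpace N] (q : E → N),
      IsTrivialKFibration q → Lifts q ({1} : Set H))
    (hnd : IsNDR ({1} : Set H)) (hf' : f'.IsWeakEquiv hn) (hl : 0 < l)
    {a : (Fin k → I) → AnMap n H H'} {h : (Fin k → I) → AnMap n H G'}
    (ha : Continuous a) (hh : KContOn h (Cube.boundary (Fin k)))
    (hs : ∀ x ∈ Cube.boundary (Fin k), (h x).size = l) (hsa : ∀ x, (a x).size = l + f'.size)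
    (hc : ∀ x ∈ Cube.boundary (Fin k), f'.comp (h x) = a x) :
    CubeLift (pathFib fun h : AnMap n H G' => f'.comp h) a
      (fun y => PathSpace.const (fun h : AnMap n H G' => f'.comp h) (h y)) := by
  let S : ℕ → Type u := fun m => {p : ((Fin k → I) → List (ℝ≥0∞ × H) → G') ×
    ((Fin k → I) × I → List (ℝ≥0∞ × H) → H') // IsPartialLift f' a h l m p.1 p.2}
  have hS : ∀ m (p : S m), ∃ p' : S (m + 1), (∀ x w, w.length ≤ m → p'.1.1 x w = p.1.1 x w) ∧
      ∀ z w, w.length ≤ m → p'.1.2 z w = p.1.2 z w := by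
    rintro m ⟨⟨ψ, ω⟩, st⟩
    obtain ⟨ψ', ω', st', h1, h2⟩ := st.exists_succ hn hp hnd hf' hl ha hh
    exact ⟨⟨(ψ', ω'), st'⟩, h1, h2⟩
  choose next hnext using hS
  obtain ⟨ψ₀, ω₀, st₀⟩ := exists_isPartialLift_zero (f' := f') hs hsa hc
  let s : ∀ m, S m := fun m => Nat.rec ⟨(ψ₀, ω₀), st₀⟩ next m
  have h1 : ∀ m N, m ≤ N → ∀ x w, w.length ≤ m → (s N).1.1 x w = (s m).1.1 x w := by
    intro m N hN x w hw
    induction N, hN using Nat.le_induction with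
    | base => rfl
    | succ N hN ih => exact ((hnext N (s N)).1 x w (hw.trans hN)).trans ih
  have h2 : ∀ m N, m ≤ N → ∀ z w, w.length ≤ m → (s N).1.2 z w = (s m).1.2 z w := by
    intro m N hN x w hw
    induction N, hN using Nat.le_induction with
    | base => rfl
    | succ N hN ih => exact ((hnext N (s N)).2 x w (hw.trans hN)).trans ih
  -- The stages stabilize on words of any given length.
  let ψ : (Fin k → I) → List (ℝ≥0∞ × H) → G' := fun x w => (s w.length).1.1 x w
  let ω : (Fin k → I) × I → List (ℝ≥0∞ × H) → H' := fun z w => (s w.length).1.2 z w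
  have hψ : ∀ m x (w : List (ℝ≥0∞ × H)), w.length ≤ m → ψ x w = (s m).1.1 x w := fun m x w hw =>
    (h1 _ _ hw x w le_rfl).symm
  have hω : ∀ m z (w : List (ℝ≥0∞ × H)), w.length ≤ m → ω z w = (s m).1.2 z w := fun m z w hw =>
    (h2 _ _ hw z w le_rfl).symm
  obtain ⟨g, hg, hg'⟩ := AnMap.exists_family (n := n) (φ := ψ) (l := l)
    (fun x => .of_agree fun m => ⟨_, (s m).2.isWordMap_lift x, hψ m x⟩)
    fun m hm => ((s m).2.continuous_lift hm).congr fun x _ w hw => hψ m x w hw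
  obtain ⟨F, hF, hF'⟩ := AnMap.exists_family (n := n) (φ := ω) (l := l + f'.size)
    (fun z => .of_agree fun m => ⟨_, (s m).2.isWordMap_homotopy z, hω m z⟩)
    fun m hm => ((s m).2.continuous_homotopy hm).congr fun x _ w hw => hω m x w hw
  have hF0 : ∀ z x, (∀ m, (s m).1.2 z = (a x).eval) → F z = a x := by
    intro z x hz
    refine AnMap.ext_eval ((hF' z).1.trans (hsa x).symm) fun w hw => ?_
    rw [(hF' z).2 w hw]
    exact congrFun (hz _) w
  refine cubeLift_pathFib g hg.continuous F hF.continuous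
    (fun x => hF0 _ _ fun m => (s m).2.homotopy_zero x) (fun x => ?_) (fun x hx => ?_)
    fun x hx t => ?_
  · refine AnMap.ext_eval ?_ fun w hw => ?_
    · rw [(hF' _).1, AnMap.size_comp, (hg' x).1]
    · rw [(hF' _).2 w hw, AnMap.eval_comp _ _ _ hw, (hg' x).1]
      refine ((s w.length).2.homotopy_one x w hw).trans ?_
      congr 1
      refine imageWord_congr fun v hv => ?_
      rw [(hg' x).2 v (le_trans (Nat.cast_le.2 hv) hw), hψ w.length x v hv]
  · refine AnMap.ext_eval ((hg' x).1.trans (hs x hx).symm) fun w hw => ?_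
    rw [(hg' x).2 w hw]
    exact congrFun ((s w.length).2.lift_boundary x hx) w
  · rw [hc x hx]
    exact hF0 _ _ fun m => (s m).2.homotopy_boundary x hx t

end Limit

/-! ### Composition with a weak equivalence -/

section Composition

variable {n : ℕ∞} {G G' G'' H H' : Type u} [Monoid G] [TopologicalSpace G]
  [Monoid G'] [TopologicalSpace G'] [Monoid G''] [TopologicalSpace G'']
  [Monoid H] [TopologicalSpace H] [Monoid H'] [TopologicalSpace H']

namespace AnMap

theorem continuous_comp_left (f' : AnMap n G' G'') :
    Continuous fun f : AnMap n G G' => f'.comp f :=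
  continuous_of_kCont (kContOn_univ.1 (kContOn_comp (continuous_const.kCont.kContOn _)
    (continuous_id.kCont.kContOn _)))

theorem continuous_comp_right (f : AnMap n G G') :
    Continuous fun f' : AnMap n G' G'' => f'.comp f :=
  continuous_of_kCont (kContOn_univ.1 (kContOn_comp (continuous_id.kCont.kContOn _)
    (continuous_const.kCont.kContOn _)))

instance : Nonempty (AnMap n G G') :=
  ⟨(isWordMap_one 0).toAnMap fun _ _ _ _ => continuous_const⟩

theorem size_raise (f : AnMap n G G') (r : ℝ≥0) : (f.raise r).size = max f.size r := rfl

theorem raise_zero (f : AnMap n G G') : f.raise 0 = f := raise_of_le f zero_le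

end AnMap

/-- Composition with a weak equivalence induces a weak equivalence between spaces of `A_n`-maps on a
well-pointed monoid of the homotopy type of a CW complex. The sizes in a lifting problem are first
raised to constant positive ones. -/
theorem AnMap.isWeakHomotopyEquiv_comp_left [CGMonoid G'] [CGMonoid H] [CGMonoid H'] (hn : 1 ≤ n)
    (hH : WellPointed H) (hHcw : HasCWType H) (f' : AnMap n G' H') (hf' : f'.IsWeakEquiv hn) :
    IsWeakHomotopyEquiv fun h : AnMap n H G' => f'.comp h := by
  have hp : Continuous fun h : AnMap n H G' => f'.comp h := continuous_comp_left f'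
  refine isWeakHomotopyEquiv_of_lifts hp fun m => lifts_pathFib_of_const fun w k hw hk hwk => ?_
  obtain ⟨r, hr0, hr⟩ : ∃ r : ℝ≥0, 0 < r ∧ ∀ y, (w y).size ≤ r := by
    obtain ⟨r, hr⟩ := (isCompact_range (continuous_size.comp hw)).bddAbove
    exact ⟨r + 1, by positivity, fun y => (hr (mem_range_self y)).trans le_self_add⟩
  have hrk : ∀ y ∈ Cube.boundary (Fin m), (k y).size ≤ r := fun y hy => by
    have := hr y
    rw [hwk y hy, size_comp] at this
    exact le_self_add.trans this
  have ht : ∀ t : I, unitInterval.toNNReal t ≤ 1 := fun t => t.2.2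
  have h1 := cubeLift_pathFib_of_homotopy hp hw
    (k := fun z : (Fin m → I) × I => (k z.1).raise (unitInterval.toNNReal z.2 * r))
    (kContOn_raise (hk.comp_continuous continuous_fst fun z hz => hz)
      (Continuous.continuousOn (by fun_prop)))
    (fun y hy => by
      rw [hwk y hy]
      simp only [unitInterval.toNNReal_zero, zero_mul, raise_zero])
  simp only [unitInterval.toNNReal_zero, zero_mul, raise_zero] at h1
  refine h1 fun w₁ hw₁ hwk₁ hran => ?_
  simp only [unitInterval.toNNReal_one, one_mul] at hwk₁ ⊢
  have hs1 : ∀ y ∈ Cube.boundary (Fin m), ((k y).raise r).size = r := fun y hy =>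
    max_eq_right (hrk y hy)
  have hr₁ : ∀ y, (w₁ y).size ≤ r + f'.size := by
    intro y
    rcases hran y with ⟨y', e⟩ | ⟨z, hz, e⟩
    · rw [e]
      exact (hr y').trans le_self_add
    · rw [e, size_comp, size_raise]
      gcongr
      exact max_le (hrk _ hz) (mul_le_of_le_one_left zero_le (ht z.2))
  have hw₁s : ∀ y ∈ Cube.boundary (Fin m), (w₁ y).size = r + f'.size := fun y hy => by
    rw [hwk₁ y hy, size_comp, hs1 y hy]
  have h2 := (isKFibration_pathFib fun h : AnMap n H G' => f'.comp h).cubeLift_of_homotopy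
    (w := fun z : (Fin m → I) × I =>
      (w₁ z.1).raise (unitInterval.toNNReal z.2 * (r + f'.size)))
    (u₀ := fun z => PathSpace.const (fun h : AnMap n H G' => f'.comp h) ((k z.1).raise r))
    (kContOn_univ.1 (kContOn_raise ((hw₁.comp continuous_fst).kCont.kContOn _)
      (Continuous.continuousOn (by fun_prop)))).continuous
    ((PathSpace.continuous_const hp).kCont.comp_kContOn
      (kContOn_raise (hk.comp_continuous continuous_fst fun z hz => hz) continuousOn_const))
    (fun z hz => by
      have e : unitInterval.toNNReal z.2 * (r + f'.size) ≤ (w₁ z.1).size :=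
        (mul_le_of_le_one_left zero_le (ht z.2)).trans (hw₁s _ hz).ge
      rw [raise_of_le (w₁ z.1) e, hwk₁ _ hz]
      rfl)
  simp only [unitInterval.toNNReal_zero, zero_mul, raise_zero,
    unitInterval.toNNReal_one, one_mul] at h2
  refine h2 (cubeLift_comp hn (fun E N _ _ q hq => lifts_unit hH hHcw hq) hH.isNDR hf' hr0
    (kContOn_univ.1 (kContOn_raise (hw₁.kCont.kContOn _) continuousOn_const)).continuous
    (kContOn_raise hk continuousOn_const) hs1 (fun y => max_eq_right (hr₁ y)) fun y hy => ?_)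
  rw [raise_of_le _ (hw₁s y hy).ge, hwk₁ y hy]

end Composition

/-! ### Homotopy inverses -/

section HomotopyInverse

variable {n : ℕ∞} {G G' G'' H : Type u} [Monoid G] [TopologicalSpace G]
  [Monoid G'] [TopologicalSpace G'] [Monoid G''] [TopologicalSpace G'']
  [Monoid H] [TopologicalSpace H]

namespace AnMap

theorem _root_.Joined.comp_right {f' f₁' : AnMap n G' G''} (h : Joined f' f₁') (f : AnMap n G G') :
    Joined (f'.comp f) (f₁'.comp f) :=
  h.map (continuous_comp_right f)

/-- A weak equivalence between well-pointed monoids of the homotopy type of CW complexes is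
invertible up to homotopy. -/
theorem exists_homotopy_inverse [CGMonoid G] [CGMonoid H] (hn : 1 ≤ n) (hG : WellPointed G)
    (hGcw : HasCWType G) (hH : WellPointed H) (hHcw : HasCWType H) (f : AnMap n G H)
    (hf : f.IsWeakEquiv hn) :
    ∃ e : AnMap n H G, Joined (e.comp f) (identity n G) ∧ Joined (f.comp e) (identity n H) := by
  obtain ⟨hc, ⟨-, hsurj⟩, -⟩ := isWeakHomotopyEquiv_comp_left hn hH hHcw f hf
  obtain ⟨hc', ⟨hinj, -⟩, -⟩ := isWeakHomotopyEquiv_comp_left hn hG hGcw f hf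
  obtain ⟨b, hb⟩ := hsurj (ZerothHomotopy.mk (identity n H))
  obtain ⟨e, rfl⟩ := Quotient.exists_rep b
  have he : Joined (f.comp e) (identity n H) := zerothHomotopy_mk_eq_iff.1 hb
  refine ⟨e, zerothHomotopy_mk_eq_iff.1 (hinj (zerothHomotopy_mk_eq_iff.2 ?_)), he⟩
  have hef := he.comp_right f
  rw [comp_assoc, identity_comp] at hef
  change Joined (f.comp (e.comp f)) (f.comp (identity n G))
  rwa [comp_identity]

/-- Precomposition with an `A_n`-map in the path component of the identity is a weak equivalence. -/
theorem isWeakHomotopyEquiv_comp_of_joined [CGMonoid G] {g : AnMap n G G}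
    (hg : Joined g (identity n G)) : IsWeakHomotopyEquiv fun h : AnMap n G G' => h.comp g := by
  obtain ⟨γ⟩ := hg.symm
  refine isWeakHomotopyEquiv_of_homotopy_id (fun z => z.1.comp (γ z.2))
    (continuous_of_kCont_prod (kContOn_univ.1 (kContOn_comp (continuous_fst.kCont.kContOn _)
      ((γ.continuous.comp continuous_snd).kCont.kContOn _)))) (fun h => ?_) fun h => ?_
  · simp only [γ.source, comp_identity]
  · simp only [γ.target]

end AnMap

end HomotopyInverse

theorem mainTheorem7 {n : ℕ∞} (hn : 1 ≤ n)
    {G G' H H' : Type u}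
    [Monoid G] [TopologicalSpace G] [CGMonoid G]
    [Monoid G'] [TopologicalSpace G'] [CGMonoid G']
    [Monoid H] [TopologicalSpace H] [CGMonoid H]
    [Monoid H'] [TopologicalSpace H'] [CGMonoid H']
    (hG : WellPointed G) (hGcw : HasCWType G)
    (hH : WellPointed H) (hHcw : HasCWType H)
    (f : AnMap n G H) (hf : f.IsWeakEquiv hn)
    (f' : AnMap n G' H') (hf' : f'.IsWeakEquiv hn) :
    IsWeakHomotopyEquiv (fun h : AnMap n H G' => h.comp f) ∧
    IsWeakHomotopyEquiv (fun h : AnMap n H G' => f'.comp h) ∧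
    ∃ e : AnMap n H G,
      ZerothHomotopy.mk (e.comp f) = ZerothHomotopy.mk (AnMap.identity n G) ∧
      ZerothHomotopy.mk (f.comp e) = ZerothHomotopy.mk (AnMap.identity n H) := by
  obtain ⟨e, he, he'⟩ := AnMap.exists_homotopy_inverse hn hG hGcw hH hHcw f hf
  refine ⟨?_, AnMap.isWeakHomotopyEquiv_comp_left hn hH hHcw f' hf', e,
    zerothHomotopy_mk_eq_iff.2 he, zerothHomotopy_mk_eq_iff.2 he'⟩
  refine isWeakHomotopyEquiv_of_homotopyEquiv (AnMap.continuous_comp_right f)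
    (AnMap.continuous_comp_right e) ?_ ?_
  · refine (congrArg IsWeakHomotopyEquiv (funext fun h => ?_)).mpr
      (AnMap.isWeakHomotopyEquiv_comp_of_joined (G' := G') he')
    exact AnMap.comp_assoc h f e
  · refine (congrArg IsWeakHomotopyEquiv (funext fun h => ?_)).mpr
      (AnMap.isWeakHomotopyEquiv_comp_of_joined (G' := G') he)
    exact AnMap.comp_assoc h e f
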